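/- **Setting.** Let $\mathbb{R}^{1,1}$ be two-dimensional Minkowski space with coordinates $(t,x)$ and metric $g=dt^2-dx^2$. Its spinor bundle is trivial with fibre $\Sigma=\mathbb{C}^2$, with flat connection, Clifford multiplication $$\partial_t\cdot=\begin{pmatrix}0&1\\1&0\end{pmatrix},\qquad \partial_x\cdot=\begin{pmatrix}0&1\\-1&0\end{pmatrix},$$ and indefinite Hermitian product $\langle\xi,\psi\rangle=\xi_2\overline{\psi_1}+\xi_1\overline{\psi_2}$. Thus $X\cdot Y\cdot\psi+Y\cdot X\cdot\psi=2g(X,Y)\psi$, Clifford multiplication is symmetric for $\langle\cdot,\cdot\rangle$, and $\langle\partial_t\cdot\psi,\psi\rangle=|\psi_1|^2+|\psi_2|^2$ is positive definite. Let $(N,h)$ be a compact smooth Riemannian manifold (without boundary) with Levi-Civita connection $\nabla$, Christoffel symbols $\Gamma^\alpha_{\beta\gamma}$, and curvature tensor $R^N(X,Y)=\nabla_X\nabla_Y-\nabla_Y\nabla_X-\nabla_{[X,Y]}$, $R^N(\partial_\gamma,\partial_\delta)\partial_\beta=R^\alpha{}_{\beta\gamma\delta}\partial_\alpha$. The Dirac-wave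 map system for a map $\phi\colon\mathbb{R}^{1,1}\to N$ and a vector spinor $\psi\in\Gamma(\Sigma\otimes\phi^*TN)$ is $$\tau(\phi)=\tfrac12\big(R^N(\psi,i\partial_t\cdot\psi)\,d\phi(\partial_t)-R^N(\psi,i\partial_x\cdot\psi)\,d\phi(\partial_x)\big),\qquad \partial_t\cdot\tilde\nabla_{\partial_t}\psi-\partial_x\cdot\tilde\nabla_{\partial_x}\psi=0,$$ where $\tau(\phi)=\frac{\nabla}{\partial t}d\phi(\partial_t)-\frac{\nabla}{\partial x}d\phi(\partial_x)$, $\tilde\nabla$ is the induced connection on $\Sigma\otimes\phi^*TN$, and $R^N(\psi,iX\cdot\psi)=\langle\psi^\gamma,iX\cdot\psi^\delta\rangle R^N(\partial_\gamma,\partial_\delta)$. In local coordinates on $N$ it reads $$\phi^\alpha_{tt}-\phi^\alpha_{xx}+\Gamma^\alpha_{\beta\gamma}(\phi)(\phi^\beta_t\phi^\gamma_t-\phi^\beta_x\phi^\gamma_x)=\tfrac12R^\alpha{}_{\beta\gamma\delta}(\phi)\big(\langle\psi^\gamma,i\partial_t\cdot\psi^\delta\rangle\phi^\beta_t-\langle\psi^\gamma,i\partial_x\cdot\psi^\delta\rangle\phi^\beta_x\big),$$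 $$\partial_t\cdot\big(\psi^\alpha_t+\Gamma^\alpha_{\beta\gamma}(\phi)\phi^\beta_t\psi^\gamma\big)-\partial_x\cdot\big(\psi^\alpha_x+\Gamma^\alpha_{\beta\gamma}(\phi)\phi^\beta_x\psi^\gamma\big)=0 .$$ A *global weak solution* is a pair $(\phi,\psi)$ defined on all of $\mathbb{R}^{1,1}$ such that $\phi$ is continuous and, for every chart $(U,y)$ of the atlas of $N$, on the open set $\phi^{-1}(U)$ the components $\phi^\alpha$ belong to $H^2_{\mathrm{loc}}$, the components $\psi^\alpha$ are continuous and belong to $H^1_{\mathrm{loc}}$, and the local equations above hold almost everywhere with weak derivatives. (This class contains the continuous representatives of all solutions with $\phi\in H^2_{\mathrm{loc}}(\mathbb{R}^{1,1},N)$ and $\psi\in H^1_{\mathrm{loc}}\cap W^{1,4}_{\mathrm{loc}}(\mathbb{R}^{1,1},\Sigma\otimes\phi^*TN)$.) Its *initial data* are $\phi(0,\cdot)$, $\frac{\partial\phi}{\partial t}(0,\cdot)$ (in the sense of traces, in every chart) and $\psi(0,\cdot)$. **Proposition (Uniqueness).** Let $(\phi,\psi)$ and $(\phi',\psi')$ be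 two global weak solutions of the Dirac-wave map system with values in $(N,h)$. If they have the same initial data at $t=0$, then they coincide for all times: $\phi(t,x)=\phi'(t,x)$ and $\psi(t,x)=\psi'(t,x)$ for all $(t,x)\in\mathbb{R}^{1,1}$. -/

import Mathlib

open MeasureTheory Set
open scoped Manifold ContDiff TensorProduct

noncomputable section

namespace DiracWave

/-! ### Weak derivatives on open subsets of the `(t, x)`-plane -/

section Sobolev

variable {F : Type*} [NormedAddCommGroup F] [NormedSpace ℝ F]

/-- Two-dimensional Minkowski space with its global coordinates `(t, x)`. -/
abbrev Spacetime : Type := ℝ × ℝ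

/-- The coordinate vector field `∂_t`. -/
abbrev dt : Spacetime := (1, 0)

/-- The coordinate vector field `∂_x`. -/
abbrev dx : Spacetime := (0, 1)

/-- The Minkowski metric, of signature `(+, -)`. -/
def minkowski (X Y : Spacetime) : ℝ := X.1 * Y.1 - X.2 * Y.2

/-- `θ ∈ C_c^∞(O)`. -/
structure IsTestFunction (O : Set Spacetime) (θ : Spacetime → ℝ) : Prop where
  smooth : ContDiff ℝ ∞ θ
  hasCompactSupport : HasCompactSupport θ
  tsupport_subset : tsupport θ ⊆ O

/-- `f ∈ L²_loc(O)`. -/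
def IsL2loc (O : Set Spacetime) (f : Spacetime → F) : Prop :=
  ∀ K : Set Spacetime, K ⊆ O → IsCompact K → MemLp f 2 (volume.restrict K)

/-- On the open set `O`, the locally integrable function `g` is the weak derivative of the locally
integrable function `f` in the direction `v`. The values of `f` and `g` outside `O` play no role,
since test functions on `O` vanish there. -/
structure HasWeakDeriv (O : Set Spacetime) (v : Spacetime) (f g : Spacetime → F) : Prop where
  locallyIntegrable : LocallyIntegrableOn f O
  locallyIntegrable_deriv : LocallyIntegrableOn g O
  integral_eq : ∀ θ : Spacetime → ℝ, IsTestFunction O θ →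
    ∫ z, (fderiv ℝ θ z v) • f z = - ∫ z, θ z • g z

/-- `f ∈ H¹_loc(O)`, with weak partial derivatives `ft = ∂_t f` and `fx = ∂_x f`. -/
structure IsH1loc (O : Set Spacetime) (f ft fx : Spacetime → F) : Prop where
  memL2 : IsL2loc O f
  memL2_dt : IsL2loc O ft
  memL2_dx : IsL2loc O fx
  weak_dt : HasWeakDeriv O dt f ft
  weak_dx : HasWeakDeriv O dx f fx

/-- `f` has a weak time derivative in `L²_loc(O)`, and its trace on the part of the line `t = 0`
that lies in `O` is `g`. The trace is characterised by Green's formula on the half plane `t > 0`. -/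
def HasInitialTrace (O : Set Spacetime) (f : Spacetime → F) (g : ℝ → F) : Prop :=
  LocallyIntegrableOn g {x : ℝ | ((0, x) : Spacetime) ∈ O} ∧
  ∃ f' : Spacetime → F, IsL2loc O f' ∧ HasWeakDeriv O dt f f' ∧
    ∀ θ : Spacetime → ℝ, IsTestFunction O θ →
      ∫ z in {z : Spacetime | 0 < z.1}, ((fderiv ℝ θ z dt) • f z + θ z • f' z)
        = - ∫ x : ℝ, θ (0, x) • g x

end Sobolev

/-! ### Spinors on two-dimensional Minkowski space -/

/-- The fibre of the (trivial, flat) spinor bundle of two-dimensional Minkowski space. -/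
abbrev Spinor : Type := Fin 2 → ℂ

/-- The matrix of Clifford multiplication by `∂_t`. -/
def gammaT : Matrix (Fin 2) (Fin 2) ℂ := !![0, 1; 1, 0]

/-- The matrix of Clifford multiplication by `∂_x`. -/
def gammaX : Matrix (Fin 2) (Fin 2) ℂ := !![0, 1; -1, 0]

/-- Clifford multiplication `X · ψ`. -/
def clifford (X : Spacetime) : Spinor →ₗ[ℂ] Spinor :=
  Matrix.toLin' ((X.1 : ℂ) • gammaT + (X.2 : ℂ) • gammaX)

/-- The indefinite Hermitian product of spinors, linear in the first and antilinear in the second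
slot. -/
def spinorProduct (ξ ψ : Spinor) : ℂ :=
  ξ 1 * (starRingEnd ℂ) (ψ 0) + ξ 0 * (starRingEnd ℂ) (ψ 1)

/-- The Clifford relations. -/
theorem clifford_relation (X Y : Spacetime) (ψ : Spinor) :
    clifford X (clifford Y ψ) + clifford Y (clifford X ψ)
      = ((2 * minkowski X Y : ℝ) : ℂ) • ψ := by
  ext i
  fin_cases i <;>
    simp [clifford, gammaT, gammaX, minkowski, dotProduct, Fin.sum_univ_two] <;>
    ring

/-- Clifford multiplication is symmetric. -/
theorem clifford_symm (X : Spacetime) (ξ ψ : Spinor) :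
    spinorProduct (clifford X ξ) ψ = spinorProduct ξ (clifford X ψ) := by
  simp [clifford, spinorProduct, gammaT, gammaX, Matrix.mulVec, dotProduct, Fin.sum_univ_two]
  ring

/-- The product `⟨∂_t · , ⟩` is positive definite. -/
theorem spinorProduct_dt_self (ψ : Spinor) :
    spinorProduct (clifford dt ψ) ψ = ((‖ψ 0‖ ^ 2 + ‖ψ 1‖ ^ 2 : ℝ) : ℂ) := by
  simp [clifford, spinorProduct, gammaT, gammaX, Matrix.mulVec, dotProduct, Fin.sum_univ_two,
    Complex.mul_conj, Complex.normSq_eq_norm_sq]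

/-! ### Riemannian geometry of the target in a chart -/

section Target

variable {n : ℕ} {N : Type*} [TopologicalSpace N] [ChartedSpace (EuclideanSpace ℝ (Fin n)) N]

/-- The partial derivative `∂f/∂y^i` of a function of the coordinates `y`. -/
def partialDeriv (i : Fin n) (f : EuclideanSpace ℝ (Fin n) → ℝ)
    (y : EuclideanSpace ℝ (Fin n)) : ℝ :=
  fderiv ℝ f y (EuclideanSpace.single i 1)

/-- The coordinate vector field `∂/∂y^i` of the chart `e`, at the point with coordinates `y`. -/
def coordVector (e : OpenPartialHomeomorph N (EuclideanSpace ℝ (Fin n)))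
    (y : EuclideanSpace ℝ (Fin n)) (i : Fin n) :
    TangentSpace 𝓘(ℝ, EuclideanSpace ℝ (Fin n)) (e.symm y) :=
  mfderiv 𝓘(ℝ, EuclideanSpace ℝ (Fin n)) 𝓘(ℝ, EuclideanSpace ℝ (Fin n)) e.symm y
    (EuclideanSpace.single i (1 : ℝ) : EuclideanSpace ℝ (Fin n))

/-- The coordinate differential `dy^i` of the chart `e`, at the point `p`. -/
def coordForm (e : OpenPartialHomeomorph N (EuclideanSpace ℝ (Fin n))) (p : N) (i : Fin n) :
    TangentSpace 𝓘(ℝ, EuclideanSpace ℝ (Fin n)) p →ₗ[ℝ] ℝ :=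
  (EuclideanSpace.proj i : EuclideanSpace ℝ (Fin n) →L[ℝ] ℝ).toLinearMap ∘ₗ
    (mfderiv 𝓘(ℝ, EuclideanSpace ℝ (Fin n)) 𝓘(ℝ, EuclideanSpace ℝ (Fin n)) e p).toLinearMap

section Metric

variable [IsManifold 𝓘(ℝ, EuclideanSpace ℝ (Fin n)) ∞ N]
  (h : Bundle.ContMDiffRiemannianMetric 𝓘(ℝ, EuclideanSpace ℝ (Fin n)) ∞
    (EuclideanSpace ℝ (Fin n))
    (fun p : N => TangentSpace 𝓘(ℝ, EuclideanSpace ℝ (Fin n)) p))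
  (e : OpenPartialHomeomorph N (EuclideanSpace ℝ (Fin n)))

/-- The components `h_ij(y)` of the Riemannian metric in the chart `e`. -/
def metricMatrix (y : EuclideanSpace ℝ (Fin n)) : Matrix (Fin n) (Fin n) ℝ :=
  Matrix.of fun i j => h.inner (e.symm y) (coordVector e y i) (coordVector e y j)

/-- The Christoffel symbols `Γ^k_ij(y)` of the Levi-Civita connection in the chart `e`. -/
def christoffel (k i j : Fin n) (y : EuclideanSpace ℝ (Fin n)) : ℝ :=
  (1 / 2) * ∑ l, (metricMatrix h e y)⁻¹ k l *
    (partialDeriv i (fun y' => metricMatrix h e y' j l) y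
      + partialDeriv j (fun y' => metricMatrix h e y' i l) y
      - partialDeriv l (fun y' => metricMatrix h e y' i j) y)

/-- The components `R^l_kij(y)` of the curvature tensor in the chart `e`, that is
`R(∂_i, ∂_j) ∂_k = R^l_kij ∂_l` with `R(X, Y) = ∇_X ∇_Y - ∇_Y ∇_X - ∇_[X,Y]`. -/
def curvature (l k i j : Fin n) (y : EuclideanSpace ℝ (Fin n)) : ℝ :=
  partialDeriv i (christoffel h e l j k) y - partialDeriv j (christoffel h e l i k) y
    + ∑ m, (christoffel h e l i m y * christoffel h e m j k y
      - christoffel h e l j m y * christoffel h e m i k y)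

/-! ### The Dirac-wave map operators in a chart

Here `y` stands for the coordinates of `φ`, `yt, yx, ytt, yxx` for those of its partial derivatives,
`s` for the components `ψ^α` of the vector spinor and `st, sx` for their partial derivatives. -/

/-- The component `α` of `τ(φ) = (∇/∂t) dφ(∂_t) - (∇/∂x) dφ(∂_x)`. -/
def tension (α : Fin n) (y yt yx ytt yxx : EuclideanSpace ℝ (Fin n)) : ℝ :=
  ytt α - yxx α
    + ∑ β, ∑ γ, christoffel h e α β γ y * (yt β * yt γ - yx β * yx γ)

/-- The component `α` of `R^N(ψ, i X · ψ) v`, where `R^N(ψ, i X · ψ)` stands for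
`⟨ψ^γ, i X · ψ^δ⟩ R^N(∂_γ, ∂_δ)`. As `R^N` is skew in `γ, δ`, only the skew part of
`⟨ψ^γ, i X · ψ^δ⟩` contributes, and this part is real. -/
def curvatureTerm (α : Fin n) (y : EuclideanSpace ℝ (Fin n)) (X : Spacetime) (s : Fin n → Spinor)
    (v : EuclideanSpace ℝ (Fin n)) : ℝ :=
  ∑ β, ∑ γ, ∑ δ, curvature h e α β γ δ y *
    (spinorProduct (s γ) (Complex.I • clifford X (s δ))).re * v β

/-- The component `α` of `D^{φ^*TN} ψ = ∂_t · ∇̃_{∂_t} ψ - ∂_x · ∇̃_{∂_x} ψ`. -/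
def twistedDirac (α : Fin n) (y yt yx : EuclideanSpace ℝ (Fin n))
    (s st sx : Fin n → Spinor) : Spinor :=
  clifford dt (st α + ∑ β, ∑ γ, (christoffel h e α β γ y * yt β) • s γ)
    - clifford dx (sx α + ∑ β, ∑ γ, (christoffel h e α β γ y * yx β) • s γ)

end Metric

/-- The skew part of `⟨ψ, i X · χ⟩` is real. -/
theorem spinorProduct_skew_im (X : Spacetime) (ψ χ : Spinor) :
    (spinorProduct ψ (Complex.I • clifford X χ)
      - spinorProduct χ (Complex.I • clifford X ψ)).im = 0 := by
  simp [clifford, spinorProduct, gammaT, gammaX, dotProduct, Fin.sum_univ_two]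
  ring

/-! ### Vector spinors, weak solutions and initial data -/

/-- The fibre `Σ ⊗ T_pN` of the twisted spinor bundle. -/
abbrev VectorSpinor (p : N) : Type :=
  Spinor ⊗[ℝ] TangentSpace 𝓘(ℝ, EuclideanSpace ℝ (Fin n)) p

/-- The components `ψ^α` of `ψ = ψ^α ⊗ ∂/∂y^α ∈ Σ ⊗ T_pN` in the chart `e`. -/
def spinorComponents (e : OpenPartialHomeomorph N (EuclideanSpace ℝ (Fin n))) (p : N)
    (s : VectorSpinor (n := n) p) : Fin n → Spinor :=
  fun α => TensorProduct.rid ℝ Spinor (LinearMap.lTensor Spinor (coordForm e p α) s)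

variable [IsManifold 𝓘(ℝ, EuclideanSpace ℝ (Fin n)) ∞ N]

/-- The vector spinor `ψ` along the map `φ` from Minkowski space to `(N, h)` forms with `φ` a global
weak solution of the Dirac-wave map system
`τ(φ) = (1/2) ε_j R^N(ψ, i e_j · ψ) dφ(e_j)`, `D^{φ^*TN} ψ = 0`:
`φ` is continuous, and in every chart of `N`, on the open set where `φ` takes its values in the
domain of the chart, the components of `φ` are in `H²_loc`, those of `ψ` are continuous and in
`H¹_loc`, and the equations hold almost everywhere. -/
structure IsDiracWaveMap
    (h : Bundle.ContMDiffRiemannianMetric 𝓘(ℝ, EuclideanSpace ℝ (Fin n)) ∞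
      (EuclideanSpace ℝ (Fin n))
      (fun p : N => TangentSpace 𝓘(ℝ, EuclideanSpace ℝ (Fin n)) p))
    (φ : Spacetime → N) (ψ : ∀ z, VectorSpinor (n := n) (φ z)) : Prop where
  continuous_map : Continuous φ
  continuousOn_spinor : ∀ e ∈ atlas (EuclideanSpace ℝ (Fin n)) N,
    ContinuousOn (fun z => spinorComponents e (φ z) (ψ z)) (φ ⁻¹' e.source)
  equations : ∀ e ∈ atlas (EuclideanSpace ℝ (Fin n)) N,
    ∃ (φt φx φtt φtx φxx : Spacetime → EuclideanSpace ℝ (Fin n))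
      (ψt ψx : Spacetime → Fin n → Spinor),
      IsH1loc (φ ⁻¹' e.source) (fun z => e (φ z)) φt φx ∧
      IsH1loc (φ ⁻¹' e.source) φt φtt φtx ∧
      IsH1loc (φ ⁻¹' e.source) φx φtx φxx ∧
      IsH1loc (φ ⁻¹' e.source) (fun z => spinorComponents e (φ z) (ψ z)) ψt ψx ∧
      ∀ᵐ z : Spacetime, z ∈ φ ⁻¹' e.source → ∀ α : Fin n,
        tension h e α (e (φ z)) (φt z) (φx z) (φtt z) (φxx z)
            = (1 / 2) *
              (curvatureTerm h e α (e (φ z)) dt (spinorComponents e (φ z) (ψ z)) (φt z)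
                - curvatureTerm h e α (e (φ z)) dx (spinorComponents e (φ z) (ψ z)) (φx z)) ∧
          twistedDirac h e α (e (φ z)) (φt z) (φx z)
            (spinorComponents e (φ z) (ψ z)) (ψt z) (ψx z) = 0

/-- The pair `(φ, ψ)` has the initial data `φ(0, ·) = φ₀`, `∂_t φ(0, ·) = φ₁` and `ψ(0, ·) = ψ₀`.
The second condition is meant in the sense of traces, in every chart of `N`. -/
structure HasInitialData (φ : Spacetime → N) (ψ : ∀ z, VectorSpinor (n := n) (φ z))
    (φ₀ : ℝ → N) (φ₁ : ∀ x, TangentSpace 𝓘(ℝ, EuclideanSpace ℝ (Fin n)) (φ₀ x))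
    (ψ₀ : ∀ x, VectorSpinor (n := n) (φ₀ x)) : Prop where
  map_eq : ∀ x : ℝ, φ (0, x) = φ₀ x
  velocity_eq : ∀ e ∈ atlas (EuclideanSpace ℝ (Fin n)) N,
    ∃ φt : Spacetime → EuclideanSpace ℝ (Fin n),
      HasWeakDeriv (φ ⁻¹' e.source) dt (fun z => e (φ z)) φt ∧
      HasInitialTrace (φ ⁻¹' e.source) φt
        (fun x => WithLp.toLp 2 fun i => coordForm e (φ₀ x) i (φ₁ x))
  spinor_eq : ∀ x : ℝ,
    (⟨φ (0, x), ψ (0, x)⟩ : Σ p : N, VectorSpinor (n := n) p) = ⟨φ₀ x, ψ₀ x⟩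

end Target

end DiracWave

end

/-!
In the null directions `∂_t + ∂_x` and `∂_t - ∂_x` the Dirac-wave map system becomes a semilinear
null system: with `f = y_t + y_x` and `g = y_t - y_x` the wave map equation reads
`W := y_tt - y_xx = a(f, g) + b(f) + c(g)`, where `W` is at the same time the derivative of `f`
along `∂_t - ∂_x` and of `g` along `∂_t + ∂_x`, and each of the two chiral parts of the spinor
satisfies a transport equation along one null direction, with right hand side linear in `f` or in
`g` (`wave_equation_null`, `dirac_equation_null`). The coefficients are continuously differentiable
functions of the coordinates of the map and of the components of the spinor
(`contDiffAt_diracWaveCoeff`), hence locally Lipschitz.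

For the difference of two solutions this yields differential inequalities whose coefficients involve
the null derivatives of both solutions. These need not be bounded, but the product structure of the
nonlinearity compensates: as `f` has an integrable weak derivative along the second null direction,
it is dominated by an integrable function of the first null coordinate alone, and similarly for `g`
(`HasWeakDeriv.norm_le_mean_add_integral_snd`). On small null rectangles these functions have small
integrals, and the integral of `‖W‖` for the difference turns out to be at most half of itself
(`ae_eq_zero_of_null_system`, `NullField.exists_diamond_uniqueness`).

To use this at the initial line the difference is replaced by zero on one side of it. Equality
of the initial data, for the velocity in the sense of traces, is what makes the truncated difference
weakly differentiable with the truncated derivatives (`HasWeakDeriv.indicator_future_of_vanish`,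
`HasInitialTrace.indicator_future_sub`).

Finally, the set of events where the two solutions coincide is closed and contains the line `t = 0`,
and for every small causal diamond near one of its points it contains the upper half as soon as it
contains the lower half (`exists_diamond_coincidence`). A first failure in the backward cone of an
event is therefore impossible (`mem_of_diamond_propagation`), and the past is treated in the same
way after reflecting time.
-/

namespace DiracWave

/-! ### Calculus of weak derivatives -/

section WeakCalculus

variable {F : Type*} [NormedAddCommGroup F] [NormedSpace ℝ F]
  {G : Type*} [NormedAddCommGroup G] [NormedSpace ℝ G]
  {O O' : Set Spacetime} {v w : Spacetime} {f f' g g' : Spacetime → F} {θ : Spacetime → ℝ}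

theorem IsTestFunction.mono (h : IsTestFunction O θ) (hO : O ⊆ O') : IsTestFunction O' θ :=
  ⟨h.smooth, h.hasCompactSupport, h.tsupport_subset.trans hO⟩

theorem IsTestFunction.fderiv_apply (h : IsTestFunction O θ) (v : Spacetime) :
    IsTestFunction O fun z => fderiv ℝ θ z v :=
  ⟨(h.smooth.fderiv_right (m := ∞) (by simp)).clm_apply contDiff_const,
    h.hasCompactSupport.fderiv_apply ℝ v,
    (tsupport_fderiv_apply_subset ℝ v).trans h.tsupport_subset⟩

theorem IsTestFunction.mul_left (h : IsTestFunction O θ) {χ : Spacetime → ℝ}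
    (hχ : ContDiff ℝ ∞ χ) : IsTestFunction O fun z => χ z * θ z :=
  ⟨hχ.mul h.smooth, h.hasCompactSupport.mul_left,
    (tsupport_mul_subset_right (f := χ) (g := θ)).trans h.tsupport_subset⟩

theorem IsTestFunction.differentiableAt (h : IsTestFunction O θ) (z : Spacetime) :
    DifferentiableAt ℝ θ z :=
  (h.smooth.differentiable (by simp)) z

theorem IsTestFunction.integrable_smul (h : IsTestFunction O θ) (hf : LocallyIntegrableOn f O) :
    Integrable fun z => θ z • f z := by
  have h1 : IntegrableOn f (tsupport θ) :=
    hf.integrableOn_compact_subset h.tsupport_subset h.hasCompactSupport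
  have h2 : IntegrableOn (fun z => θ z • f z) (tsupport θ) :=
    h1.continuousOn_smul h.smooth.continuous.continuousOn h.hasCompactSupport
  rw [← integrableOn_iff_integrable_of_support_subset (s := tsupport θ)]
  · exact h2
  · exact (Function.support_smul_subset_left θ f).trans (subset_tsupport θ)

theorem HasWeakDeriv.mono (h : HasWeakDeriv O v f f') (hO : O' ⊆ O) : HasWeakDeriv O' v f f' :=
  ⟨h.1.mono_set hO, h.2.mono_set hO, fun θ hθ => h.3 θ (hθ.mono hO)⟩

theorem HasWeakDeriv.sub (h : HasWeakDeriv O v f f') (h' : HasWeakDeriv O v g g') :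
    HasWeakDeriv O v (fun z => f z - g z) (fun z => f' z - g' z) := by
  refine ⟨h.1.sub h'.1, h.2.sub h'.2, fun θ hθ => ?_⟩
  have e1 := h.3 θ hθ
  have e2 := h'.3 θ hθ
  simp only [smul_sub]
  rw [integral_sub ((hθ.fderiv_apply v).integrable_smul h.1)
      ((hθ.fderiv_apply v).integrable_smul h'.1),
    integral_sub (hθ.integrable_smul h.2) (hθ.integrable_smul h'.2), e1, e2]
  abel

theorem HasWeakDeriv.add (h : HasWeakDeriv O v f f') (h' : HasWeakDeriv O v g g') :
    HasWeakDeriv O v (fun z => f z + g z) (fun z => f' z + g' z) := by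
  refine ⟨h.1.add h'.1, h.2.add h'.2, fun θ hθ => ?_⟩
  have e1 := h.3 θ hθ
  have e2 := h'.3 θ hθ
  simp only [smul_add]
  rw [integral_add ((hθ.fderiv_apply v).integrable_smul h.1)
      ((hθ.fderiv_apply v).integrable_smul h'.1),
    integral_add (hθ.integrable_smul h.2) (hθ.integrable_smul h'.2), e1, e2]
  abel

/-- The weak derivative is additive in the direction. -/
theorem HasWeakDeriv.add_dir (h : HasWeakDeriv O v f f') (h' : HasWeakDeriv O w f g') :
    HasWeakDeriv O (v + w) f (fun z => f' z + g' z) := by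
  refine ⟨h.1, h.2.add h'.2, fun θ hθ => ?_⟩
  have e1 := h.3 θ hθ
  have e2 := h'.3 θ hθ
  simp only [smul_add, map_add, add_smul]
  rw [integral_add ((hθ.fderiv_apply v).integrable_smul h.1)
      ((hθ.fderiv_apply w).integrable_smul h.1),
    integral_add (hθ.integrable_smul h.2) (hθ.integrable_smul h'.2), e1, e2]
  abel

theorem HasWeakDeriv.sub_dir (h : HasWeakDeriv O v f f') (h' : HasWeakDeriv O w f g') :
    HasWeakDeriv O (v - w) f (fun z => f' z - g' z) := by
  refine ⟨h.1, h.2.sub h'.2, fun θ hθ => ?_⟩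
  have e1 := h.3 θ hθ
  have e2 := h'.3 θ hθ
  simp only [smul_sub, map_sub, sub_smul]
  rw [integral_sub ((hθ.fderiv_apply v).integrable_smul h.1)
      ((hθ.fderiv_apply w).integrable_smul h.1),
    integral_sub (hθ.integrable_smul h.2) (hθ.integrable_smul h'.2), e1, e2]
  abel

theorem locallyIntegrableOn_clm_comp (L : F →L[ℝ] G) (h : LocallyIntegrableOn f O) :
    LocallyIntegrableOn (fun z => L (f z)) O := fun x hx => by
  obtain ⟨s, hs, hi⟩ := h x hx
  exact ⟨s, hs, L.integrable_comp hi⟩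

theorem HasWeakDeriv.clm_comp [CompleteSpace F] [CompleteSpace G] (L : F →L[ℝ] G)
    (h : HasWeakDeriv O v f f') :
    HasWeakDeriv O v (fun z => L (f z)) (fun z => L (f' z)) := by
  refine ⟨locallyIntegrableOn_clm_comp L h.1, locallyIntegrableOn_clm_comp L h.2,
    fun θ hθ => ?_⟩
  simp only [← map_smul]
  rw [L.integral_comp_comm ((hθ.fderiv_apply v).integrable_smul h.1),
    L.integral_comp_comm (hθ.integrable_smul h.2), h.3 θ hθ, map_neg]

theorem HasWeakDeriv.congr (h : HasWeakDeriv O v f f') (hO : MeasurableSet O)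
    (hf : ∀ᵐ z, z ∈ O → f z = g z) (hf' : ∀ᵐ z, z ∈ O → f' z = g' z) :
    HasWeakDeriv O v g g' := by
  refine ⟨h.1.congr ((ae_restrict_iff' hO).2 hf), h.2.congr ((ae_restrict_iff' hO).2 hf'),
    fun θ hθ => ?_⟩
  have key : ∀ {k k' : Spacetime → F} {η : Spacetime → ℝ}, IsTestFunction O η →
      (∀ᵐ z, z ∈ O → k z = k' z) → ∫ z, η z • k z = ∫ z, η z • k' z := by
    intro k k' η hη hk
    refine integral_congr_ae ?_
    filter_upwards [hk] with z hz
    by_cases hzO : z ∈ O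
    · rw [hz hzO]
    · have : η z = 0 := image_eq_zero_of_notMem_tsupport fun h => hzO (hη.tsupport_subset h)
      simp [this]
  rw [← key (hθ.fderiv_apply v) hf, ← key hθ hf', h.3 θ hθ]

/-- Weak derivatives are unique almost everywhere. -/
theorem HasWeakDeriv.unique [CompleteSpace F] (hO : IsOpen O) (h : HasWeakDeriv O v f f')
    (h' : HasWeakDeriv O v f g') : ∀ᵐ z, z ∈ O → f' z = g' z := by
  have := hO.ae_eq_zero_of_integral_contDiff_smul_eq_zero (μ := volume)
    (h.2.sub h'.2) (fun θ h1 h2 h3 => by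
      have hθ : IsTestFunction O θ := ⟨h1, h2, h3⟩
      have e1 := h.3 θ hθ
      have e2 := h'.3 θ hθ
      simp only [Pi.sub_apply, smul_sub]
      rw [integral_sub (hθ.integrable_smul h.2) (hθ.integrable_smul h'.2), sub_eq_zero]
      exact neg_injective (e1.symm.trans e2))
  filter_upwards [this] with z hz hzO
  exact sub_eq_zero.1 (hz hzO)

theorem hasWeakDeriv_zero : HasWeakDeriv O v (fun _ => (0 : F)) fun _ => 0 :=
  ⟨locallyIntegrableOn_zero, locallyIntegrableOn_zero, fun θ _ => by simp⟩

/-- The weak derivative of a function vanishing on an open set vanishes there. -/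
theorem HasWeakDeriv.eq_zero_of_eq_zero [CompleteSpace F] (hO : IsOpen O)
    (h : HasWeakDeriv O v f f') (hf : ∀ᵐ z, z ∈ O → f z = 0) : ∀ᵐ z, z ∈ O → f' z = 0 :=
  (h.congr (g' := f') hO.measurableSet hf (by simp)).unique hO hasWeakDeriv_zero

section LinearChange

variable (A : Spacetime ≃L[ℝ] Spacetime)

theorem exists_map_volume_eq_smul :
    ∃ c : ENNReal, c ≠ 0 ∧ c ≠ ⊤ ∧ (volume : Measure Spacetime).map A = c • volume := by
  have hdet : LinearMap.det (A.toLinearEquiv : Spacetime →ₗ[ℝ] Spacetime) ≠ 0 :=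
    (LinearEquiv.isUnit_det' A.toLinearEquiv).ne_zero
  refine ⟨_, ?_, ?_, Measure.map_linearMap_addHaar_eq_smul_addHaar volume hdet⟩
  · simpa using hdet
  · exact ENNReal.ofReal_ne_top

theorem ae_comp_linear {P : Spacetime → Prop} (h : ∀ᵐ z, P z) : ∀ᵐ z, P (A z) := by
  obtain ⟨c, -, -, hA⟩ := exists_map_volume_eq_smul A
  have : ∀ᵐ z ∂((volume : Measure Spacetime).map A), P z := by
    rw [hA]; exact Measure.ae_smul_measure h c
  exact ae_of_ae_map A.continuous.aemeasurable this

theorem locallyIntegrableOn_comp_linear {E : Type*} [NormedAddCommGroup E] {f : Spacetime → E}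
    (h : LocallyIntegrableOn f O) :
    LocallyIntegrableOn (fun z => f (A z)) (A ⁻¹' O) := by
  obtain ⟨c, -, hc, hA⟩ := exists_map_volume_eq_smul A
  intro x hx
  obtain ⟨s, hs, hi⟩ := h (A x) hx
  refine ⟨A ⁻¹' s, ?_, ?_⟩
  · exact (A.continuous.continuousWithinAt.tendsto_nhdsWithin (mapsTo_preimage A O)) hs
  · have hm : MeasurableEmbedding A := A.toHomeomorph.measurableEmbedding
    have : IntegrableOn f s ((volume : Measure Spacetime).map A) := by
      rw [hA, IntegrableOn, Measure.restrict_smul]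
      exact hi.smul_measure hc
    exact (hm.integrableOn_map_iff).1 this

/-- Weak derivatives under a linear change of coordinates. -/
theorem HasWeakDeriv.comp_linear (h : HasWeakDeriv O (A v) f f') :
    HasWeakDeriv (A ⁻¹' O) v (fun z => f (A z)) (fun z => f' (A z)) := by
  refine ⟨locallyIntegrableOn_comp_linear A h.1, locallyIntegrableOn_comp_linear A h.2,
    fun θ hθ => ?_⟩
  obtain ⟨c, -, -, hA⟩ := exists_map_volume_eq_smul A
  have hm : MeasurableEmbedding A := A.toHomeomorph.measurableEmbedding
  have hint : ∀ k : Spacetime → F, ∫ z, k (A z) = c.toReal • ∫ z, k z := fun k => by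
    rw [← hm.integral_map, hA, integral_smul_measure]
  have htest : IsTestFunction O fun z => θ (A.symm z) := by
    refine ⟨hθ.smooth.comp A.symm.contDiff,
      hθ.hasCompactSupport.comp_homeomorph A.symm.toHomeomorph, ?_⟩
    have : tsupport (fun z => θ (A.symm z)) = A.symm ⁻¹' tsupport θ :=
      tsupport_comp_eq_preimage θ A.symm.toHomeomorph
    rw [this]
    intro z hz
    simpa using hθ.tsupport_subset hz
  have hder : ∀ z, fderiv ℝ (fun z => θ (A.symm z)) (A z) (A v) = fderiv ℝ θ z v := fun z => by
    have := (((hθ.differentiableAt (A.symm (A z))).hasFDerivAt).comp (A z)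
      A.symm.hasFDerivAt).fderiv
    simp only [Function.comp_def] at this
    rw [this]
    simp
  have e := h.3 _ htest
  calc ∫ z, fderiv ℝ θ z v • f (A z)
      = ∫ z, (fun y => fderiv ℝ (fun z => θ (A.symm z)) y (A v) • f y) (A z) := by
        simp only [hder]
    _ = c.toReal • -∫ z, θ (A.symm z) • f' z := (hint _).trans (by rw [e])
    _ = -∫ z, (fun y => θ (A.symm y) • f' y) (A z) := by
        rw [smul_neg]
        exact congrArg Neg.neg (hint _).symm
    _ = _ := by simp

end LinearChange

end WeakCalculus

/-! ### Weak derivatives along lines -/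

section Lines

theorem integrable_comp_shear {E : Type*} [NormedAddCommGroup E] {f : Spacetime → E}
    (hf : Integrable f) (μ : Measure ℝ) [IsFiniteMeasure μ] (e : Spacetime) :
    Integrable (fun q : ℝ × Spacetime => f (q.2 + q.1 • e)) (μ.prod volume) := by
  have hS : MeasurePreserving (fun q : ℝ × Spacetime => (q.1, q.2 + q.1 • e))
      (μ.prod volume) (μ.prod volume) :=
    (MeasurePreserving.id μ).skew_product (g := fun σ z => z + σ • e)
      (by unfold Function.uncurry; fun_prop)
      (ae_of_all _ fun σ => (measurePreserving_add_right volume (σ • e)).map_eq)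
  exact hS.integrable_comp_of_integrable (hf.comp_snd μ)

theorem integral_translate_sub {θ : Spacetime → ℝ} (hθ : ContDiff ℝ ∞ θ) (z e : Spacetime)
    (s : ℝ) :
    ∫ σ in (0 : ℝ)..s, fderiv ℝ θ (z - σ • e) e = θ z - θ (z - s • e) := by
  have hd : ∀ σ : ℝ, HasDerivAt (fun σ : ℝ => -θ (z - σ • e)) (fderiv ℝ θ (z - σ • e) e) σ := by
    intro σ
    have h1 : HasDerivAt (fun σ : ℝ => z - σ • e) (-e) σ := by
      simpa using ((hasDerivAt_id σ).smul_const e).const_sub z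
    have h2 := ((hθ.differentiable (by simp)) (z - σ • e)).hasFDerivAt.comp_hasDerivAt σ h1
    simpa [Function.comp_def] using h2.fun_neg
  have hc : Continuous fun σ : ℝ => fderiv ℝ θ (z - σ • e) e := by
    have := hθ.continuous_fderiv (by simp)
    fun_prop
  rw [intervalIntegral.integral_eq_sub_of_hasDerivAt (fun σ _ => hd σ)
    (hc.intervalIntegrable _ _)]
  simp
  ring

variable {F : Type*} [NormedAddCommGroup F] [NormedSpace ℝ F]
  {Q : Set Spacetime} {e : Spacetime} {f W : Spacetime → F}

/-- The fundamental theorem of calculus for weak derivatives on a convex open set, for the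
increment by a fixed multiple of the direction `e`. -/
theorem HasWeakDeriv.translate_sub [CompleteSpace F] (hQo : IsOpen Q) (hQc : Convex ℝ Q)
    (hf : IntegrableOn f Q) (hW : IntegrableOn W Q) (h : HasWeakDeriv Q e f W) (s : ℝ) :
    ∀ᵐ z, z ∈ Q → z + s • e ∈ Q →
      f (z + s • e) - f z = ∫ σ in (0 : ℝ)..s, Q.indicator W (z + σ • e) := by
  set f₀ : Spacetime → F := Q.indicator f with hf₀
  set W₀ : Spacetime → F := Q.indicator W with hW₀
  have hf₀i : Integrable f₀ := hf.integrable_indicator hQo.measurableSet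
  have hW₀i : Integrable W₀ := hW.integrable_indicator hQo.measurableSet
  set U : Set Spacetime := Q ∩ (fun z => z + s • e) ⁻¹' Q with hU
  have hUo : IsOpen U := hQo.inter (hQo.preimage (by fun_prop))
  have : IsFiniteMeasure (volume.restrict (uIoc 0 s)) := by unfold uIoc; infer_instance
  have hshear := integrable_comp_shear hW₀i (volume.restrict (uIoc 0 s)) e
  have hprim : Integrable fun z => ∫ σ in (0 : ℝ)..s, W₀ (z + σ • e) := by
    have := hshear.integral_prod_right
    simp only [intervalIntegral.intervalIntegral_eq_integral_uIoc]
    exact this.smul (if (0 : ℝ) ≤ s then (1 : ℝ) else -1)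
  have hmain := hUo.ae_eq_zero_of_integral_contDiff_smul_eq_zero (μ := volume)
    (f := fun z => f₀ (z + s • e) - f₀ z - ∫ σ in (0 : ℝ)..s, W₀ (z + σ • e))
    ((((hf₀i.comp_add_right (s • e)).sub hf₀i).sub hprim).locallyIntegrable.locallyIntegrableOn
      U) ?_
  · filter_upwards [hmain] with z hz hzQ hzQ'
    have := hz ⟨hzQ, hzQ'⟩
    simpa [hf₀, indicator_of_mem hzQ, indicator_of_mem hzQ', sub_eq_zero] using this
  -- tested against `θ`, both sides become integrals over `σ` of `f` against translates of `∂ₑ θ`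
  intro θ hθ1 hθ2 hθ3
  have hθ : IsTestFunction U θ := ⟨hθ1, hθ2, hθ3⟩
  have hθc : Continuous θ := hθ1.continuous
  -- translates of `θ` by `σ e`, with `σ` between `0` and `s`, are test functions on `Q`
  have htest : ∀ σ ∈ uIcc 0 s, IsTestFunction Q fun z => θ (z - σ • e) := by
    intro σ hσ
    have hts : tsupport (fun z => θ (z - σ • e)) = (fun z => z - σ • e) ⁻¹' tsupport θ :=
      tsupport_comp_eq_preimage θ (Homeomorph.subRight (σ • e))
    refine ⟨hθ1.comp (contDiff_id.sub contDiff_const),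
      hθ2.comp_homeomorph (Homeomorph.subRight (σ • e)), ?_⟩
    rw [hts]
    intro z hz
    obtain ⟨h1, h2⟩ := hθ3 hz
    have hseg : z ∈ segment ℝ (z - σ • e) (z - σ • e + s • e) := by
      rw [segment_eq_image_lineMap]
      rcases eq_or_ne s 0 with rfl | hs
      · have : σ = 0 := by simpa using hσ
        exact ⟨0, by simp, by simp [this]⟩
      · refine ⟨σ / s, ?_, ?_⟩
        · rcases le_total 0 s with h0 | h0
          · rw [uIcc_of_le h0] at hσ
            exact ⟨div_nonneg hσ.1 h0, div_le_one_of_le₀ hσ.2 h0⟩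
          · rw [uIcc_of_ge h0] at hσ
            exact ⟨div_nonneg_of_nonpos hσ.2 h0, by
              rw [div_le_one_of_neg (lt_of_le_of_ne h0 hs)]; exact hσ.1⟩
        · rw [AffineMap.lineMap_apply]
          simp [smul_smul, div_mul_cancel₀ _ hs]
    exact hQc.segment_subset h1 h2 hseg
  have hweak : ∀ σ ∈ uIcc 0 s, ∫ z, fderiv ℝ θ (z - σ • e) e • f₀ z
      = - ∫ z, θ z • W₀ (z + σ • e) := by
    intro σ hσ
    have e1 := h.3 _ (htest σ hσ)
    have hfd : ∀ z, fderiv ℝ (fun z => θ (z - σ • e)) z = fderiv ℝ θ (z - σ • e) := fun z =>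
      by simpa [sub_eq_add_neg] using fderiv_comp_add_right (f := θ) (x := z) (-(σ • e))
    have e2 : ∀ {k : Spacetime → F} {η : Spacetime → ℝ}, IsTestFunction Q η →
        ∫ z, η z • k z = ∫ z, η z • Q.indicator k z := by
      intro k η hη
      congr 1
      ext z
      by_cases hz : z ∈ Q
      · simp [hz]
      · have : η z = 0 := image_eq_zero_of_notMem_tsupport fun h => hz (hη.tsupport_subset h)
        simp [this]
    rw [e2 ((htest σ hσ).fderiv_apply e), e2 (htest σ hσ)] at e1
    simp only [hfd] at e1
    rw [e1, ← integral_add_right_eq_self (fun z => θ (z - σ • e) • Q.indicator W z) (σ • e)]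
    simp [hW₀]
  obtain ⟨M, hM⟩ := hθc.bounded_above_of_compact_support hθ2
  obtain ⟨M', hM'⟩ := ((hθ.fderiv_apply e).smooth.continuous).bounded_above_of_compact_support
    (hθ.fderiv_apply e).hasCompactSupport
  have hDθ : Continuous fun z => fderiv ℝ θ z e := (hθ.fderiv_apply e).smooth.continuous
  have hi1 : Integrable fun z => θ z • f₀ (z + s • e) :=
    (hf₀i.comp_add_right (s • e)).bdd_smul M hθc.aestronglyMeasurable (ae_of_all _ hM)
  have hi2 : Integrable fun z => θ z • f₀ z :=
    hf₀i.bdd_smul M hθc.aestronglyMeasurable (ae_of_all _ hM)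
  have hi2' : Integrable fun z => θ (z - s • e) • f₀ z :=
    hf₀i.bdd_smul M (Continuous.aestronglyMeasurable (by fun_prop)) (ae_of_all _ fun z => hM _)
  have hi3 : Integrable fun z => θ z • ∫ σ in (0 : ℝ)..s, W₀ (z + σ • e) :=
    hprim.bdd_smul M hθc.aestronglyMeasurable (ae_of_all _ hM)
  have hswap1 : ∫ σ in (0 : ℝ)..s, ∫ z, fderiv ℝ θ (z - σ • e) e • f₀ z
      = ∫ z, (∫ σ in (0 : ℝ)..s, fderiv ℝ θ (z - σ • e) e • f₀ z) := by
    refine intervalIntegral_integral_swap ?_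
    exact (hf₀i.comp_snd (volume.restrict (uIoc 0 s))).bdd_smul M'
      (φ := fun q : ℝ × Spacetime => fderiv ℝ θ (q.2 - q.1 • e) e)
      (Continuous.aestronglyMeasurable (hDθ.comp (by fun_prop))) (ae_of_all _ fun q => hM' _)
  have hswap2 : ∫ σ in (0 : ℝ)..s, ∫ z, θ z • W₀ (z + σ • e)
      = ∫ z, (∫ σ in (0 : ℝ)..s, θ z • W₀ (z + σ • e)) := by
    refine intervalIntegral_integral_swap ?_
    exact hshear.bdd_smul M (φ := fun q : ℝ × Spacetime => θ q.2)
      (Continuous.aestronglyMeasurable (by fun_prop)) (ae_of_all _ fun q => hM _)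
  have hlhs : ∫ z, (∫ σ in (0 : ℝ)..s, fderiv ℝ θ (z - σ • e) e • f₀ z)
      = (∫ z, θ z • f₀ z) - ∫ z, θ z • f₀ (z + s • e) := by
    have : ∀ z, (∫ σ in (0 : ℝ)..s, fderiv ℝ θ (z - σ • e) e • f₀ z)
        = θ z • f₀ z - θ (z - s • e) • f₀ z := fun z => by
      rw [intervalIntegral.integral_smul_const, integral_translate_sub hθ1, sub_smul]
    simp only [this]
    rw [integral_sub hi2 hi2',
      ← integral_add_right_eq_self (fun z => θ (z - s • e) • f₀ z) (s • e)]
    simp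
  have hrhs : ∫ σ in (0 : ℝ)..s, ∫ z, fderiv ℝ θ (z - σ • e) e • f₀ z
      = - ∫ σ in (0 : ℝ)..s, ∫ z, θ z • W₀ (z + σ • e) := by
    rw [← intervalIntegral.integral_neg]
    exact intervalIntegral.integral_congr fun σ hσ => hweak σ hσ
  have hfin : (∫ z, θ z • f₀ z) - ∫ z, θ z • f₀ (z + s • e)
      = - ∫ z, θ z • ∫ σ in (0 : ℝ)..s, W₀ (z + σ • e) := by
    rw [← hlhs, ← hswap1, hrhs, hswap2]
    simp only [intervalIntegral.integral_smul]
  have hi12 : Integrable fun z => θ z • f₀ (z + s • e) - θ z • f₀ z := hi1.sub hi2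
  simp only [smul_sub]
  rw [integral_sub hi12 hi3, integral_sub hi1 hi2, sub_eq_zero, ← neg_inj, ← hfin]
  abel

variable {a b c d : ℝ}

/-- A function whose weak derivative along the second coordinate is `W` oscillates on almost every
line in that direction by at most the integral of `‖W‖` over the line. -/
theorem HasWeakDeriv.line_bound [CompleteSpace F]
    (hf : IntegrableOn f (Ioo a b ×ˢ Ioo c d)) (hW : IntegrableOn W (Ioo a b ×ˢ Ioo c d))
    (h : HasWeakDeriv (Ioo a b ×ˢ Ioo c d) (0, 1) f W) :
    ∀ᵐ u ∂volume.restrict (Ioo a b), ∀ᵐ v ∂volume.restrict (Ioo c d),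
      ∀ᵐ v' ∂volume.restrict (Ioo c d),
        ‖f (u, v) - f (u, v')‖ ≤ ∫ w in Ioo c d, ‖W (u, w)‖ := by
  set Q : Set Spacetime := Ioo a b ×ˢ Ioo c d with hQ
  have hQo : IsOpen Q := isOpen_Ioo.prod isOpen_Ioo
  have hQm : MeasurableSet Q := hQo.measurableSet
  have hQc : Convex ℝ Q := (convex_Ioo a b).prod (convex_Ioo c d)
  have hprod : (volume.restrict Q : Measure Spacetime)
      = (volume.restrict (Ioo a b)).prod (volume.restrict (Ioo c d)) :=
    (Measure.prod_restrict _ _).symm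
  -- pass to measurable representatives, so that almost-everywhere quantifiers can be exchanged
  obtain ⟨f₁, hf₁m, hf₁⟩ := hf.1
  obtain ⟨W₁, hW₁m, hW₁⟩ := hW.1
  have h₁ : HasWeakDeriv Q (0, 1) f₁ W₁ :=
    h.congr hQm ((ae_restrict_iff' hQm).1 hf₁) ((ae_restrict_iff' hQm).1 hW₁)
  have hf₁i : IntegrableOn f₁ Q := hf.congr hf₁
  have hW₁i : IntegrableOn W₁ Q := hW.congr hW₁
  set A : ℝ → ℝ := fun u => ∫ w in Ioo c d, ‖W₁ (u, w)‖ with hA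
  have hAm : StronglyMeasurable A :=
    (hW₁m.norm).integral_prod_right' (ν := volume.restrict (Ioo c d))
  have hslice : ∀ᵐ u : ℝ, Integrable fun w => Q.indicator W₁ (u, w) :=
    (hW₁i.integrable_indicator hQm).prod_right_ae
  have hslice' : ∀ᵐ z : Spacetime, Integrable fun w => Q.indicator W₁ (z.1, w) :=
    Measure.quasiMeasurePreserving_fst.ae hslice
  have step : ∀ s : ℝ, ∀ᵐ z : Spacetime, z ∈ Q → z + s • ((0, 1) : Spacetime) ∈ Q →
      ‖f₁ (z + s • ((0, 1) : Spacetime)) - f₁ z‖ ≤ A z.1 := by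
    intro s
    filter_upwards [h₁.translate_sub hQo hQc hf₁i hW₁i s, hslice'] with z hz hzi hz1 hz2
    rw [hz hz1 hz2]
    have e1 : ∀ σ : ℝ, Q.indicator W₁ (z + σ • ((0, 1) : Spacetime))
        = Q.indicator W₁ (z.1, σ + z.2) := fun σ => by
      congr 1
      ext <;> simp [add_comm]
    simp only [e1]
    rw [intervalIntegral.integral_comp_add_right (fun w => Q.indicator W₁ (z.1, w))]
    refine intervalIntegral.norm_integral_le_integral_norm_uIoc.trans ?_
    refine (setIntegral_le_integral hzi.norm (ae_of_all _ fun w => norm_nonneg _)).trans_eq ?_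
    change _ = ∫ w in Ioo c d, ‖W₁ (z.1, w)‖
    rw [← integral_indicator measurableSet_Ioo]
    congr 1
    ext w
    have hz1' : z.1 ∈ Ioo a b := hz1.1
    by_cases hw : w ∈ Ioo c d
    · have : (z.1, w) ∈ Q := ⟨hz1', hw⟩
      rw [indicator_of_mem this, indicator_of_mem hw]
    · have : (z.1, w) ∉ Q := fun h => hw h.2
      rw [indicator_of_notMem this, indicator_of_notMem hw, norm_zero]
  have hmeas : MeasurableSet {q : ℝ × Spacetime | q.2 ∈ Q →
      q.2 + q.1 • ((0, 1) : Spacetime) ∈ Q →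
      ‖f₁ (q.2 + q.1 • ((0, 1) : Spacetime)) - f₁ q.2‖ ≤ A q.2.1} := by
    have hg : Measurable fun q : ℝ × Spacetime => q.2 + q.1 • ((0, 1) : Spacetime) := by fun_prop
    refine measurableSet_setOfPred.2 (Measurable.imp ?_ (Measurable.imp ?_ ?_))
    · exact measurableSet_setOfPred.1 (measurable_snd hQm)
    · exact measurableSet_setOfPred.1 (hg hQm)
    · refine measurableSet_setOfPred.1 (measurableSet_le ?_ ?_)
      · exact ((hf₁m.comp_measurable hg).sub
          (hf₁m.comp_measurable measurable_snd)).norm.measurable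
      · exact hAm.measurable.comp (measurable_fst.comp measurable_snd)
  have hswap := (Measure.ae_ae_comm (μ := (volume : Measure ℝ)) (ν := (volume : Measure Spacetime))
    (p := fun s z => z ∈ Q → z + s • ((0, 1) : Spacetime) ∈ Q →
      ‖f₁ (z + s • ((0, 1) : Spacetime)) - f₁ z‖ ≤ A z.1) hmeas).1 (ae_of_all _ step)
  have hiter := Measure.ae_ae_of_ae_prod (μ := (volume : Measure ℝ)) (ν := (volume : Measure ℝ))
    hswap
  have hf₁' : ∀ᵐ u ∂volume.restrict (Ioo a b), ∀ᵐ v ∂volume.restrict (Ioo c d),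
      f (u, v) = f₁ (u, v) := by
    rw [hprod] at hf₁
    exact Measure.ae_ae_of_ae_prod hf₁
  have hW₁' : ∀ᵐ u ∂volume.restrict (Ioo a b), ∀ᵐ v ∂volume.restrict (Ioo c d),
      W (u, v) = W₁ (u, v) := by
    rw [hprod] at hW₁
    exact Measure.ae_ae_of_ae_prod hW₁
  filter_upwards [hf₁', hW₁', ae_restrict_of_ae hiter, ae_restrict_mem measurableSet_Ioo]
    with u h1 h2 h3 hu
  have e2 : ∫ w in Ioo c d, ‖W (u, w)‖ = A u :=
    integral_congr_ae (by filter_upwards [h2] with w hw; rw [hw])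
  rw [e2]
  filter_upwards [h1, ae_restrict_of_ae h3, ae_restrict_mem measurableSet_Ioo] with v hv1 hv3 hv
  have hv3' : ∀ᵐ v' : ℝ, ((u, v) : Spacetime) ∈ Q →
      (u, v) + (v' - v) • ((0, 1) : Spacetime) ∈ Q →
      ‖f₁ ((u, v) + (v' - v) • ((0, 1) : Spacetime)) - f₁ (u, v)‖ ≤ A u :=
    (measurePreserving_sub_right volume v).quasiMeasurePreserving.ae hv3
  filter_upwards [h1, ae_restrict_of_ae hv3', ae_restrict_mem measurableSet_Ioo] with v' h4 h5 hv'
  have e3 : ((u, v) : Spacetime) + (v' - v) • ((0, 1) : Spacetime) = (u, v') := by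
    ext <;> simp
  rw [e3] at h5
  rw [hv1, h4, norm_sub_rev]
  exact h5 ⟨hu, hv⟩ ⟨hu, hv'⟩

end Lines

section LineConsequences

variable {F : Type*} [NormedAddCommGroup F] [NormedSpace ℝ F] {f W : Spacetime → F}
  {a b c d : ℝ}

theorem restrict_prod_Ioo (a b c d : ℝ) :
    (volume.restrict (Ioo a b ×ˢ Ioo c d) : Measure Spacetime)
      = (volume.restrict (Ioo a b)).prod (volume.restrict (Ioo c d)) :=
  (Measure.prod_restrict _ _).symm

theorem ae_prod_norm_le_of_ae_ae {E : Type*} [NormedAddCommGroup E] {k : Spacetime → E}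
    {μ ν : Measure ℝ} [SFinite μ] [SFinite ν] {A : ℝ → ℝ}
    (hk : AEStronglyMeasurable k (μ.prod ν))
    (hA : AEStronglyMeasurable A μ) (h : ∀ᵐ u ∂μ, ∀ᵐ v ∂ν, ‖k (u, v)‖ ≤ A u) :
    ∀ᵐ z ∂μ.prod ν, ‖k z‖ ≤ A z.1 := by
  obtain ⟨k₁, hk₁m, hk₁⟩ := hk
  obtain ⟨A₁, hA₁m, hA₁⟩ := hA
  have h1 : ∀ᵐ z ∂μ.prod ν, ‖k₁ z‖ ≤ A₁ z.1 := by
    refine (Measure.ae_prod_iff_ae_ae (measurableSet_le hk₁m.norm.measurable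
      (hA₁m.measurable.comp measurable_fst))).2 ?_
    filter_upwards [h, hA₁, Measure.ae_ae_of_ae_prod hk₁] with u hu1 hu2 hu3
    filter_upwards [hu1, hu3] with v hv1 hv2
    change ‖k₁ (u, v)‖ ≤ A₁ u
    rw [← hv2, ← hu2]
    exact hv1
  have h2 : ∀ᵐ z ∂μ.prod ν, A z.1 = A₁ z.1 := Measure.quasiMeasurePreserving_fst.ae hA₁
  filter_upwards [h1, h2, hk₁] with z h3 h4 h5
  rw [h4, h5]
  exact h3

/-- A function with weak derivative `W` along the second coordinate that vanishes on an interval of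
every line is bounded by the integrals of `‖W‖` over the lines. -/
theorem HasWeakDeriv.norm_le_integral_snd [CompleteSpace F]
    (hf : IntegrableOn f (Ioo a b ×ˢ Ioo c d)) (hW : IntegrableOn W (Ioo a b ×ˢ Ioo c d))
    (h : HasWeakDeriv (Ioo a b ×ˢ Ioo c d) (0, 1) f W) {H : Set Spacetime}
    (hH : ∀ u ∈ Ioo a b, ∃ c' d', c' < d' ∧ Ioo c' d' ⊆ Ioo c d ∧ ∀ v ∈ Ioo c' d', (u, v) ∈ H)
    (hfH : ∀ᵐ z ∂volume.restrict (Ioo a b ×ˢ Ioo c d), z ∈ H → f z = 0) :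
    ∀ᵐ z ∂volume.restrict (Ioo a b ×ˢ Ioo c d), ‖f z‖ ≤ ∫ w in Ioo c d, ‖W (z.1, w)‖ := by
  have hl := h.line_bound hf hW
  rw [restrict_prod_Ioo] at hfH ⊢
  rw [IntegrableOn, restrict_prod_Ioo] at hf hW
  refine ae_prod_norm_le_of_ae_ae (A := fun u => ∫ w in Ioo c d, ‖W (u, w)‖) hf.1
    hW.1.norm.integral_prod_right' ?_
  filter_upwards [hl, Measure.ae_ae_of_ae_prod hfH, ae_restrict_mem measurableSet_Ioo]
    with u h1 h2 hu
  obtain ⟨c', d', hcd, hsub, hmem⟩ := hH u hu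
  filter_upwards [h1] with v hv
  have hne : (ae (volume.restrict (Ioo c' d'))).NeBot := by
    rw [ae_neBot, Ne, Measure.restrict_eq_zero]
    simpa using hcd
  have h3 : ∀ᵐ v' ∂volume.restrict (Ioo c' d'),
      ‖f (u, v) - f (u, v')‖ ≤ ∫ w in Ioo c d, ‖W (u, w)‖ :=
    ae_restrict_of_ae_restrict_of_subset hsub hv
  have h4 := ae_restrict_of_ae_restrict_of_subset hsub h2
  obtain ⟨v', hv1, hv2, hv3⟩ := (h3.and (h4.and (ae_restrict_mem measurableSet_Ioo))).exists
  simpa [hv2 (hmem v' hv3)] using hv1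

/-- A function with weak derivative `W` along the second coordinate is bounded on almost every line
by a quantity that depends only on the line and is integrable. -/
theorem HasWeakDeriv.norm_le_mean_add_integral_snd [CompleteSpace F] (hcd : c < d)
    (hf : IntegrableOn f (Ioo a b ×ˢ Ioo c d)) (hW : IntegrableOn W (Ioo a b ×ˢ Ioo c d))
    (h : HasWeakDeriv (Ioo a b ×ˢ Ioo c d) (0, 1) f W) :
    ∀ᵐ z ∂volume.restrict (Ioo a b ×ˢ Ioo c d),
      ‖f z‖ ≤ (d - c)⁻¹ * (∫ w in Ioo c d, ‖f (z.1, w)‖) + ∫ w in Ioo c d, ‖W (z.1, w)‖ := by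
  have hl := h.line_bound hf hW
  rw [IntegrableOn, restrict_prod_Ioo] at hf hW
  rw [restrict_prod_Ioo]
  refine ae_prod_norm_le_of_ae_ae (A := fun u => (d - c)⁻¹ * (∫ w in Ioo c d, ‖f (u, w)‖)
    + ∫ w in Ioo c d, ‖W (u, w)‖) hf.1 ?_ ?_
  · exact (hf.1.norm.integral_prod_right'.const_mul _).add hW.1.norm.integral_prod_right'
  filter_upwards [hl, hf.prod_right_ae] with u h1 h2
  filter_upwards [h1] with v hv
  have hpos : 0 < d - c := sub_pos.2 hcd
  have h3 : ∫ _ in Ioo c d, (‖f (u, v)‖ - ∫ w in Ioo c d, ‖W (u, w)‖)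
      ≤ ∫ w in Ioo c d, ‖f (u, w)‖ := by
    refine integral_mono_ae (integrable_const _) h2.norm ?_
    filter_upwards [hv] with v' hv'
    have := norm_sub_norm_le (f (u, v)) (f (u, v'))
    linarith
  have h4 : (d - c) * (‖f (u, v)‖ - ∫ w in Ioo c d, ‖W (u, w)‖)
      ≤ ∫ w in Ioo c d, ‖f (u, w)‖ := by
    simpa [Real.volume_real_Ioo_of_le hcd.le] using h3
  have h5 := (le_inv_mul_iff₀ hpos).2 h4
  linarith

theorem ae_restrict_prod_swap {P : Spacetime → Prop}
    (h : ∀ᵐ z ∂volume.restrict (Ioo c d ×ˢ Ioo a b), P z.swap) :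
    ∀ᵐ z ∂volume.restrict (Ioo a b ×ˢ Ioo c d), P z := by
  rw [ae_restrict_iff' (measurableSet_Ioo.prod measurableSet_Ioo)] at h ⊢
  filter_upwards [ae_comp_linear (ContinuousLinearEquiv.prodComm ℝ ℝ ℝ) h] with z hz hzQ
  exact hz ⟨hzQ.2, hzQ.1⟩

theorem integrableOn_prod_swap {E : Type*} [NormedAddCommGroup E] {k : Spacetime → E}
    (h : IntegrableOn k (Ioo a b ×ˢ Ioo c d)) :
    IntegrableOn (fun z : Spacetime => k z.swap) (Ioo c d ×ˢ Ioo a b) := by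
  rw [IntegrableOn, restrict_prod_Ioo] at h ⊢
  exact h.swap

theorem HasWeakDeriv.prod_swap (h : HasWeakDeriv (Ioo a b ×ˢ Ioo c d) (1, 0) f W) :
    HasWeakDeriv (Ioo c d ×ˢ Ioo a b) (0, 1) (fun z => f z.swap) (fun z => W z.swap) := by
  have := HasWeakDeriv.comp_linear (ContinuousLinearEquiv.prodComm ℝ ℝ ℝ) (v := (0, 1)) h
  have hpre : (ContinuousLinearEquiv.prodComm ℝ ℝ ℝ) ⁻¹' (Ioo a b ×ˢ Ioo c d)
      = Ioo c d ×ˢ Ioo a b := by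
    ext z
    simp [and_comm]
  rw [hpre] at this
  exact this

theorem HasWeakDeriv.norm_le_integral_fst [CompleteSpace F]
    (hf : IntegrableOn f (Ioo a b ×ˢ Ioo c d)) (hW : IntegrableOn W (Ioo a b ×ˢ Ioo c d))
    (h : HasWeakDeriv (Ioo a b ×ˢ Ioo c d) (1, 0) f W) {H : Set Spacetime}
    (hH : ∀ v ∈ Ioo c d, ∃ a' b', a' < b' ∧ Ioo a' b' ⊆ Ioo a b ∧ ∀ u ∈ Ioo a' b', (u, v) ∈ H)
    (hfH : ∀ᵐ z ∂volume.restrict (Ioo a b ×ˢ Ioo c d), z ∈ H → f z = 0) :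
    ∀ᵐ z ∂volume.restrict (Ioo a b ×ˢ Ioo c d), ‖f z‖ ≤ ∫ u in Ioo a b, ‖W (u, z.2)‖ :=
  ae_restrict_prod_swap <| h.prod_swap.norm_le_integral_snd (H := {z | z.swap ∈ H})
    (integrableOn_prod_swap hf) (integrableOn_prod_swap hW) hH
    (ae_restrict_prod_swap (P := fun z => z.swap ∈ H → f z.swap = 0) (by simpa using hfH))

theorem HasWeakDeriv.norm_le_mean_add_integral_fst [CompleteSpace F] (hab : a < b)
    (hf : IntegrableOn f (Ioo a b ×ˢ Ioo c d)) (hW : IntegrableOn W (Ioo a b ×ˢ Ioo c d))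
    (h : HasWeakDeriv (Ioo a b ×ˢ Ioo c d) (1, 0) f W) :
    ∀ᵐ z ∂volume.restrict (Ioo a b ×ˢ Ioo c d),
      ‖f z‖ ≤ (b - a)⁻¹ * (∫ u in Ioo a b, ‖f (u, z.2)‖) + ∫ u in Ioo a b, ‖W (u, z.2)‖ :=
  ae_restrict_prod_swap <| h.prod_swap.norm_le_mean_add_integral_snd hab
    (integrableOn_prod_swap hf) (integrableOn_prod_swap hW)

/-- If `f` vanishes on an interval of every line in the first coordinate direction and its weak
derivative in that direction is dominated by `m`, then `f` is bounded by the integral of `m`. -/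
theorem HasWeakDeriv.norm_le_of_bound_fst [CompleteSpace F]
    (hf : IntegrableOn f (Ioo a b ×ˢ Ioo c d)) (hW : IntegrableOn W (Ioo a b ×ˢ Ioo c d))
    (h : HasWeakDeriv (Ioo a b ×ˢ Ioo c d) (1, 0) f W) {H : Set Spacetime}
    (hH : ∀ v ∈ Ioo c d, ∃ a' b', a' < b' ∧ Ioo a' b' ⊆ Ioo a b ∧ ∀ u ∈ Ioo a' b', (u, v) ∈ H)
    (hfH : ∀ᵐ z ∂volume.restrict (Ioo a b ×ˢ Ioo c d), z ∈ H → f z = 0) {m : ℝ → ℝ}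
    (hm : IntegrableOn m (Ioo a b))
    (hWm : ∀ᵐ z ∂volume.restrict (Ioo a b ×ˢ Ioo c d), ‖W z‖ ≤ m z.1) :
    ∀ᵐ z ∂volume.restrict (Ioo a b ×ˢ Ioo c d), ‖f z‖ ≤ ∫ u in Ioo a b, m u := by
  have h1 : ∀ᵐ z ∂volume.restrict (Ioo c d ×ˢ Ioo a b), ‖W z.swap‖ ≤ m z.2 :=
    ae_restrict_prod_swap (P := fun z => ‖W z.swap‖ ≤ m z.2) (by simpa using hWm)
  rw [restrict_prod_Ioo] at h1
  have h2 : ∀ᵐ v ∂volume.restrict (Ioo c d),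
      ∫ u in Ioo a b, ‖W (u, v)‖ ≤ ∫ u in Ioo a b, m u := by
    filter_upwards [Measure.ae_ae_of_ae_prod h1] with v hv
    exact integral_mono_of_nonneg (ae_of_all _ fun u => norm_nonneg _) hm hv
  have h3 : ∀ᵐ z ∂volume.restrict (Ioo a b ×ˢ Ioo c d),
      ∫ u in Ioo a b, ‖W (u, z.2)‖ ≤ ∫ u in Ioo a b, m u := by
    rw [restrict_prod_Ioo]
    exact Measure.quasiMeasurePreserving_snd.ae h2
  filter_upwards [h.norm_le_integral_fst hf hW hH hfH, h3] with z h4 h5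
  exact h4.trans h5

theorem HasWeakDeriv.norm_le_of_bound_snd [CompleteSpace F]
    (hf : IntegrableOn f (Ioo a b ×ˢ Ioo c d)) (hW : IntegrableOn W (Ioo a b ×ˢ Ioo c d))
    (h : HasWeakDeriv (Ioo a b ×ˢ Ioo c d) (0, 1) f W) {H : Set Spacetime}
    (hH : ∀ u ∈ Ioo a b, ∃ c' d', c' < d' ∧ Ioo c' d' ⊆ Ioo c d ∧ ∀ v ∈ Ioo c' d', (u, v) ∈ H)
    (hfH : ∀ᵐ z ∂volume.restrict (Ioo a b ×ˢ Ioo c d), z ∈ H → f z = 0) {m : ℝ → ℝ}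
    (hm : IntegrableOn m (Ioo c d))
    (hWm : ∀ᵐ z ∂volume.restrict (Ioo a b ×ˢ Ioo c d), ‖W z‖ ≤ m z.2) :
    ∀ᵐ z ∂volume.restrict (Ioo a b ×ˢ Ioo c d), ‖f z‖ ≤ ∫ u in Ioo c d, m u := by
  rw [restrict_prod_Ioo] at hWm
  have h2 : ∀ᵐ u ∂volume.restrict (Ioo a b),
      ∫ v in Ioo c d, ‖W (u, v)‖ ≤ ∫ v in Ioo c d, m v := by
    filter_upwards [Measure.ae_ae_of_ae_prod hWm] with u hu
    exact integral_mono_of_nonneg (ae_of_all _ fun v => norm_nonneg _) hm hu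
  have h3 : ∀ᵐ z ∂volume.restrict (Ioo a b ×ˢ Ioo c d),
      ∫ v in Ioo c d, ‖W (z.1, v)‖ ≤ ∫ v in Ioo c d, m v := by
    rw [restrict_prod_Ioo]
    exact Measure.quasiMeasurePreserving_fst.ae h2
  filter_upwards [h.norm_le_integral_snd hf hW hH hfH, h3] with z h4 h5
  exact h4.trans h5

end LineConsequences

/-! ### Uniqueness for null systems of differential inequalities -/

section NullSystem

variable {E : Type*} [NormedAddCommGroup E] [NormedSpace ℝ E] [CompleteSpace E]
  {S : Type*} [NormedAddCommGroup S] [NormedSpace ℝ S] [CompleteSpace S]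
  {a b c d : ℝ}

/-- Uniqueness on a null rectangle. The fields are related by `∂₁ p = f`, `∂₂ f = ∂₁ g = W`,
`∂₁ α = α'`, `∂₂ β = β'`, and they satisfy linear differential inequalities whose coefficients are
built from `F z.1` and `G z.2`, the integrals of `F` and `G` being small. If everything vanishes on
a set `H` that contains an interval of each null line of the rectangle, then it vanishes altogether.

With `A = ∫ ‖W‖`, integration along null lines bounds `‖f‖` by a function of the first coordinate
and `‖g‖` by one of the second, each with integral `A`; these bound `‖p‖` by `A`, and `‖α‖`, `‖β‖`
by a multiple of `A`. Inserted into the bound for `W` they give `A ≤ A / 2`. -/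
theorem ae_eq_zero_of_null_system {p f g W : Spacetime → E} {α α' β β' : Spacetime → S}
    {F G : ℝ → ℝ} {H : Set Spacetime} {C η S₀ : ℝ}
    (hp : IntegrableOn p (Ioo a b ×ˢ Ioo c d)) (hf : IntegrableOn f (Ioo a b ×ˢ Ioo c d))
    (hg : IntegrableOn g (Ioo a b ×ˢ Ioo c d)) (hW : IntegrableOn W (Ioo a b ×ˢ Ioo c d))
    (hα : IntegrableOn α (Ioo a b ×ˢ Ioo c d)) (hα' : IntegrableOn α' (Ioo a b ×ˢ Ioo c d))
    (hβ : IntegrableOn β (Ioo a b ×ˢ Ioo c d)) (hβ' : IntegrableOn β' (Ioo a b ×ˢ Ioo c d))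
    (dp : HasWeakDeriv (Ioo a b ×ˢ Ioo c d) (1, 0) p f)
    (df : HasWeakDeriv (Ioo a b ×ˢ Ioo c d) (0, 1) f W)
    (dg : HasWeakDeriv (Ioo a b ×ˢ Ioo c d) (1, 0) g W)
    (dα : HasWeakDeriv (Ioo a b ×ˢ Ioo c d) (1, 0) α α')
    (dβ : HasWeakDeriv (Ioo a b ×ˢ Ioo c d) (0, 1) β β')
    (hH₂ : ∀ u ∈ Ioo a b, ∃ c' d', c' < d' ∧ Ioo c' d' ⊆ Ioo c d ∧ ∀ v ∈ Ioo c' d', (u, v) ∈ H)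
    (hH₁ : ∀ v ∈ Ioo c d, ∃ a' b', a' < b' ∧ Ioo a' b' ⊆ Ioo a b ∧ ∀ u ∈ Ioo a' b', (u, v) ∈ H)
    (hzero : ∀ᵐ z ∂volume.restrict (Ioo a b ×ˢ Ioo c d), z ∈ H →
      p z = 0 ∧ f z = 0 ∧ g z = 0 ∧ α z = 0 ∧ β z = 0)
    (hF : IntegrableOn F (Ioo a b)) (hG : IntegrableOn G (Ioo c d))
    (hF0 : ∀ u, 0 ≤ F u) (hG0 : ∀ v, 0 ≤ G v)
    (hFη : ∫ u in Ioo a b, F u ≤ η) (hGη : ∫ v in Ioo c d, G v ≤ η)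
    (hC : 1 ≤ C) (hη0 : 0 ≤ η) (hη : 8 * C * η ≤ 1)
    (hαS : ∀ᵐ z ∂volume.restrict (Ioo a b ×ˢ Ioo c d), ‖α z‖ ≤ S₀)
    (hβS : ∀ᵐ z ∂volume.restrict (Ioo a b ×ˢ Ioo c d), ‖β z‖ ≤ S₀)
    (bW : ∀ᵐ z ∂volume.restrict (Ioo a b ×ˢ Ioo c d), ‖W z‖ ≤
      C * ((‖p z‖ + ‖α z‖ + ‖β z‖) * (F z.1 * G z.2) + ‖f z‖ * G z.2 + F z.1 * ‖g z‖))
    (bα : ∀ᵐ z ∂volume.restrict (Ioo a b ×ˢ Ioo c d), ‖α' z‖ ≤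
      C * ((‖p z‖ + ‖α z‖ + ‖β z‖) * F z.1 + ‖f z‖))
    (bβ : ∀ᵐ z ∂volume.restrict (Ioo a b ×ˢ Ioo c d), ‖β' z‖ ≤
      C * ((‖p z‖ + ‖α z‖ + ‖β z‖) * G z.2 + ‖g z‖)) :
    ∀ᵐ z ∂volume.restrict (Ioo a b ×ˢ Ioo c d), p z = 0 ∧ α z = 0 ∧ β z = 0 := by
  have hC0 : 0 < C := by linarith
  have hη1 : η ≤ 1 := by nlinarith
  set A : ℝ := ∫ z in Ioo a b ×ˢ Ioo c d, ‖W z‖ with hA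
  have hA0 : 0 ≤ A := integral_nonneg fun z => norm_nonneg _
  set m : ℝ → ℝ := fun u => ∫ w in Ioo c d, ‖W (u, w)‖ with hm
  set l : ℝ → ℝ := fun v => ∫ w in Ioo a b, ‖W (w, v)‖ with hl
  have hWp := hW
  rw [IntegrableOn, restrict_prod_Ioo] at hWp
  have hmi : IntegrableOn m (Ioo a b) := hWp.norm.integral_prod_left
  have hli : IntegrableOn l (Ioo c d) := hWp.norm.integral_prod_right
  have hmA : ∫ u in Ioo a b, m u = A := by
    rw [hA, restrict_prod_Ioo, integral_prod _ hWp.norm]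
  have hlA : ∫ v in Ioo c d, l v = A := by
    rw [hA, restrict_prod_Ioo, integral_prod_symm _ hWp.norm]
  have hfm : ∀ᵐ z ∂volume.restrict (Ioo a b ×ˢ Ioo c d), ‖f z‖ ≤ m z.1 :=
    df.norm_le_integral_snd hf hW hH₂ (hzero.mono fun z hz h => (hz h).2.1)
  have hgl : ∀ᵐ z ∂volume.restrict (Ioo a b ×ˢ Ioo c d), ‖g z‖ ≤ l z.2 :=
    dg.norm_le_integral_fst hg hW hH₁ (hzero.mono fun z hz h => (hz h).2.2.1)
  have hpA : ∀ᵐ z ∂volume.restrict (Ioo a b ×ˢ Ioo c d), ‖p z‖ ≤ A := by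
    rw [← hmA]
    exact dp.norm_le_of_bound_fst hp hf hH₁ (hzero.mono fun z hz h => (hz h).1) hmi hfm
  -- a bound `s` for `‖α‖` and `‖β‖` improves itself, because `F` and `G` have small integrals
  have iter : ∀ s : ℝ, 0 ≤ s →
      (∀ᵐ z ∂volume.restrict (Ioo a b ×ˢ Ioo c d), ‖α z‖ ≤ s ∧ ‖β z‖ ≤ s) →
      ∀ᵐ z ∂volume.restrict (Ioo a b ×ˢ Ioo c d),
        ‖α z‖ ≤ s / 2 + 2 * C * A ∧ ‖β z‖ ≤ s / 2 + 2 * C * A := by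
    intro s hs0 hs
    have hfin : ∀ x : ℝ, x ≤ η → C * ((A + 2 * s) * x + A) ≤ s / 2 + 2 * C * A := by
      intro x hx
      have h1 : (A + 2 * s) * x ≤ (A + 2 * s) * η :=
        mul_le_mul_of_nonneg_left hx (by linarith)
      have h2 : C * ((A + 2 * s) * x + A) ≤ C * ((A + 2 * s) * η + A) :=
        mul_le_mul_of_nonneg_left (by linarith) hC0.le
      have h3 : C * A * η ≤ C * A * 1 := mul_le_mul_of_nonneg_left hη1 (by positivity)
      have h4 : s * (8 * C * η) ≤ s * 1 := mul_le_mul_of_nonneg_left hη hs0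
      nlinarith
    have hα1 : ∀ᵐ z ∂volume.restrict (Ioo a b ×ˢ Ioo c d),
        ‖α z‖ ≤ ∫ u in Ioo a b, C * ((A + 2 * s) * F u + m u) := by
      refine dα.norm_le_of_bound_fst hα hα' hH₁ (hzero.mono fun z hz h => (hz h).2.2.2.1)
        (((hF.const_mul _).add hmi).const_mul C) ?_
      filter_upwards [bα, hs, hpA, hfm] with z h1 h2 h3 h4
      refine h1.trans (mul_le_mul_of_nonneg_left ?_ hC0.le)
      exact add_le_add (mul_le_mul_of_nonneg_right (by linarith [h2.1, h2.2]) (hF0 _)) h4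
    have hβ1 : ∀ᵐ z ∂volume.restrict (Ioo a b ×ˢ Ioo c d),
        ‖β z‖ ≤ ∫ v in Ioo c d, C * ((A + 2 * s) * G v + l v) := by
      refine dβ.norm_le_of_bound_snd hβ hβ' hH₂ (hzero.mono fun z hz h => (hz h).2.2.2.2)
        (((hG.const_mul _).add hli).const_mul C) ?_
      filter_upwards [bβ, hs, hpA, hgl] with z h1 h2 h3 h4
      refine h1.trans (mul_le_mul_of_nonneg_left ?_ hC0.le)
      exact add_le_add (mul_le_mul_of_nonneg_right (by linarith [h2.1, h2.2]) (hG0 _)) h4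
    rw [integral_const_mul, integral_add (hF.const_mul _) hmi, integral_const_mul, hmA] at hα1
    rw [integral_const_mul, integral_add (hG.const_mul _) hli, integral_const_mul, hlA] at hβ1
    filter_upwards [hα1, hβ1] with z h1 h2
    exact ⟨h1.trans (hfin _ hFη), h2.trans (hfin _ hGη)⟩
  -- iterating the bound drives `‖α‖` and `‖β‖` down to its fixed point `4 C A`
  have hS : ∀ᵐ z ∂volume.restrict (Ioo a b ×ˢ Ioo c d), ‖α z‖ ≤ 4 * C * A ∧ ‖β z‖ ≤ 4 * C * A := by
    have hk : ∀ k : ℕ, ∀ᵐ z ∂volume.restrict (Ioo a b ×ˢ Ioo c d),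
        ‖α z‖ ≤ |S₀| * (1 / 2) ^ k + 4 * C * A ∧ ‖β z‖ ≤ |S₀| * (1 / 2) ^ k + 4 * C * A := by
      intro k
      induction k with
      | zero =>
        filter_upwards [hαS, hβS] with z h1 h2
        have : 0 ≤ 4 * C * A := by positivity
        have := le_abs_self S₀
        constructor <;> simp <;> linarith
      | succ k ih =>
        filter_upwards [iter _ (by positivity) ih] with z hz
        have : (|S₀| * (1 / 2) ^ k + 4 * C * A) / 2 + 2 * C * A
            = |S₀| * (1 / 2) ^ (k + 1) + 4 * C * A := by ring
        rwa [this] at hz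
    have hlim : Filter.Tendsto (fun k : ℕ => |S₀| * (1 / 2 : ℝ) ^ k + 4 * C * A) Filter.atTop
        (nhds (4 * C * A)) := by
      have := ((tendsto_pow_atTop_nhds_zero_of_lt_one (r := (1 / 2 : ℝ)) (by norm_num)
        (by norm_num)).const_mul |S₀|).add_const (4 * C * A)
      simpa using this
    filter_upwards [ae_all_iff.2 hk] with z hz
    exact ⟨ge_of_tendsto' hlim fun k => (hz k).1, ge_of_tendsto' hlim fun k => (hz k).2⟩
  have hAle : A ≤ C * ((A + 8 * C * A) * ((∫ u in Ioo a b, F u) * ∫ v in Ioo c d, G v)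
      + A * (∫ v in Ioo c d, G v) + (∫ u in Ioo a b, F u) * A) := by
    have hFG := Integrable.mul_prod hF hG
    have hmG := Integrable.mul_prod hmi hG
    have hFl := Integrable.mul_prod hF hli
    have h12 : Integrable (fun z : ℝ × ℝ => (A + 8 * C * A) * (F z.1 * G z.2) + m z.1 * G z.2)
        ((volume.restrict (Ioo a b)).prod (volume.restrict (Ioo c d))) :=
      (hFG.const_mul _).add hmG
    have hle : A ≤ ∫ z in Ioo a b ×ˢ Ioo c d,
        C * ((A + 8 * C * A) * (F z.1 * G z.2) + m z.1 * G z.2 + F z.1 * l z.2) := by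
      refine integral_mono_ae hW.norm ?_ ?_
      · rw [restrict_prod_Ioo]
        exact (h12.add hFl).const_mul C
      · filter_upwards [bW, hS, hpA, hfm, hgl] with z h1 h2 h3 h4 h5
        refine h1.trans (mul_le_mul_of_nonneg_left ?_ hC0.le)
        exact add_le_add (add_le_add (mul_le_mul_of_nonneg_right (by linarith [h2.1, h2.2])
          (mul_nonneg (hF0 _) (hG0 _))) (mul_le_mul_of_nonneg_right h4 (hG0 _)))
          (mul_le_mul_of_nonneg_left h5 (hF0 _))
    rw [restrict_prod_Ioo, integral_const_mul,
      integral_add h12 hFl, integral_add (hFG.const_mul _) hmG,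
      integral_const_mul, integral_prod_mul, integral_prod_mul, integral_prod_mul, hmA, hlA] at hle
    exact hle
  have hFpos : 0 ≤ ∫ u in Ioo a b, F u := integral_nonneg hF0
  have hGpos : 0 ≤ ∫ v in Ioo c d, G v := integral_nonneg hG0
  have hA2 : A ≤ A / 2 := by
    refine hAle.trans ?_
    have h1 : (∫ u in Ioo a b, F u) * ∫ v in Ioo c d, G v ≤ η * η :=
      mul_le_mul hFη hGη hGpos hη0
    calc C * ((A + 8 * C * A) * ((∫ u in Ioo a b, F u) * ∫ v in Ioo c d, G v)
          + A * (∫ v in Ioo c d, G v) + (∫ u in Ioo a b, F u) * A)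
        ≤ C * ((A + 8 * C * A) * (η * η) + A * η + η * A) := by gcongr
      _ = A * ((C * η) * η + 8 * (C * η) * (C * η) + 2 * (C * η)) := by ring
      _ ≤ A * (1 / 2) := by
          refine mul_le_mul_of_nonneg_left ?_ hA0
          have hx0 : 0 ≤ C * η := by positivity
          have hx : C * η ≤ 1 / 8 := by linarith
          have hη' : η ≤ 1 / 8 := by nlinarith
          nlinarith
      _ = A / 2 := by ring
  have hA00 : A = 0 := by linarith
  filter_upwards [hpA, hS] with z h1 h2
  rw [hA00] at h1 h2
  simp only [mul_zero, norm_le_zero_iff] at h1 h2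
  exact ⟨h1, h2.1, h2.2⟩

end NullSystem

section NullField

/-- The unknowns of a first order null system: a map `p` with its null derivatives `f = ∂₁ p`,
`g = ∂₂ p`, its mixed derivative `W = ∂₁ ∂₂ p`, and two fields `α`, `β`, each with its derivative in
one null direction, `α' = ∂₁ α` and `β' = ∂₂ β`. -/
structure NullField (E S : Type*) where
  p : Spacetime → E
  f : Spacetime → E
  g : Spacetime → E
  W : Spacetime → E
  α : Spacetime → S
  α' : Spacetime → S
  β : Spacetime → S
  β' : Spacetime → S

variable {E : Type*} [NormedAddCommGroup E] [NormedSpace ℝ E]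
  {S : Type*} [NormedAddCommGroup S] [NormedSpace ℝ S]

/-- The derivatives recorded in a `NullField` are weak derivatives on `O`, in the null
directions `e₁` and `e₂`. -/
structure NullField.IsWeak (Φ : NullField E S) (O : Set Spacetime) (e₁ e₂ : Spacetime) : Prop where
  dp₁ : HasWeakDeriv O e₁ Φ.p Φ.f
  dp₂ : HasWeakDeriv O e₂ Φ.p Φ.g
  df : HasWeakDeriv O e₂ Φ.f Φ.W
  dg : HasWeakDeriv O e₁ Φ.g Φ.W
  dα : HasWeakDeriv O e₁ Φ.α Φ.α'
  dβ : HasWeakDeriv O e₂ Φ.β Φ.β'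

/-- The differential inequalities satisfied by the difference of two solutions of a semilinear null
system; `F` and `G` stand for the sizes of the derivatives of the two solutions in the two null
directions. -/
structure NullField.IsDominated (Δ : NullField E S) (O : Set Spacetime) (C : ℝ)
    (F G : Spacetime → ℝ) : Prop where
  bW : ∀ᵐ z, z ∈ O → ‖Δ.W z‖ ≤
    C * ((‖Δ.p z‖ + ‖Δ.α z‖ + ‖Δ.β z‖) * (F z * G z) + ‖Δ.f z‖ * G z + F z * ‖Δ.g z‖)
  bα : ∀ᵐ z, z ∈ O → ‖Δ.α' z‖ ≤ C * ((‖Δ.p z‖ + ‖Δ.α z‖ + ‖Δ.β z‖) * F z + ‖Δ.f z‖)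
  bβ : ∀ᵐ z, z ∈ O → ‖Δ.β' z‖ ≤ C * ((‖Δ.p z‖ + ‖Δ.α z‖ + ‖Δ.β z‖) * G z + ‖Δ.g z‖)

/-- Composition of the unknowns with a change of coordinates. -/
def NullField.comp (Φ : NullField E S) (A : Spacetime → Spacetime) : NullField E S :=
  ⟨fun z => Φ.p (A z), fun z => Φ.f (A z), fun z => Φ.g (A z), fun z => Φ.W (A z),
    fun z => Φ.α (A z), fun z => Φ.α' (A z), fun z => Φ.β (A z), fun z => Φ.β' (A z)⟩

variable {O O' : Set Spacetime} {e₁ e₂ : Spacetime} {Φ Φ' Δ : NullField E S} {C : ℝ}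
  {F G : Spacetime → ℝ}

theorem NullField.IsWeak.mono (h : Φ.IsWeak O e₁ e₂) (hO : O' ⊆ O) : Φ.IsWeak O' e₁ e₂ :=
  ⟨h.dp₁.mono hO, h.dp₂.mono hO, h.df.mono hO, h.dg.mono hO, h.dα.mono hO, h.dβ.mono hO⟩

theorem NullField.IsWeak.comp_linear (A : Spacetime ≃L[ℝ] Spacetime)
    (h : Φ.IsWeak O (A e₁) (A e₂)) : (Φ.comp A).IsWeak (A ⁻¹' O) e₁ e₂ :=
  ⟨h.dp₁.comp_linear A, h.dp₂.comp_linear A, h.df.comp_linear A, h.dg.comp_linear A,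
    h.dα.comp_linear A, h.dβ.comp_linear A⟩

theorem NullField.IsDominated.comp_linear {E S : Type*} [NormedAddCommGroup E]
    [NormedAddCommGroup S] {Δ : NullField E S} {O : Set Spacetime} {C : ℝ} {F G : Spacetime → ℝ}
    (A : Spacetime ≃L[ℝ] Spacetime)
    (h : Δ.IsDominated O C F G) :
    (Δ.comp A).IsDominated (A ⁻¹' O) C (fun z => F (A z)) fun z => G (A z) :=
  ⟨ae_comp_linear A h.bW, ae_comp_linear A h.bα, ae_comp_linear A h.bβ⟩

/-- Absolute continuity of the integral, for short intervals. -/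
theorem exists_setIntegral_Ioo_le {F : ℝ → ℝ} {a₀ b₀ : ℝ} (hF : IntegrableOn F (Ioo a₀ b₀))
    (hF0 : ∀ u, 0 ≤ F u) {η : ℝ} (hη : 0 < η) :
    ∃ ℓ > 0, ∀ a b, a₀ ≤ a → b ≤ b₀ → b - a ≤ ℓ → ∫ u in Ioo a b, F u ≤ η := by
  have hfin : ∫⁻ u in Ioo a₀ b₀, ENNReal.ofReal (F u) ≠ ⊤ := by
    have := hF.lintegral_lt_top
    exact this.ne
  obtain ⟨δ, hδ, h⟩ := exists_pos_setLIntegral_lt_of_measure_lt hfin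
    (ε := ENNReal.ofReal η) (by simpa using hη)
  obtain ⟨ℓ, hℓ0, hℓ⟩ : ∃ ℓ : ℝ, 0 < ℓ ∧ ENNReal.ofReal ℓ < δ := by
    obtain ⟨x, hx0, hx⟩ := ENNReal.lt_iff_exists_nnreal_btwn.1 hδ
    refine ⟨x, by simpa using hx0, by simpa using hx⟩
  refine ⟨ℓ, hℓ0, fun a b ha hb hab => ?_⟩
  have hsub : Ioo a b ⊆ Ioo a₀ b₀ := Ioo_subset_Ioo ha hb
  have hvol : (volume.restrict (Ioo a₀ b₀)) (Ioo a b) < δ := by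
    refine (Measure.restrict_apply_le _ _).trans_lt ?_
    rw [Real.volume_Ioo]
    exact (ENNReal.ofReal_le_ofReal hab).trans_lt hℓ
  have h1 := h _ hvol
  rw [Measure.restrict_restrict measurableSet_Ioo, inter_eq_left.2 hsub] at h1
  rw [integral_eq_lintegral_of_nonneg_ae (ae_of_all _ hF0) (hF.mono_set hsub).1]
  exact ENNReal.toReal_le_of_le_ofReal hη.le h1.le

variable [CompleteSpace E] [CompleteSpace S]

/-- Uniqueness for a semilinear null system on small null rectangles: `Φ` and `Φ'` are two
solutions, `Δ` is their difference, possibly cut off. The null derivatives of the two solutions need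
not be bounded: on a fixed rectangle they are dominated by integrable functions of one null
coordinate, whose integrals over short intervals are small. -/
theorem NullField.exists_rectangle_uniqueness {a₀ b₀ c₀ d₀ S₀ : ℝ} (hab : a₀ < b₀) (hcd : c₀ < d₀)
    (hO : Icc a₀ b₀ ×ˢ Icc c₀ d₀ ⊆ O)
    (hΦ : Φ.IsWeak O (1, 0) (0, 1)) (hΦ' : Φ'.IsWeak O (1, 0) (0, 1))
    (hΔ : Δ.IsWeak O (1, 0) (0, 1)) (hC : 1 ≤ C)
    (hdom : Δ.IsDominated O C (fun z => 1 + ‖Φ.f z‖ + ‖Φ'.f z‖)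
      fun z => 1 + ‖Φ.g z‖ + ‖Φ'.g z‖)
    (hS : ∀ z ∈ O, ‖Δ.α z‖ ≤ S₀ ∧ ‖Δ.β z‖ ≤ S₀) :
    ∃ ℓ > 0, ∀ a b c d, a₀ ≤ a → b ≤ b₀ → c₀ ≤ c → d ≤ d₀ → b - a ≤ ℓ → d - c ≤ ℓ →
      ∀ H : Set Spacetime, IsOpen H →
      (∀ u ∈ Ioo a b, ∃ c' d', c' < d' ∧ Ioo c' d' ⊆ Ioo c d ∧ ∀ v ∈ Ioo c' d', (u, v) ∈ H) →
      (∀ v ∈ Ioo c d, ∃ a' b', a' < b' ∧ Ioo a' b' ⊆ Ioo a b ∧ ∀ u ∈ Ioo a' b', (u, v) ∈ H) →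
      (∀ z ∈ Ioo a b ×ˢ Ioo c d, z ∈ H → Δ.p z = 0 ∧ Δ.α z = 0 ∧ Δ.β z = 0) →
      ∀ᵐ z, z ∈ Ioo a b ×ˢ Ioo c d → Δ.p z = 0 ∧ Δ.α z = 0 ∧ Δ.β z = 0 := by
  have hsub₀ : Ioo a₀ b₀ ×ˢ Ioo c₀ d₀ ⊆ Icc a₀ b₀ ×ˢ Icc c₀ d₀ :=
    prod_mono Ioo_subset_Icc_self Ioo_subset_Icc_self
  have hintE : ∀ {X : Type _} [NormedAddCommGroup X] {k : Spacetime → X},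
      LocallyIntegrableOn k O → IntegrableOn k (Ioo a₀ b₀ ×ˢ Ioo c₀ d₀) := fun hk =>
    (hk.integrableOn_compact_subset hO (isCompact_Icc.prod isCompact_Icc)).mono_set hsub₀
  have hintS : ∀ {X : Type _} [NormedAddCommGroup X] {k : Spacetime → X},
      LocallyIntegrableOn k O → IntegrableOn k (Ioo a₀ b₀ ×ˢ Ioo c₀ d₀) := fun hk =>
    (hk.integrableOn_compact_subset hO (isCompact_Icc.prod isCompact_Icc)).mono_set hsub₀
  -- the bounds of the null derivatives of a solution along null lines
  have env : ∀ {Ψ : NullField E S}, Ψ.IsWeak O (1, 0) (0, 1) → ∃ F G : ℝ → ℝ,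
      IntegrableOn F (Ioo a₀ b₀) ∧ IntegrableOn G (Ioo c₀ d₀) ∧ (∀ u, 0 ≤ F u) ∧ (∀ v, 0 ≤ G v) ∧
      ∀ᵐ z ∂volume.restrict (Ioo a₀ b₀ ×ˢ Ioo c₀ d₀), ‖Ψ.f z‖ ≤ F z.1 ∧ ‖Ψ.g z‖ ≤ G z.2 := by
    intro Ψ hΨ
    have hΨ₀ := hΨ.mono (hsub₀.trans hO)
    have hfi := hintE hΨ.df.1
    have hgi := hintE hΨ.dg.1
    have hWi := hintE hΨ.df.2
    have h1 := hΨ₀.df.norm_le_mean_add_integral_snd hcd hfi hWi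
    have h2 := hΨ₀.dg.norm_le_mean_add_integral_fst hab hgi hWi
    rw [IntegrableOn, restrict_prod_Ioo] at hfi hgi hWi
    refine ⟨_, _, (hfi.norm.integral_prod_left.const_mul (d₀ - c₀)⁻¹).add
        hWi.norm.integral_prod_left,
      (hgi.norm.integral_prod_right.const_mul (b₀ - a₀)⁻¹).add
        hWi.norm.integral_prod_right, ?_, ?_, h1.and h2⟩
    · intro u
      exact add_nonneg (mul_nonneg (inv_nonneg.2 (sub_pos.2 hcd).le)
        (integral_nonneg fun _ => norm_nonneg _)) (integral_nonneg fun _ => norm_nonneg _)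
    · intro u
      exact add_nonneg (mul_nonneg (inv_nonneg.2 (sub_pos.2 hab).le)
        (integral_nonneg fun _ => norm_nonneg _)) (integral_nonneg fun _ => norm_nonneg _)
  obtain ⟨F₁, G₁, hF₁i, hG₁i, hF₁0, hG₁0, h₁⟩ := env hΦ
  obtain ⟨F₂, G₂, hF₂i, hG₂i, hF₂0, hG₂0, h₂⟩ := env hΦ'
  set F : ℝ → ℝ := fun u => 1 + F₁ u + F₂ u with hF
  set G : ℝ → ℝ := fun u => 1 + G₁ u + G₂ u with hG
  have hFi : IntegrableOn F (Ioo a₀ b₀) := ((integrable_const (1 : ℝ)).add hF₁i).add hF₂i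
  have hGi : IntegrableOn G (Ioo c₀ d₀) := ((integrable_const (1 : ℝ)).add hG₁i).add hG₂i
  have hF0 : ∀ u, 0 ≤ F u := fun u => by
    have := hF₁0 u; have := hF₂0 u; simp only [hF]; linarith
  have hG0 : ∀ u, 0 ≤ G u := fun u => by
    have := hG₁0 u; have := hG₂0 u; simp only [hG]; linarith
  have hC0 : 0 < C := by linarith
  have hη : (0 : ℝ) < 1 / (8 * C) := by positivity
  -- lengths for which the integrals of `F` and `G` meet the smallness required for the contraction
  obtain ⟨ℓ₁, hℓ₁, hFℓ⟩ := exists_setIntegral_Ioo_le hFi hF0 hη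
  obtain ⟨ℓ₂, hℓ₂, hGℓ⟩ := exists_setIntegral_Ioo_le hGi hG0 hη
  refine ⟨min ℓ₁ ℓ₂, lt_min hℓ₁ hℓ₂, ?_⟩
  intro a b c d ha hb hc hd hba hdc H hHo hH₂ hH₁ hzero
  have hsub : Ioo a b ×ˢ Ioo c d ⊆ Ioo a₀ b₀ ×ˢ Ioo c₀ d₀ :=
    prod_mono (Ioo_subset_Ioo ha hb) (Ioo_subset_Ioo hc hd)
  have hsubO : Ioo a b ×ˢ Ioo c d ⊆ O := (hsub.trans hsub₀).trans hO
  have hQo : IsOpen (Ioo a b ×ˢ Ioo c d : Set Spacetime) := isOpen_Ioo.prod isOpen_Ioo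
  have hQm := hQo.measurableSet
  have hΔQ := hΔ.mono hsubO
  have hFG : ∀ᵐ z ∂volume.restrict (Ioo a b ×ˢ Ioo c d),
      1 + ‖Φ.f z‖ + ‖Φ'.f z‖ ≤ F z.1 ∧ 1 + ‖Φ.g z‖ + ‖Φ'.g z‖ ≤ G z.2 := by
    filter_upwards [ae_restrict_of_ae_restrict_of_subset hsub h₁,
      ae_restrict_of_ae_restrict_of_subset hsub h₂] with z hz1 hz2
    simp only [hF, hG]
    constructor
    · linarith [hz1.1, hz2.1]
    · linarith [hz1.2, hz2.2]
  have hHQ : IsOpen (Ioo a b ×ˢ Ioo c d ∩ H) := hQo.inter hHo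
  have hf0 : ∀ᵐ z, z ∈ Ioo a b ×ˢ Ioo c d ∩ H → Δ.f z = 0 :=
    (hΔQ.dp₁.mono inter_subset_left).eq_zero_of_eq_zero hHQ
      (ae_of_all _ fun z hz => (hzero z hz.1 hz.2).1)
  have hg0 : ∀ᵐ z, z ∈ Ioo a b ×ˢ Ioo c d ∩ H → Δ.g z = 0 :=
    (hΔQ.dp₂.mono inter_subset_left).eq_zero_of_eq_zero hHQ
      (ae_of_all _ fun z hz => (hzero z hz.1 hz.2).1)
  rw [← ae_restrict_iff' hQm]
  refine ae_eq_zero_of_null_system (F := F) (G := G) (H := H) (C := C) (η := 1 / (8 * C))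
    (S₀ := S₀) ((hintE hΔ.dp₁.1).mono_set hsub) ((hintE hΔ.df.1).mono_set hsub)
    ((hintE hΔ.dg.1).mono_set hsub) ((hintE hΔ.df.2).mono_set hsub)
    ((hintS hΔ.dα.1).mono_set hsub) ((hintS hΔ.dα.2).mono_set hsub)
    ((hintS hΔ.dβ.1).mono_set hsub) ((hintS hΔ.dβ.2).mono_set hsub)
    hΔQ.dp₁ hΔQ.df hΔQ.dg hΔQ.dα hΔQ.dβ hH₂ hH₁ ?_
    (hFi.mono_set (Ioo_subset_Ioo ha hb)) (hGi.mono_set (Ioo_subset_Ioo hc hd)) hF0 hG0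
    (hFℓ a b ha hb (hba.trans (min_le_left _ _))) (hGℓ c d hc hd (hdc.trans (min_le_right _ _)))
    hC hη.le (by field_simp; norm_num) ?_ ?_ ?_ ?_ ?_
  · filter_upwards [ae_restrict_mem hQm, ae_restrict_of_ae hf0, ae_restrict_of_ae hg0]
      with z hz hzf hzg hzH
    obtain ⟨z1, z2, z3⟩ := hzero z hz hzH
    exact ⟨z1, hzf ⟨hz, hzH⟩, hzg ⟨hz, hzH⟩, z2, z3⟩
  · filter_upwards [ae_restrict_mem hQm] with z hz using (hS z (hsubO hz)).1
  · filter_upwards [ae_restrict_mem hQm] with z hz using (hS z (hsubO hz)).2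
  · filter_upwards [ae_restrict_mem hQm, ae_restrict_of_ae hdom.bW, hFG] with z hz h h'
    refine (h (hsubO hz)).trans ?_
    have := h'.1
    have := h'.2
    gcongr
    exact hF0 _
  · filter_upwards [ae_restrict_mem hQm, ae_restrict_of_ae hdom.bα, hFG] with z hz h h'
    refine (h (hsubO hz)).trans ?_
    have := h'.1
    gcongr
  · filter_upwards [ae_restrict_mem hQm, ae_restrict_of_ae hdom.bβ, hFG] with z hz h h'
    refine (h (hsubO hz)).trans ?_
    have := h'.2
    gcongr

end NullField

section Diamond

/-- The open causal diamond of radius `ρ` about the point `(τ, x)`. -/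
def diamond (τ x ρ : ℝ) : Set Spacetime := {z | |z.1 - τ| + |z.2 - x| < ρ}

theorem isOpen_diamond (τ x ρ : ℝ) : IsOpen (diamond τ x ρ) :=
  isOpen_lt (by fun_prop) continuous_const

/-- The null coordinates `(u, v)`, with `t = u + v` and `x = u - v`. -/
noncomputable def nullCoord : Spacetime ≃L[ℝ] Spacetime :=
  ContinuousLinearEquiv.equivOfInverse
    ((ContinuousLinearMap.fst ℝ ℝ ℝ + ContinuousLinearMap.snd ℝ ℝ ℝ).prod
      (ContinuousLinearMap.fst ℝ ℝ ℝ - ContinuousLinearMap.snd ℝ ℝ ℝ))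
    (((1 / 2 : ℝ) • (ContinuousLinearMap.fst ℝ ℝ ℝ + ContinuousLinearMap.snd ℝ ℝ ℝ)).prod
      ((1 / 2 : ℝ) • (ContinuousLinearMap.fst ℝ ℝ ℝ - ContinuousLinearMap.snd ℝ ℝ ℝ)))
    (fun z => by ext <;> simp <;> ring) (fun z => by ext <;> simp <;> ring)

theorem nullCoord_apply (z : Spacetime) : nullCoord z = (z.1 + z.2, z.1 - z.2) := rfl

theorem nullCoord_symm_apply (z : Spacetime) :
    nullCoord.symm z = ((1 / 2 : ℝ) * (z.1 + z.2), (1 / 2 : ℝ) * (z.1 - z.2)) := rfl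

theorem mem_diamond_iff {τ x ρ : ℝ} {z : Spacetime} :
    nullCoord z ∈ diamond τ x ρ ↔
      z ∈ Ioo ((τ + x) / 2 - ρ / 2) ((τ + x) / 2 + ρ / 2) ×ˢ
        Ioo ((τ - x) / 2 - ρ / 2) ((τ - x) / 2 + ρ / 2) := by
  simp only [diamond, nullCoord_apply, mem_ofPred_eq, mem_prod, mem_Ioo]
  constructor
  · intro h
    have h1 := abs_le.1 (le_refl |z.1 + z.2 - τ|)
    have h2 := abs_le.1 (le_refl |z.1 - z.2 - x|)
    refine ⟨⟨?_, ?_⟩, ?_, ?_⟩ <;> linarith [h1.1, h1.2, h2.1, h2.2]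
  · rintro ⟨⟨h1, h2⟩, h3, h4⟩
    rcases abs_cases (z.1 + z.2 - τ) with h5 | h5 <;>
    rcases abs_cases (z.1 - z.2 - x) with h6 | h6 <;> linarith

variable {E : Type*} [NormedAddCommGroup E] [NormedSpace ℝ E] [CompleteSpace E]
  {S : Type*} [NormedAddCommGroup S] [NormedSpace ℝ S] [CompleteSpace S]
  {O : Set Spacetime} {Φ Φ' Δ : NullField E S} {C : ℝ}

/-- Uniqueness on small causal diamonds: if the difference of two solutions vanishes in the lower
half (`σ = 1`) or the upper half (`σ = -1`) of the diamond, then it vanishes in the diamond. -/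
theorem NullField.exists_diamond_uniqueness {S₀ : ℝ} {q : Spacetime} (hO : IsOpen O) (hq : q ∈ O)
    (hΦ : Φ.IsWeak O (1, 1) (1, -1)) (hΦ' : Φ'.IsWeak O (1, 1) (1, -1))
    (hΔ : Δ.IsWeak O (1, 1) (1, -1)) (hC : 1 ≤ C)
    (hdom : Δ.IsDominated O C (fun z => 1 + ‖Φ.f z‖ + ‖Φ'.f z‖)
      fun z => 1 + ‖Φ.g z‖ + ‖Φ'.g z‖)
    (hS : ∀ z ∈ O, ‖Δ.α z‖ ≤ S₀ ∧ ‖Δ.β z‖ ≤ S₀) :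
    ∃ r > 0, ∀ τ x ρ, |τ - q.1| < r → |x - q.2| < r → ρ < r → ∀ σ : ℝ, (σ = 1 ∨ σ = -1) →
      (∀ z ∈ diamond τ x ρ, σ * (z.1 - τ) < 0 → Δ.p z = 0 ∧ Δ.α z = 0 ∧ Δ.β z = 0) →
      ∀ᵐ z, z ∈ diamond τ x ρ → Δ.p z = 0 ∧ Δ.α z = 0 ∧ Δ.β z = 0 := by
  set w := nullCoord.symm q with hw
  have hwO : w ∈ nullCoord ⁻¹' O := by simpa [hw] using hq
  have hOo : IsOpen (nullCoord ⁻¹' O) := hO.preimage nullCoord.continuous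
  obtain ⟨ε, hε, hball⟩ := Metric.nhds_basis_closedBall.mem_iff.1 (hOo.mem_nhds hwO)
  have hrect : Icc (w.1 - ε) (w.1 + ε) ×ˢ Icc (w.2 - ε) (w.2 + ε) ⊆ nullCoord ⁻¹' O := by
    rw [← Real.closedBall_eq_Icc, ← Real.closedBall_eq_Icc, closedBall_prod_same]
    exact hball
  have e₁ : nullCoord (1, 0) = (1, 1) := by simp [nullCoord_apply]
  have e₂ : nullCoord (0, 1) = (1, -1) := by simp [nullCoord_apply]
  rw [← e₁, ← e₂] at hΦ hΦ' hΔ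
  obtain ⟨ℓ, hℓ, huniq⟩ := NullField.exists_rectangle_uniqueness (by linarith) (by linarith) hrect
    (hΦ.comp_linear nullCoord) (hΦ'.comp_linear nullCoord) (hΔ.comp_linear nullCoord) hC
    (hdom.comp_linear nullCoord) (S₀ := S₀) fun z hz => hS _ hz
  refine ⟨min (ε / 2) ℓ, lt_min (by linarith) hℓ, ?_⟩
  intro τ x ρ hτ hx hρ σ hσ hzero
  obtain ⟨hτ1, hτ2⟩ := abs_lt.1 (hτ.trans_le (min_le_left _ _))
  obtain ⟨hx1, hx2⟩ := abs_lt.1 (hx.trans_le (min_le_left _ _))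
  have hρ1 := hρ.trans_le (min_le_left _ _)
  have hρ2 := hρ.trans_le (min_le_right _ _)
  have hw1 : w.1 = (q.1 + q.2) / 2 := by rw [hw, nullCoord_symm_apply]; ring
  have hw2 : w.2 = (q.1 - q.2) / 2 := by rw [hw, nullCoord_symm_apply]; ring
  have key := huniq ((τ + x) / 2 - ρ / 2) ((τ + x) / 2 + ρ / 2)
    ((τ - x) / 2 - ρ / 2) ((τ - x) / 2 + ρ / 2) (by rw [hw1]; linarith) (by rw [hw1]; linarith)
    (by rw [hw2]; linarith) (by rw [hw2]; linarith) (by linarith) (by linarith)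
    {z | σ * (z.1 + z.2 - τ) < 0} (isOpen_lt (by fun_prop) continuous_const) ?_ ?_ ?_
  · filter_upwards [ae_comp_linear nullCoord.symm key] with z hz hzd
    have := hz (mem_diamond_iff.1 (by simpa using hzd))
    simpa [NullField.comp] using this
  · rintro u ⟨hu1, hu2⟩
    rcases hσ with rfl | rfl
    · refine ⟨(τ - x) / 2 - ρ / 2, min ((τ - x) / 2 + ρ / 2) (τ - u), lt_min ?_ ?_,
        Ioo_subset_Ioo le_rfl (min_le_left _ _), fun v hv => ?_⟩
      · linarith
      · linarith
      · have := hv.2.trans_le (min_le_right _ _)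
        simp only [mem_ofPred_eq]; linarith
    · refine ⟨max ((τ - x) / 2 - ρ / 2) (τ - u), (τ - x) / 2 + ρ / 2, max_lt ?_ ?_,
        Ioo_subset_Ioo (le_max_left _ _) le_rfl, fun v hv => ?_⟩
      · linarith
      · linarith
      · have := (le_max_right _ _).trans_lt hv.1
        simp only [mem_ofPred_eq]; linarith
  · rintro u ⟨hu1, hu2⟩
    rcases hσ with rfl | rfl
    · refine ⟨(τ + x) / 2 - ρ / 2, min ((τ + x) / 2 + ρ / 2) (τ - u), lt_min ?_ ?_,
        Ioo_subset_Ioo le_rfl (min_le_left _ _), fun v hv => ?_⟩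
      · linarith
      · linarith
      · have := hv.2.trans_le (min_le_right _ _)
        simp only [mem_ofPred_eq]; linarith
    · refine ⟨max ((τ + x) / 2 - ρ / 2) (τ - u), (τ + x) / 2 + ρ / 2, max_lt ?_ ?_,
        Ioo_subset_Ioo (le_max_left _ _) le_rfl, fun v hv => ?_⟩
      · linarith
      · linarith
      · have := (le_max_right _ _).trans_lt hv.1
        simp only [mem_ofPred_eq]; linarith
  · intro z hz hzH
    exact hzero (nullCoord z) (mem_diamond_iff.2 hz) hzH

end Diamond

section Propagation

/-- A closed set of events that contains the line `t = 0`, and with the lower half of a small causal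
diamond always its upper half, contains the half plane `t ≥ 0`: in the backward cone of an event
that is not in the set, consider the infimum of the times of such events. -/
theorem mem_of_diamond_propagation {Z : Set Spacetime} (hZ : IsClosed Z)
    (h0 : ∀ x : ℝ, ((0, x) : Spacetime) ∈ Z)
    (hloc : ∀ q ∈ Z, 0 ≤ q.1 → ∃ r > 0, ∀ τ x ρ, 0 ≤ τ → |τ - q.1| < r → |x - q.2| < r → ρ < r →
      (∀ z ∈ diamond τ x ρ, z.1 < τ → 0 < z.1 → z ∈ Z) →
      ∀ z ∈ diamond τ x ρ, 0 < z.1 → z ∈ Z)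
    (z : Spacetime) (hz : 0 ≤ z.1) : z ∈ Z := by
  by_contra hzZ
  set K : Set Spacetime := {y | 0 ≤ y.1 ∧ |y.2 - z.2| ≤ z.1 - y.1} with hK
  have hKc : IsCompact K := by
    refine Metric.isCompact_of_isClosed_isBounded ?_ ?_
    · exact (isClosed_le continuous_const continuous_fst).inter
        (isClosed_le (by fun_prop : Continuous fun y : Spacetime => |y.2 - z.2|)
          (by fun_prop : Continuous fun y : Spacetime => z.1 - y.1))
    · refine (Metric.isBounded_Icc ((0, z.2 - z.1) : Spacetime) (z.1, z.2 + z.1)).subset ?_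
      rintro y ⟨hy0, hy⟩
      have h1 := abs_nonneg (y.2 - z.2)
      obtain ⟨h2, h3⟩ := abs_le.1 hy
      refine ⟨⟨hy0, ?_⟩, ?_, ?_⟩ <;> simp only <;> linarith
  have hzK : z ∈ K := ⟨hz, by simp⟩
  set T : Set ℝ := Prod.fst '' (K \ Z) with hT
  have hTne : T.Nonempty := ⟨z.1, z, ⟨hzK, hzZ⟩, rfl⟩
  have hTb : BddBelow T := ⟨0, by rintro _ ⟨y, hy, rfl⟩; exact hy.1.1⟩
  set s := sInf T with hs
  have hlow : ∀ y ∈ K, y.1 < s → y ∈ Z := fun y hy hys => by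
    by_contra hyZ
    exact (notMem_of_lt_csInf hys hTb) ⟨y, ⟨hy, hyZ⟩, rfl⟩
  -- lowering an event of the backward cone stays in the cone, so limits of lower events decide
  have hlim : ∀ y ∈ K, 0 < y.1 → (∃ δ > 0, ∀ ε, 0 < ε → ε < δ → (y.1 - ε, y.2) ∈ Z) → y ∈ Z := by
    rintro y hy hy0 ⟨δ, hδ, h⟩
    have hc : Filter.Tendsto (fun ε : ℝ => ((y.1 - ε, y.2) : Spacetime)) (nhdsWithin 0 (Ioi 0))
        (nhds y) := by
      have : Continuous fun ε : ℝ => ((y.1 - ε, y.2) : Spacetime) := by fun_prop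
      simpa using (this.tendsto 0).mono_left nhdsWithin_le_nhds
    refine hZ.mem_of_tendsto hc ?_
    filter_upwards [Ioo_mem_nhdsGT hδ] with ε hε
    exact h ε hε.1 hε.2
  have hdown : ∀ y ∈ K, ∀ ε, 0 < ε → ε < y.1 → ((y.1 - ε, y.2) : Spacetime) ∈ K := by
    rintro y ⟨hy0, hy⟩ ε h1 h2
    exact ⟨by simp only; linarith, by simp only; linarith⟩
  have hZ' : ∀ y ∈ K, y.1 ≤ s → y ∈ Z := by
    intro y hy hys
    rcases hy.1.eq_or_lt with h | h
    · have := h0 y.2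
      rwa [h] at this
    · refine hlim y hy h ⟨y.1, h, fun ε h1 h2 => hlow _ (hdown y hy ε h1 h2) ?_⟩
      simp only
      linarith
  obtain ⟨t, -, htlim, htT⟩ := exists_seq_tendsto_sInf hTne hTb
  choose y hy hyt using htT
  obtain ⟨q, hqK, k, hk, hyq⟩ := hKc.tendsto_subseq fun n => (hy n).1
  have hqs : q.1 = s := by
    have h1 : Filter.Tendsto (fun n => (y (k n)).1) Filter.atTop (nhds q.1) :=
      (continuous_fst.tendsto q).comp hyq
    have h2 : Filter.Tendsto (fun n => (y (k n)).1) Filter.atTop (nhds s) := by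
      simp only [hyt]
      exact htlim.comp hk.tendsto_atTop
    exact tendsto_nhds_unique h1 h2
  have hs0 : 0 ≤ s := hqs ▸ hqK.1
  obtain ⟨r, hr, hprop⟩ := hloc q (hZ' q hqK hqs.le) hqK.1
  obtain ⟨n, hn⟩ := (hyq.eventually (Metric.ball_mem_nhds q hr)).exists
  set x := y (k n) with hx
  have hxK : x ∈ K := (hy (k n)).1
  have hxZ : x ∉ Z := (hy (k n)).2
  have hxq : dist x q < r := hn
  rw [Prod.dist_eq, max_lt_iff, Real.dist_eq, Real.dist_eq] at hxq
  have hsx : s < x.1 := by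
    by_contra h
    exact hxZ (hZ' x hxK (not_lt.1 h))
  have hρ : x.1 - s < r := by
    have := (abs_lt.1 hxq.1).2
    linarith
  have hd := hprop s x.2 (x.1 - s) hs0 (by rw [hqs]; simpa using hr) hxq.2 hρ ?_
  · refine hxZ (hlim x hxK (hs0.trans_lt hsx) ⟨x.1 - s, by linarith, fun ε h1 h2 => ?_⟩)
    refine hd _ ?_ (by simp only; linarith)
    simp only [diamond, mem_ofPred_eq, sub_self, abs_zero, add_zero]
    rw [abs_of_pos] <;> linarith
  · intro w hw hws hw0
    refine hlow w ⟨hw0.le, ?_⟩ hws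
    have h1 : |w.1 - s| + |w.2 - x.2| < x.1 - s := hw
    rw [abs_of_neg (by linarith)] at h1
    have h2 := hxK.2
    have h3 := abs_sub_le w.2 x.2 z.2
    linarith

end Propagation

/-! ### Cutting off at the initial line -/

section Cutoff

variable {F : Type*} [NormedAddCommGroup F] [NormedSpace ℝ F]
  {O : Set Spacetime} {v w : Spacetime} {f f' : Spacetime → F}

/-- The open half plane `t > 0`. -/
def future : Set Spacetime := {z | 0 < z.1}

theorem measurableSet_future : MeasurableSet future :=
  (isOpen_lt continuous_const continuous_fst).measurableSet

theorem locallyIntegrableOn_indicator {E : Type*} [NormedAddCommGroup E] {k : Spacetime → E}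
    {P : Set Spacetime} (hP : MeasurableSet P) (h : LocallyIntegrableOn k O) :
    LocallyIntegrableOn (P.indicator k) O := fun x hx => by
  obtain ⟨s, hs, hi⟩ := h x hx
  exact ⟨s, hs, hi.indicator hP⟩

/-- Green's formula on a half plane without boundary term means that the extension by zero is
weakly differentiable. -/
theorem HasWeakDeriv.indicator_future (h : HasWeakDeriv O v f f')
    (hg : ∀ θ : Spacetime → ℝ, IsTestFunction O θ →
      ∫ z in future, (fderiv ℝ θ z v • f z + θ z • f' z) = 0) :
    HasWeakDeriv O v (future.indicator f) (future.indicator f') := by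
  refine ⟨locallyIntegrableOn_indicator measurableSet_future h.1,
    locallyIntegrableOn_indicator measurableSet_future h.2, fun θ hθ => ?_⟩
  have e1 := hg θ hθ
  rw [integral_add ((hθ.fderiv_apply v).integrable_smul h.1).integrableOn
    (hθ.integrable_smul h.2).integrableOn] at e1
  have e2 : ∀ (η : Spacetime → ℝ) (k : Spacetime → F),
      ∫ z, η z • future.indicator k z = ∫ z in future, η z • k z := fun η k => by
    rw [← integral_indicator measurableSet_future]
    congr 1
    ext z
    by_cases hz : z ∈ future <;> simp [hz]
  rw [e2 (fun z => fderiv ℝ θ z v) f, e2]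
  exact eq_neg_of_add_eq_zero_left e1

/-- The extension by zero from the half plane `t ≤ 0` is the difference of the function itself and
of its extension by zero from the half plane `t > 0`. -/
theorem HasWeakDeriv.indicator_future_compl (h : HasWeakDeriv O v f f')
    (hi : HasWeakDeriv O v (future.indicator f) (future.indicator f')) :
    HasWeakDeriv O v (futureᶜ.indicator f) (futureᶜ.indicator f') := by
  rw [indicator_compl, indicator_compl]
  exact h.sub hi

theorem exists_bound_deriv_smoothTransition :
    ∃ M : ℝ, 0 ≤ M ∧ (∀ s, |deriv Real.smoothTransition s| ≤ M) ∧
      ∀ s, s ∉ Icc (0 : ℝ) 1 → deriv Real.smoothTransition s = 0 := by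
  have hzero : ∀ s, s ∉ Icc (0 : ℝ) 1 → deriv Real.smoothTransition s = 0 := by
    intro s hs
    rw [mem_Icc, not_and_or, not_le, not_le] at hs
    rcases hs with hs | hs
    · have : Real.smoothTransition =ᶠ[nhds s] fun _ => 0 := by
        filter_upwards [Iio_mem_nhds hs] with x hx
        exact Real.smoothTransition.zero_of_nonpos (le_of_lt hx)
      rw [this.deriv_eq, deriv_const]
    · have : Real.smoothTransition =ᶠ[nhds s] fun _ => 1 := by
        filter_upwards [Ioi_mem_nhds hs] with x hx
        exact Real.smoothTransition.one_of_one_le (le_of_lt hx)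
      rw [this.deriv_eq, deriv_const]
  have hc : Continuous (deriv Real.smoothTransition) :=
    (Real.smoothTransition.contDiff (n := 1)).continuous_deriv (by simp)
  obtain ⟨M, hM⟩ := (isCompact_Icc (a := (0 : ℝ)) (b := 1)).exists_bound_of_continuousOn
    hc.continuousOn
  refine ⟨max M 0, le_max_right _ _, fun s => ?_, hzero⟩
  by_cases hs : s ∈ Icc (0 : ℝ) 1
  · exact (hM s hs).trans (le_max_left _ _)
  · rw [hzero s hs, abs_zero]
    exact le_max_right _ _

theorem IsTestFunction.continuous_smul {θ : Spacetime → ℝ} (hθ : IsTestFunction O θ)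
    (hO : IsOpen O) (hf : ContinuousOn f O) : Continuous fun z => θ z • f z := by
  refine continuous_iff_continuousAt.2 fun z => ?_
  by_cases hz : z ∈ O
  · exact hθ.smooth.continuous.continuousAt.smul (hf.continuousAt (hO.mem_nhds hz))
  · have hz' : z ∉ tsupport θ := fun h => hz (hθ.tsupport_subset h)
    have : (fun z => θ z • f z) =ᶠ[nhds z] fun _ => 0 := by
      filter_upwards [notMem_tsupport_iff_eventuallyEq.1 hz'] with y hy
      simp [hy]
    exact ContinuousAt.congr continuousAt_const (Filter.EventuallyEq.symm this)

/-- The boundary layer of the cutoffs `χ (n t)` does not contribute in the limit when the function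
vanishes at `t = 0`. -/
theorem tendsto_integral_boundary_layer {κ : Spacetime → F} (hκ : Continuous κ)
    (hs : HasCompactSupport κ) (h0 : ∀ x : ℝ, κ (0, x) = 0) :
    Filter.Tendsto (fun n : ℕ => ∫ z : Spacetime,
        (((n : ℝ) + 1) * deriv Real.smoothTransition (((n : ℝ) + 1) * z.1)) • κ z)
      Filter.atTop (nhds 0) := by
  obtain ⟨M, hM0, hM, hMz⟩ := exists_bound_deriv_smoothTransition
  obtain ⟨R, hR0, hR⟩ := hs.isCompact.isBounded.subset_closedBall_lt 0 (0 : Spacetime)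
  have huc : UniformContinuous κ :=
    hκ.uniformContinuous_of_tendsto_cocompact hs.is_zero_at_infty
  rw [Metric.tendsto_atTop]
  intro ε hε
  obtain ⟨δ, hδ, hδε⟩ := Metric.uniformContinuous_iff.1 huc (ε / (2 * R * (M + 1)))
    (by positivity)
  obtain ⟨n₀, hn₀⟩ := exists_nat_gt (1 / δ)
  refine ⟨n₀, fun n hn => ?_⟩
  have hn1 : (0 : ℝ) < (n : ℝ) + 1 := by positivity
  have hnδ : 1 / ((n : ℝ) + 1) < δ := by
    rw [div_lt_iff₀ hn1]
    rw [div_lt_iff₀ hδ] at hn₀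
    have : (n₀ : ℝ) ≤ n := by exact_mod_cast hn
    nlinarith
  set Sn : Set Spacetime := Icc 0 (1 / ((n : ℝ) + 1)) ×ˢ Icc (-R) R with hSn
  have hvol : (volume : Measure Spacetime).real Sn = 1 / ((n : ℝ) + 1) * (2 * R) := by
    rw [hSn, Measure.volume_eq_prod, Measure.real, Measure.prod_prod, ENNReal.toReal_mul,
      Real.volume_Icc, Real.volume_Icc, ENNReal.toReal_ofReal (by simp; positivity),
      ENNReal.toReal_ofReal (by linarith)]
    ring
  have hfin : (volume : Measure Spacetime) Sn < ⊤ :=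
    (isCompact_Icc.prod isCompact_Icc).measure_lt_top
  have hrestr : ∫ z : Spacetime,
      (((n : ℝ) + 1) * deriv Real.smoothTransition (((n : ℝ) + 1) * z.1)) • κ z
      = ∫ z in Sn, (((n : ℝ) + 1) * deriv Real.smoothTransition (((n : ℝ) + 1) * z.1)) • κ z := by
    refine (setIntegral_eq_integral_of_forall_compl_eq_zero fun z hz => ?_).symm
    rw [hSn, mem_prod, not_and_or] at hz
    rcases hz with hz | hz
    · rw [hMz, mul_zero, zero_smul]
      intro h
      refine hz ⟨?_, ?_⟩
      · exact nonneg_of_mul_nonneg_right h.1 hn1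
      · rw [le_div_iff₀ hn1, mul_comm]; exact h.2
    · have : κ z = 0 := by
        refine image_eq_zero_of_notMem_tsupport fun h => hz ?_
        have h1 := hR h
        rw [mem_closedBall_zero_iff, Prod.norm_def, max_le_iff] at h1
        exact abs_le.1 h1.2
      rw [this, smul_zero]
  rw [dist_zero_right, hrestr]
  have hb : ∀ z ∈ Sn,
      ‖(((n : ℝ) + 1) * deriv Real.smoothTransition (((n : ℝ) + 1) * z.1)) • κ z‖
        ≤ ((n : ℝ) + 1) * M * (ε / (2 * R * (M + 1))) := by
    intro z hz
    have hk : ‖κ z‖ ≤ ε / (2 * R * (M + 1)) := by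
      have h1 : dist z (0, z.2) < δ := by
        rw [Prod.dist_eq, dist_self, max_eq_left dist_nonneg, Real.dist_eq, sub_zero,
          abs_of_nonneg hz.1.1]
        exact hz.1.2.trans_lt hnδ
      have h2 := hδε h1
      rw [h0, dist_zero_right] at h2
      exact h2.le
    rw [norm_smul, Real.norm_eq_abs, abs_mul, abs_of_pos hn1]
    exact mul_le_mul (mul_le_mul_of_nonneg_left (hM _) hn1.le) hk (norm_nonneg _) (by positivity)
  refine (norm_setIntegral_le_of_norm_le_const hfin hb).trans_lt ?_
  rw [hvol]
  have : ((n : ℝ) + 1) * M * (ε / (2 * R * (M + 1))) * (1 / ((n : ℝ) + 1) * (2 * R))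
      = ε * (M / (M + 1)) := by field_simp
  rw [this]
  have h1 : M / (M + 1) < 1 := by rw [div_lt_one (by linarith)]; linarith
  nlinarith

/-- Extension by zero to the past of `t = 0` keeps weak derivatives in spatial directions, and, for
continuous functions vanishing at `t = 0`, in all directions. -/
theorem HasWeakDeriv.indicator_future_of_vanish (hO : IsOpen O) (h : HasWeakDeriv O v f f')
    (hv : v.1 = 0 ∨ (ContinuousOn f O ∧ ∀ x : ℝ, ((0, x) : Spacetime) ∈ O → f (0, x) = 0)) :
    HasWeakDeriv O v (future.indicator f) (future.indicator f') := by
  refine h.indicator_future fun θ hθ => ?_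
  -- smooth cutoffs that increase to the indicator function of the future
  set χ : ℕ → Spacetime → ℝ := fun n z => Real.smoothTransition (((n : ℝ) + 1) * z.1) with hχ
  have hχs : ∀ n, ContDiff ℝ ∞ (χ n) := fun n =>
    Real.smoothTransition.contDiff.comp (contDiff_const.mul contDiff_fst)
  have hχd : ∀ n z, fderiv ℝ (χ n) z v
      = ((n : ℝ) + 1) * deriv Real.smoothTransition (((n : ℝ) + 1) * z.1) * v.1 := by
    intro n z
    have h1 : HasFDerivAt (fun z : Spacetime => ((n : ℝ) + 1) * z.1)
        (((n : ℝ) + 1) • ContinuousLinearMap.fst ℝ ℝ ℝ) z :=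
      (ContinuousLinearMap.fst ℝ ℝ ℝ).hasFDerivAt.const_mul _
    have h2 := ((Real.smoothTransition.contDiff (n := 1)).differentiable (by simp)
      (((n : ℝ) + 1) * z.1)).hasDerivAt.comp_hasFDerivAt z h1
    have h3 := h2.fderiv
    rw [hχ]
    simp only [Function.comp_def] at h3
    rw [h3]
    simp
    ring
  have hi1 := (hθ.fderiv_apply v).integrable_smul h.1
  have hi2 := hθ.integrable_smul h.2
  have hDf : ∀ n, ∫ z, χ n z • (fderiv ℝ θ z v • f z + θ z • f' z)
      = - ∫ z, (fderiv ℝ (χ n) z v) • θ z • f z := by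
    intro n
    have ht := hθ.mul_left (hχs n)
    have e := h.3 _ ht
    have hd : ∀ z, fderiv ℝ (fun z => χ n z * θ z) z v
        = χ n z * fderiv ℝ θ z v + fderiv ℝ (χ n) z v * θ z := by
      intro z
      rw [fderiv_fun_mul ((hχs n).differentiable (by simp) z) (hθ.differentiableAt z)]
      simp
      ring
    have i1 : Integrable fun z => (χ n z * fderiv ℝ θ z v) • f z :=
      ((hθ.fderiv_apply v).mul_left (hχs n)).integrable_smul h.1
    have i2 : Integrable fun z => (fderiv ℝ (χ n) z v * θ z) • f z :=
      (hθ.mul_left (((hχs n).fderiv_right (m := ∞) (by simp)).clm_apply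
        contDiff_const)).integrable_smul h.1
    have i3 : Integrable fun z => (χ n z * θ z) • f' z := ht.integrable_smul h.2
    simp only [hd, add_smul] at e
    rw [integral_add i1 i2] at e
    simp only [smul_add, smul_smul]
    rw [integral_add i1 i3]
    rw [eq_neg_iff_add_eq_zero] at e ⊢
    rw [← e]
    abel
  have hlhs : Filter.Tendsto (fun n => ∫ z, χ n z • (fderiv ℝ θ z v • f z + θ z • f' z))
      Filter.atTop (nhds (∫ z in future, (fderiv ℝ θ z v • f z + θ z • f' z))) := by
    rw [← integral_indicator measurableSet_future]
    refine tendsto_integral_of_dominated_convergence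
      (fun z => ‖fderiv ℝ θ z v • f z + θ z • f' z‖) (fun n => ?_) (hi1.add hi2).norm
      (fun n => ae_of_all _ fun z => ?_) (ae_of_all _ fun z => ?_)
    · exact (hχs n).continuous.aestronglyMeasurable.smul (hi1.add hi2).1
    · rw [norm_smul, Real.norm_eq_abs, abs_of_nonneg (Real.smoothTransition.nonneg _)]
      exact mul_le_of_le_one_left (norm_nonneg _) (Real.smoothTransition.le_one _)
    · refine tendsto_const_nhds.congr' ?_
      by_cases hz : z ∈ future
      · have hz0 : 0 < z.1 := hz
        obtain ⟨n₀, hn₀⟩ := exists_nat_gt (1 / z.1)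
        filter_upwards [Filter.eventually_ge_atTop n₀] with n hn
        have : (n₀ : ℝ) ≤ n := by exact_mod_cast hn
        rw [div_lt_iff₀ hz0] at hn₀
        have h1 : χ n z = 1 := Real.smoothTransition.one_of_one_le (by nlinarith)
        rw [indicator_of_mem hz, h1, one_smul]
      · refine Filter.Eventually.of_forall fun n => ?_
        have hz0 : z.1 ≤ 0 := not_lt.1 hz
        have h1 : χ n z = 0 := Real.smoothTransition.zero_of_nonpos
          (mul_nonpos_of_nonneg_of_nonpos (by positivity) hz0)
        rw [indicator_of_notMem hz]
        simp only [h1, zero_smul]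
  have hrhs : Filter.Tendsto (fun n => ∫ z, (fderiv ℝ (χ n) z v) • θ z • f z)
      Filter.atTop (nhds 0) := by
    rcases hv with hv | ⟨hfc, hf0⟩
    · simp only [hχd, hv, mul_zero, zero_smul, integral_zero]
      exact tendsto_const_nhds
    · have hκc := hθ.continuous_smul hO hfc
      have hκs : HasCompactSupport fun z => θ z • f z := hθ.hasCompactSupport.smul_right
      have := (tendsto_integral_boundary_layer hκc hκs fun x => by
        by_cases hx : ((0, x) : Spacetime) ∈ O
        · rw [hf0 x hx, smul_zero]
        · have : θ (0, x) = 0 :=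
            image_eq_zero_of_notMem_tsupport fun h => hx (hθ.tsupport_subset h)
          rw [this, zero_smul]).const_smul v.1
      rw [smul_zero] at this
      refine this.congr fun n => ?_
      rw [← integral_smul]
      congr 1
      ext z
      rw [hχd, smul_smul, mul_comm v.1]
  have := tendsto_nhds_unique hlhs (by simpa only [hDf, neg_zero] using hrhs.neg)
  exact this

/-- The difference of two functions with the same initial trace, extended by zero to the past, is
weakly differentiable in time. -/
theorem HasInitialTrace.indicator_future_sub [CompleteSpace F] (hO : IsOpen O)
    {k k' l l' : Spacetime → F} {tr : ℝ → F}
    {O₁ O₂ : Set Spacetime} (hO₁ : O ⊆ O₁) (hO₂ : O ⊆ O₂)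
    (hk : HasInitialTrace O₁ k tr) (hl : HasInitialTrace O₂ l tr)
    (hk' : HasWeakDeriv O dt k k') (hl' : HasWeakDeriv O dt l l') :
    HasWeakDeriv O dt (future.indicator fun z => k z - l z)
      (future.indicator fun z => k' z - l' z) := by
  obtain ⟨-, k₁, -, hk₁, hkg⟩ := hk
  obtain ⟨-, l₁, -, hl₁, hlg⟩ := hl
  have hk₁' := hk₁.mono hO₁
  have hl₁' := hl₁.mono hO₂
  have e1 := hk₁'.unique hO hk'
  have e2 := hl₁'.unique hO hl'
  have main : HasWeakDeriv O dt (future.indicator fun z => k z - l z)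
      (future.indicator fun z => k₁ z - l₁ z) := by
    refine (hk₁'.sub hl₁').indicator_future fun θ hθ => ?_
    have hg := hkg θ (hθ.mono hO₁)
    have hg' := hlg θ (hθ.mono hO₂)
    have i1 : Integrable fun z => fderiv ℝ θ z dt • k z + θ z • k₁ z :=
      ((hθ.fderiv_apply dt).integrable_smul hk₁'.1).add (hθ.integrable_smul hk₁'.2)
    have i2 : Integrable fun z => fderiv ℝ θ z dt • l z + θ z • l₁ z :=
      ((hθ.fderiv_apply dt).integrable_smul hl₁'.1).add (hθ.integrable_smul hl₁'.2)
    have e3 : ∀ z, fderiv ℝ θ z dt • (k z - l z) + θ z • (k₁ z - l₁ z)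
        = (fderiv ℝ θ z dt • k z + θ z • k₁ z) - (fderiv ℝ θ z dt • l z + θ z • l₁ z) := by
      intro z
      simp only [smul_sub]
      abel
    simp only [e3]
    rw [integral_sub i1.integrableOn i2.integrableOn, sub_eq_zero]
    exact hg.trans hg'.symm
  refine main.congr hO.measurableSet (ae_of_all _ fun z _ => rfl) ?_
  filter_upwards [e1, e2] with z h1 h2 hz
  by_cases hzf : z ∈ future
  · simp only [indicator_of_mem hzf, h1 hz, h2 hz]
  · simp only [indicator_of_notMem hzf]

/-- Weak derivatives commute: if the mixed derivative exists in one order, then it exists in the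
other. -/
theorem HasWeakDeriv.comm {p pv pw pvw : Spacetime → F} (h1 : HasWeakDeriv O v p pv)
    (h2 : HasWeakDeriv O w p pw) (h3 : HasWeakDeriv O w pv pvw) : HasWeakDeriv O v pw pvw := by
  refine ⟨h2.2, h3.2, fun θ hθ => ?_⟩
  have e1 := h2.3 _ (hθ.fderiv_apply v)
  have e2 := h1.3 _ (hθ.fderiv_apply w)
  have e3 := h3.3 θ hθ
  have hsymm : ∀ z, fderiv ℝ (fun z => fderiv ℝ θ z v) z w
      = fderiv ℝ (fun z => fderiv ℝ θ z w) z v := by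
    intro z
    have hd : DifferentiableAt ℝ (fderiv ℝ θ) z :=
      ((hθ.smooth.fderiv_right (m := ∞) (by simp)).differentiable (by simp)) z
    have hs : IsSymmSndFDerivAt ℝ θ z :=
      hθ.smooth.contDiffAt.isSymmSndFDerivAt
        (by rw [minSmoothness_of_isRCLikeNormedField]; exact WithTop.coe_le_coe.2 le_top)
    rw [fderiv_clm_apply hd (by fun_prop), fderiv_clm_apply hd (by fun_prop)]
    simpa using hs w v
  simp only [hsymm] at e1
  exact (neg_injective (e1.symm.trans e2)).trans e3

end Cutoff

/-! ### Smoothness of the geometric coefficients in a chart -/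

section Geometry

variable {n : ℕ} {N : Type*} [TopologicalSpace N] [ChartedSpace (EuclideanSpace ℝ (Fin n)) N]
  [IsManifold 𝓘(ℝ, EuclideanSpace ℝ (Fin n)) ∞ N]
  (h : Bundle.ContMDiffRiemannianMetric 𝓘(ℝ, EuclideanSpace ℝ (Fin n)) ∞
    (EuclideanSpace ℝ (Fin n))
    (fun p : N => TangentSpace 𝓘(ℝ, EuclideanSpace ℝ (Fin n)) p))
  {e : OpenPartialHomeomorph N (EuclideanSpace ℝ (Fin n))}

theorem chart_mdifferentiable (he : e ∈ atlas (EuclideanSpace ℝ (Fin n)) N) :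
    e.MDifferentiable 𝓘(ℝ, EuclideanSpace ℝ (Fin n)) 𝓘(ℝ, EuclideanSpace ℝ (Fin n)) := by
  have : IsManifold 𝓘(ℝ, EuclideanSpace ℝ (Fin n)) 1 N :=
    IsManifold.of_le (n := ∞) (by exact_mod_cast le_top)
  exact mdifferentiable_of_mem_atlas he

theorem contMDiffOn_coordVector (he : e ∈ atlas (EuclideanSpace ℝ (Fin n)) N) (i : Fin n) :
    ContMDiffOn 𝓘(ℝ, EuclideanSpace ℝ (Fin n))
      (𝓘(ℝ, EuclideanSpace ℝ (Fin n)).prod 𝓘(ℝ, EuclideanSpace ℝ (Fin n))) ∞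
      (fun y => (⟨e.symm y, coordVector e y i⟩ :
        Bundle.TotalSpace (EuclideanSpace ℝ (Fin n))
          (fun p : N => TangentSpace 𝓘(ℝ, EuclideanSpace ℝ (Fin n)) p))) e.target := by
  have : IsManifold 𝓘(ℝ, EuclideanSpace ℝ (Fin n)) 1 N :=
    IsManifold.of_le (n := ∞) (by exact_mod_cast le_top)
  have h1 : ContMDiffOn 𝓘(ℝ, EuclideanSpace ℝ (Fin n)) 𝓘(ℝ, EuclideanSpace ℝ (Fin n)) ∞
      e.symm e.target :=
    contMDiffOn_symm_of_mem_maximalAtlas (IsManifold.subset_maximalAtlas he)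
  have h2 := h1.contMDiffOn_tangentMapWithin (m := ∞) (by simp) e.open_target.uniqueMDiffOn
  have h3 : ContMDiffOn 𝓘(ℝ, EuclideanSpace ℝ (Fin n))
      (𝓘(ℝ, EuclideanSpace ℝ (Fin n)).prod 𝓘(ℝ, EuclideanSpace ℝ (Fin n))) ∞
      (fun y : EuclideanSpace ℝ (Fin n) => (⟨y, EuclideanSpace.single i (1 : ℝ)⟩ :
        Bundle.TotalSpace (EuclideanSpace ℝ (Fin n))
          (fun p : EuclideanSpace ℝ (Fin n) =>
            TangentSpace 𝓘(ℝ, EuclideanSpace ℝ (Fin n)) p))) e.target := fun y _ =>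
    contMDiffWithinAt_vectorSpace_iff_contDiffWithinAt.2 contDiffWithinAt_const
  refine (h2.comp h3 fun y hy => hy).congr fun y hy => ?_
  simp only [Function.comp_def, tangentMapWithin, coordVector]
  rw [mfderivWithin_of_isOpen e.open_target hy]

theorem contDiffOn_metricMatrix (he : e ∈ atlas (EuclideanSpace ℝ (Fin n)) N) (i j : Fin n) :
    ContDiffOn ℝ ∞ (fun y => metricMatrix h e y i j) e.target := by
  rw [← contMDiffOn_iff_contDiffOn]
  intro y hy
  have hi := contMDiffOn_coordVector he i y hy
  have hj := contMDiffOn_coordVector he j y hy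
  have hb : ContMDiffWithinAt 𝓘(ℝ, EuclideanSpace ℝ (Fin n)) 𝓘(ℝ, EuclideanSpace ℝ (Fin n)) ∞
      e.symm e.target y :=
    contMDiffOn_symm_of_mem_maximalAtlas (IsManifold.subset_maximalAtlas he) y hy
  have : ContMDiffWithinAt 𝓘(ℝ, EuclideanSpace ℝ (Fin n))
      (𝓘(ℝ, EuclideanSpace ℝ (Fin n)).prod 𝓘(ℝ)) ∞
      (fun m => Bundle.TotalSpace.mk' ℝ (E := Bundle.Trivial N ℝ) (e.symm m)
        (h.inner (e.symm m) (coordVector e m i) (coordVector e m j))) e.target y := by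
    apply ContMDiffWithinAt.clm_bundle_apply₂ (F₁ := EuclideanSpace ℝ (Fin n))
      (F₂ := EuclideanSpace ℝ (Fin n))
    · exact ContMDiffAt.comp_contMDiffWithinAt y h.contMDiff.contMDiffAt hb
    · exact hi
    · exact hj
  simp only [Bundle.contMDiffWithinAt_totalSpace] at this
  exact this.2

/-- The metric matrix is a Gram matrix of linearly independent vectors: a vector in its kernel would
be the coordinate vector of a nonzero tangent vector of length zero. -/
theorem det_metricMatrix_ne_zero (he : e ∈ atlas (EuclideanSpace ℝ (Fin n)) N)
    {y : EuclideanSpace ℝ (Fin n)} (hy : y ∈ e.target) : (metricMatrix h e y).det ≠ 0 := by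
  intro hdet
  obtain ⟨x, hx0, hx⟩ := Matrix.exists_mulVec_eq_zero_iff.2 hdet
  let L : EuclideanSpace ℝ (Fin n) →L[ℝ]
      TangentSpace 𝓘(ℝ, EuclideanSpace ℝ (Fin n)) (e.symm y) :=
    mfderiv 𝓘(ℝ, EuclideanSpace ℝ (Fin n)) 𝓘(ℝ, EuclideanSpace ℝ (Fin n)) e.symm y
  have hL : Function.Injective L := (chart_mdifferentiable he).symm.mfderiv_injective hy
  have hLc : ∀ i, coordVector e y i = L (EuclideanSpace.single i (1 : ℝ)) := fun i => rfl
  set w : EuclideanSpace ℝ (Fin n) := ∑ i, x i • EuclideanSpace.single i (1 : ℝ) with hw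
  have hwx : ∀ i, w i = x i := fun i => by
    simp [hw, Finset.sum_apply, Pi.single_apply]
  have hw0 : w ≠ 0 := fun h0 => hx0 <| by
    ext i
    rw [← hwx i, h0]
    rfl
  have hpos := h.pos _ (L w) fun h0 => hw0 (hL (h0.trans (map_zero L).symm))
  have : h.inner (e.symm y) (L w) (L w) = x ⬝ᵥ (metricMatrix h e y).mulVec x := by
    have e1 : L w = ∑ i, x i • coordVector e y i := by
      simp only [hw, map_sum, map_smul, hLc]
    rw [e1]
    simp only [map_sum, map_smul, sum_apply, smul_apply,
      metricMatrix, dotProduct, Matrix.mulVec, Matrix.of_apply, Finset.mul_sum, smul_eq_mul]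
    rw [Finset.sum_comm]
    exact Finset.sum_congr rfl fun i _ => Finset.sum_congr rfl fun j _ => by ring
  rw [this, hx] at hpos
  simp at hpos

theorem contDiffOn_det {k : ℕ} {U : Set (EuclideanSpace ℝ (Fin n))}
    {M : EuclideanSpace ℝ (Fin n) → Matrix (Fin k) (Fin k) ℝ}
    (hM : ∀ i j, ContDiffOn ℝ ∞ (fun y => M y i j) U) :
    ContDiffOn ℝ ∞ (fun y => (M y).det) U := by
  simp only [Matrix.det_apply]
  exact ContDiffOn.sum fun σ _ => (contDiffOn_prod fun i _ => hM _ _).const_smul _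

theorem contDiffOn_metricMatrix_inv (he : e ∈ atlas (EuclideanSpace ℝ (Fin n)) N) (i j : Fin n) :
    ContDiffOn ℝ ∞ (fun y => (metricMatrix h e y)⁻¹ i j) e.target := by
  simp only [Matrix.inv_def, Matrix.smul_apply, Matrix.adjugate_apply, smul_eq_mul,
    Ring.inverse_eq_inv']
  refine ((contDiffOn_det (contDiffOn_metricMatrix h he)).inv
    fun y hy => det_metricMatrix_ne_zero h he hy).mul (contDiffOn_det fun k l => ?_)
  simp only [Matrix.updateRow_apply]
  split_ifs
  · exact contDiffOn_const
  · exact contDiffOn_metricMatrix h he k l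

theorem contDiffOn_partialDeriv {U : Set (EuclideanSpace ℝ (Fin n))} (hU : IsOpen U)
    {f : EuclideanSpace ℝ (Fin n) → ℝ} (hf : ContDiffOn ℝ ∞ f U) (i : Fin n) :
    ContDiffOn ℝ ∞ (partialDeriv i f) U :=
  (hf.fderiv_of_isOpen hU (m := ∞) (by simp)).clm_apply contDiffOn_const

theorem contDiffOn_christoffel (he : e ∈ atlas (EuclideanSpace ℝ (Fin n)) N) (k i j : Fin n) :
    ContDiffOn ℝ ∞ (christoffel h e k i j) e.target := by
  unfold christoffel
  refine contDiffOn_const.mul (ContDiffOn.sum fun l _ => ?_)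
  have hd := fun a b c => contDiffOn_partialDeriv e.open_target (contDiffOn_metricMatrix h he a b) c
  exact (contDiffOn_metricMatrix_inv h he k l).mul (((hd j l i).add (hd i l j)).sub (hd i j l))

theorem contDiffOn_curvature (he : e ∈ atlas (EuclideanSpace ℝ (Fin n)) N) (l k i j : Fin n) :
    ContDiffOn ℝ ∞ (curvature h e l k i j) e.target := by
  unfold curvature
  have hc := contDiffOn_christoffel h he
  have hd := fun a b c => contDiffOn_partialDeriv e.open_target (hc a b c)
  exact ((hd l j k i).sub (hd l i k j)).add (ContDiffOn.sum fun m _ =>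
    ((hc l i m).mul (hc m j k)).sub ((hc l j m).mul (hc m i k)))

/-- A vector spinor is determined by its components: `ψ = ψ^α ⊗ ∂/∂y^α`. -/
theorem spinorComponents_injective (he : e ∈ atlas (EuclideanSpace ℝ (Fin n)) N) {p : N}
    (hp : p ∈ e.source) : Function.Injective (spinorComponents e p) := by
  let D : TangentSpace 𝓘(ℝ, EuclideanSpace ℝ (Fin n)) p ≃L[ℝ] EuclideanSpace ℝ (Fin n) :=
    (chart_mdifferentiable he).mfderiv hp
  have hD : ∀ v i, coordForm e p i v = D v i := fun v i => rfl
  have key : ∀ s : VectorSpinor (n := n) p, s = ∑ i, spinorComponents e p s i ⊗ₜ[ℝ]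
      D.symm (EuclideanSpace.single i (1 : ℝ)) := by
    intro s
    refine TensorProduct.induction_on s ?_ (fun c v => ?_) fun a b ha hb => ?_
    · simp [spinorComponents]
    · have h1 : ∀ i, spinorComponents e p (c ⊗ₜ[ℝ] v) i = D v i • c := fun i => by
        rw [← hD]
        simp [spinorComponents]
      simp only [h1, TensorProduct.smul_tmul, ← TensorProduct.tmul_sum, ← map_smul, ← map_sum]
      congr 1
      apply D.injective
      rw [D.apply_symm_apply]
      ext i
      simp [Finset.sum_apply, Pi.single_apply]
    · conv_lhs => rw [ha, hb]
      rw [← Finset.sum_add_distrib]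
      refine Finset.sum_congr rfl fun i _ => ?_
      rw [← TensorProduct.add_tmul]
      simp [spinorComponents]
  intro s s' hs
  rw [key s, key s', hs]

theorem sigma_eq_of_components_eq (he : e ∈ atlas (EuclideanSpace ℝ (Fin n)) N) {p p' : N}
    (hp : p ∈ e.source) (hpp : p = p') (s : VectorSpinor (n := n) p)
    (s' : VectorSpinor (n := n) p') (hs : spinorComponents e p s = spinorComponents e p' s') :
    (⟨p, s⟩ : Σ p : N, VectorSpinor (n := n) p) = ⟨p', s'⟩ := by
  subst hpp
  rw [spinorComponents_injective he hp hs]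

end Geometry

theorem components_eq_of_sigma_eq {n : ℕ} {N : Type*} [TopologicalSpace N]
    [ChartedSpace (EuclideanSpace ℝ (Fin n)) N] {p p' : N} (s : VectorSpinor (n := n) p)
    (s' : VectorSpinor (n := n) p')
    (hs : (⟨p, s⟩ : Σ p : N, VectorSpinor (n := n) p) = ⟨p', s'⟩)
    (e : OpenPartialHomeomorph N (EuclideanSpace ℝ (Fin n))) :
    spinorComponents e p s = spinorComponents e p' s' := by
  have := congrArg (fun q : Σ p : N, VectorSpinor (n := n) p => spinorComponents e q.1 q.2) hs
  exact this

/-! ### Differences of solutions of semilinear null systems -/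

section Semilinear

variable {E : Type*} [NormedAddCommGroup E] [NormedSpace ℝ E]
  {S : Type*} [NormedAddCommGroup S] [NormedSpace ℝ S]

variable (E S) in
/-- The values of the coefficients of a semilinear null system
`W = a(f, g) + b(f) + c(g)`, `α' = m(f)`, `β' = k(g)`, listed in the order `(a, b, c, m, k)`. -/
abbrev NullCoeff : Type _ :=
  (E →L[ℝ] E →L[ℝ] E) × (E →L[ℝ] E) × (E →L[ℝ] E) × (E →L[ℝ] S) × (E →L[ℝ] S)

/-- The part of the unknowns on which the coefficients depend. -/
def NullField.state (Φ : NullField E S) (z : Spacetime) : E × S × S := (Φ.p z, Φ.α z, Φ.β z)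

/-- `Φ` solves the semilinear null system with coefficients `A` almost everywhere on `O`. -/
def NullField.Solves (Φ : NullField E S) (O : Set Spacetime) (A : E × S × S → NullCoeff E S) :
    Prop :=
  ∀ᵐ z, z ∈ O →
    Φ.W z = (A (Φ.state z)).1 (Φ.f z) (Φ.g z) + (A (Φ.state z)).2.1 (Φ.f z)
      + (A (Φ.state z)).2.2.1 (Φ.g z) ∧
    Φ.α' z = (A (Φ.state z)).2.2.2.1 (Φ.f z) ∧
    Φ.β' z = (A (Φ.state z)).2.2.2.2 (Φ.g z)

/-- The difference of two sets of unknowns, cut off outside `P`. -/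
noncomputable def NullField.cutSub (Φ Φ' : NullField E S) (P : Set Spacetime) : NullField E S :=
  ⟨P.indicator fun z => Φ.p z - Φ'.p z, P.indicator fun z => Φ.f z - Φ'.f z,
    P.indicator fun z => Φ.g z - Φ'.g z, P.indicator fun z => Φ.W z - Φ'.W z,
    P.indicator fun z => Φ.α z - Φ'.α z, P.indicator fun z => Φ.α' z - Φ'.α' z,
    P.indicator fun z => Φ.β z - Φ'.β z, P.indicator fun z => Φ.β' z - Φ'.β' z⟩

theorem norm_clm_sub_le {X X' : Type*} [NormedAddCommGroup X] [NormedSpace ℝ X]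
    [NormedAddCommGroup X'] [NormedSpace ℝ X'] (B B' : X →L[ℝ] X') (x x' : X) {K M : ℝ}
    (hK : ‖B - B'‖ ≤ K) (hM : ‖B'‖ ≤ M) :
    ‖B x - B' x'‖ ≤ K * ‖x‖ + M * ‖x - x'‖ := by
  have : B x - B' x' = (B - B') x + B' (x - x') := by simp
  rw [this]
  exact (norm_add_le _ _).trans (add_le_add ((B - B').le_of_opNorm_le hK x)
    (B'.le_of_opNorm_le hM _))

theorem norm_clm₂_sub_le (B B' : E →L[ℝ] E →L[ℝ] E) (x x' y y' : E) {K M : ℝ}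
    (hK : ‖B - B'‖ ≤ K) (hM : ‖B'‖ ≤ M) :
    ‖B x y - B' x' y'‖ ≤ K * ‖x‖ * ‖y‖ + M * ‖x - x'‖ * ‖y‖ + M * ‖x'‖ * ‖y - y'‖ := by
  have : B x y - B' x' y' = (B - B') x y + B' (x - x') y + B' x' (y - y') := by
    simp
  rw [this]
  refine (norm_add₃_le).trans (add_le_add (add_le_add ?_ ?_) ?_)
  · exact ((B - B').le_opNorm₂ x y).trans (by gcongr)
  · exact (B'.le_opNorm₂ _ _).trans (by gcongr)
  · exact (B'.le_opNorm₂ _ _).trans (by gcongr)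

theorem quadratic_bound {L M D f f' g g' df dg : ℝ} (hL : 0 ≤ L) (hM : 0 ≤ M) (hD : 0 ≤ D)
    (hf : 0 ≤ f) (hf' : 0 ≤ f') (hg : 0 ≤ g) (hg' : 0 ≤ g') (hdf : 0 ≤ df) (hdg : 0 ≤ dg) :
    L * D * f * g + M * df * g + M * f' * dg + (L * D * f + M * df) + (L * D * g + M * dg)
      ≤ (1 + 3 * L + 2 * M) *
        (D * ((1 + f + f') * (1 + g + g')) + df * (1 + g + g') + (1 + f + f') * dg) := by
  rw [← sub_nonneg]
  ring_nf
  positivity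

theorem linear_bound {L M D f f' df : ℝ} (hL : 0 ≤ L) (hM : 0 ≤ M) (hD : 0 ≤ D)
    (hf : 0 ≤ f) (hf' : 0 ≤ f') (hdf : 0 ≤ df) :
    L * D * f + M * df ≤ (1 + 3 * L + 2 * M) * (D * (1 + f + f') + df) := by
  rw [← sub_nonneg]
  ring_nf
  positivity

/-- The difference of two solutions satisfies the differential inequalities, with the null
derivatives of both solutions in the coefficients; they hold trivially where the difference
is cut off. -/
theorem NullField.isDominated_cutSub {Φ Φ' : NullField E S} {O P : Set Spacetime}
    {A : E × S × S → NullCoeff E S} {V : Set (E × S × S)} {L M : ℝ}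
    (hL0 : 0 ≤ L) (hM0 : 0 ≤ M)
    (hL : ∀ y ∈ V, ∀ y' ∈ V, ‖A y - A y'‖ ≤ L * ‖y - y'‖) (hM : ∀ y ∈ V, ‖A y‖ ≤ M)
    (hΦ : Φ.Solves O A) (hΦ' : Φ'.Solves O A)
    (hV : ∀ z ∈ O, Φ.state z ∈ V) (hV' : ∀ z ∈ O, Φ'.state z ∈ V) :
    (Φ.cutSub Φ' P).IsDominated O (1 + 3 * L + 2 * M) (fun z => 1 + ‖Φ.f z‖ + ‖Φ'.f z‖)
      fun z => 1 + ‖Φ.g z‖ + ‖Φ'.g z‖ := by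
  -- the bounds without cutoff, at a single event
  have key : ∀ᵐ z, z ∈ O →
      ‖Φ.W z - Φ'.W z‖ ≤ (1 + 3 * L + 2 * M) *
        ((‖Φ.p z - Φ'.p z‖ + ‖Φ.α z - Φ'.α z‖ + ‖Φ.β z - Φ'.β z‖) *
          ((1 + ‖Φ.f z‖ + ‖Φ'.f z‖) * (1 + ‖Φ.g z‖ + ‖Φ'.g z‖))
          + ‖Φ.f z - Φ'.f z‖ * (1 + ‖Φ.g z‖ + ‖Φ'.g z‖)
          + (1 + ‖Φ.f z‖ + ‖Φ'.f z‖) * ‖Φ.g z - Φ'.g z‖) ∧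
      ‖Φ.α' z - Φ'.α' z‖ ≤ (1 + 3 * L + 2 * M) *
        ((‖Φ.p z - Φ'.p z‖ + ‖Φ.α z - Φ'.α z‖ + ‖Φ.β z - Φ'.β z‖) *
          (1 + ‖Φ.f z‖ + ‖Φ'.f z‖) + ‖Φ.f z - Φ'.f z‖) ∧
      ‖Φ.β' z - Φ'.β' z‖ ≤ (1 + 3 * L + 2 * M) *
        ((‖Φ.p z - Φ'.p z‖ + ‖Φ.α z - Φ'.α z‖ + ‖Φ.β z - Φ'.β z‖) *
          (1 + ‖Φ.g z‖ + ‖Φ'.g z‖) + ‖Φ.g z - Φ'.g z‖) := by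
    filter_upwards [hΦ, hΦ'] with z h h' hz
    obtain ⟨h1, h2, h3⟩ := h hz
    obtain ⟨h1', h2', h3'⟩ := h' hz
    set D := ‖Φ.p z - Φ'.p z‖ + ‖Φ.α z - Φ'.α z‖ + ‖Φ.β z - Φ'.β z‖ with hD
    have hD0 : 0 ≤ D := by positivity
    have hst : ‖Φ.state z - Φ'.state z‖ ≤ D := by
      simp only [NullField.state, Prod.mk_sub_mk, Prod.norm_mk]
      have := norm_nonneg (Φ.p z - Φ'.p z)
      have := norm_nonneg (Φ.α z - Φ'.α z)
      have := norm_nonneg (Φ.β z - Φ'.β z)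
      refine max_le ?_ (max_le ?_ ?_) <;> linarith
    have hdiff : ‖A (Φ.state z) - A (Φ'.state z)‖ ≤ L * D :=
      (hL _ (hV z hz) _ (hV' z hz)).trans (mul_le_mul_of_nonneg_left hst hL0)
    have hbd : ‖A (Φ'.state z)‖ ≤ M := hM _ (hV' z hz)
    have d1 := (norm_fst_le _).trans hdiff
    have d2 := (norm_fst_le _).trans ((norm_snd_le _).trans hdiff)
    have d3 := (norm_fst_le _).trans ((norm_snd_le _).trans ((norm_snd_le _).trans hdiff))
    have d4 := (norm_fst_le _).trans ((norm_snd_le _).trans ((norm_snd_le _).trans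
      ((norm_snd_le _).trans hdiff)))
    have d5 := (norm_snd_le _).trans ((norm_snd_le _).trans ((norm_snd_le _).trans
      ((norm_snd_le _).trans hdiff)))
    have b1 := (norm_fst_le _).trans hbd
    have b2 := (norm_fst_le _).trans ((norm_snd_le _).trans hbd)
    have b3 := (norm_fst_le _).trans ((norm_snd_le _).trans ((norm_snd_le _).trans hbd))
    have b4 := (norm_fst_le _).trans ((norm_snd_le _).trans ((norm_snd_le _).trans
      ((norm_snd_le _).trans hbd)))
    have b5 := (norm_snd_le _).trans ((norm_snd_le _).trans ((norm_snd_le _).trans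
      ((norm_snd_le _).trans hbd)))
    have k1 := norm_clm₂_sub_le _ _ (Φ.f z) (Φ'.f z) (Φ.g z) (Φ'.g z) d1 b1
    have k2 := norm_clm_sub_le _ _ (Φ.f z) (Φ'.f z) d2 b2
    have k3 := norm_clm_sub_le _ _ (Φ.g z) (Φ'.g z) d3 b3
    have k4 := norm_clm_sub_le _ _ (Φ.f z) (Φ'.f z) d4 b4
    have k5 := norm_clm_sub_le _ _ (Φ.g z) (Φ'.g z) d5 b5
    have nf := norm_nonneg (Φ.f z)
    have nf' := norm_nonneg (Φ'.f z)
    have ng := norm_nonneg (Φ.g z)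
    have ng' := norm_nonneg (Φ'.g z)
    refine ⟨?_, ?_, ?_⟩
    · rw [h1, h1', add_sub_add_comm, add_sub_add_comm]
      exact (norm_add₃_le.trans (add_le_add (add_le_add k1 k2) k3)).trans
        (quadratic_bound hL0 hM0 hD0 nf nf' ng ng' (norm_nonneg _) (norm_nonneg _))
    · rw [h2, h2']
      exact k4.trans (linear_bound hL0 hM0 hD0 nf nf' (norm_nonneg _))
    · rw [h3, h3']
      exact k5.trans (linear_bound hL0 hM0 hD0 ng ng' (norm_nonneg _))
  refine ⟨?_, ?_, ?_⟩ <;>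
  · filter_upwards [key] with z hk hz
    by_cases hzP : z ∈ P
    · simp only [NullField.cutSub, indicator_of_mem hzP]
      first | exact (hk hz).1 | exact (hk hz).2.1 | exact (hk hz).2.2
    · simp [NullField.cutSub, indicator_of_notMem hzP]

/-- Near a state where the coefficients are continuously differentiable they are bounded and
Lipschitz. -/
theorem exists_coeff_bounds {A : E × S × S → NullCoeff E S} {y₀ : E × S × S}
    (hA : ContDiffAt ℝ 1 A y₀) :
    ∃ V : Set (E × S × S), IsOpen V ∧ y₀ ∈ V ∧ V ⊆ Metric.ball y₀ 1 ∧
      ∃ L M : ℝ, 0 ≤ L ∧ 0 ≤ M ∧ (∀ y ∈ V, ∀ y' ∈ V, ‖A y - A y'‖ ≤ L * ‖y - y'‖) ∧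
        ∀ y ∈ V, ‖A y‖ ≤ M := by
  obtain ⟨K, t, ht, hK⟩ := hA.exists_lipschitzOnWith
  obtain ⟨U, hUt, hUo, hU⟩ := mem_nhds_iff.1 ht
  refine ⟨U ∩ Metric.ball y₀ 1, hUo.inter Metric.isOpen_ball,
    ⟨hU, Metric.mem_ball_self one_pos⟩, inter_subset_right, K, ‖A y₀‖ + K, K.2, by positivity,
    fun y hy y' hy' => ?_, fun y hy => ?_⟩
  · have h1 := hK.dist_le_mul y (hUt hy.1) y' (hUt hy'.1)
    rwa [dist_eq_norm (A y), dist_eq_norm y] at h1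
  · have h1 := hK.dist_le_mul y (hUt hy.1) y₀ (hUt hU)
    have h2 : dist y y₀ ≤ 1 := (Metric.mem_ball.1 hy.2).le
    have h3 : (K : ℝ) * dist y y₀ ≤ K := mul_le_of_le_one_right K.2 h2
    rw [dist_eq_norm (A y)] at h1
    have h4 := norm_le_norm_add_norm_sub' (A y) (A y₀)
    linarith

end Semilinear

/-! ### The Dirac-wave map system in null coordinates -/

section Coefficients

variable {n : ℕ} {N : Type*} [TopologicalSpace N] [ChartedSpace (EuclideanSpace ℝ (Fin n)) N]
  [IsManifold 𝓘(ℝ, EuclideanSpace ℝ (Fin n)) ∞ N]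
  (h : Bundle.ContMDiffRiemannianMetric 𝓘(ℝ, EuclideanSpace ℝ (Fin n)) ∞
    (EuclideanSpace ℝ (Fin n))
    (fun p : N => TangentSpace 𝓘(ℝ, EuclideanSpace ℝ (Fin n)) p))
  (e : OpenPartialHomeomorph N (EuclideanSpace ℝ (Fin n)))

/-- The components of a vector spinor, from its two families of chiral components. -/
def spinorOf (α β : Fin n → ℂ) : Fin n → Spinor := fun γ => ![α γ, β γ]

theorem spinorOf_components (s : Fin n → Spinor) :
    spinorOf (fun γ => s γ 0) (fun γ => s γ 1) = s := by
  ext γ i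
  fin_cases i <;> rfl

/-- The real part of `⟨ψ^γ, i X · ψ^δ⟩`. -/
noncomputable def pairing (X : Spacetime) (s : Fin n → Spinor) (γ δ : Fin n) : ℝ :=
  (spinorProduct (s γ) (Complex.I • clifford X (s δ))).re

/-- The linear map `f ↦ f^β v`. -/
noncomputable def coordSmul {V : Type*} [NormedAddCommGroup V] [NormedSpace ℝ V] (β : Fin n)
    (v : V) : EuclideanSpace ℝ (Fin n) →L[ℝ] V :=
  (EuclideanSpace.proj β : EuclideanSpace ℝ (Fin n) →L[ℝ] ℝ).smulRight v

theorem coordSmul_apply {V : Type*} [NormedAddCommGroup V] [NormedSpace ℝ V] (β : Fin n)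
    (v : V) (f : EuclideanSpace ℝ (Fin n)) : coordSmul β v f = f β • v := rfl

/-- The coefficients of the Dirac-wave map system, written as a semilinear null system for the
coordinates of the map and the two chiral parts of the vector spinor. The Christoffel symbols enter
the quadratic term symmetrised, because `y_t^β y_t^γ - y_x^β y_x^γ` is the symmetric part of
`f^β g^γ`. -/
noncomputable def diracWaveCoeff
    (Y : EuclideanSpace ℝ (Fin n) × (Fin n → ℂ) × (Fin n → ℂ)) :
    NullCoeff (EuclideanSpace ℝ (Fin n)) (Fin n → ℂ) :=
  (∑ β, ∑ γ, coordSmul β (coordSmul γ (WithLp.toLp 2 fun α =>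
      -(1 / 2) * (christoffel h e α β γ Y.1 + christoffel h e α γ β Y.1))),
    ∑ β, coordSmul β (WithLp.toLp 2 fun α => (1 / 4) * ∑ γ, ∑ δ, curvature h e α β γ δ Y.1 *
      (pairing dt (spinorOf Y.2.1 Y.2.2) γ δ - pairing dx (spinorOf Y.2.1 Y.2.2) γ δ)),
    ∑ β, coordSmul β (WithLp.toLp 2 fun α => (1 / 4) * ∑ γ, ∑ δ, curvature h e α β γ δ Y.1 *
      (pairing dt (spinorOf Y.2.1 Y.2.2) γ δ + pairing dx (spinorOf Y.2.1 Y.2.2) γ δ)),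
    ∑ β, coordSmul β fun α => -∑ γ, christoffel h e α β γ Y.1 • Y.2.1 γ,
    ∑ β, coordSmul β fun α => -∑ γ, christoffel h e α β γ Y.1 • Y.2.2 γ)

theorem contDiff_pairing (X : Spacetime) (γ δ : Fin n) :
    ContDiff ℝ 1 fun Y : (Fin n → ℂ) × (Fin n → ℂ) => pairing X (spinorOf Y.1 Y.2) γ δ := by
  have h1 : ∀ i : Fin n, ContDiff ℝ 1 fun Y : (Fin n → ℂ) × (Fin n → ℂ) => Y.1 i := fun i => by
    fun_prop
  have h2 : ∀ i : Fin n, ContDiff ℝ 1 fun Y : (Fin n → ℂ) × (Fin n → ℂ) => Y.2 i := fun i => by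
    fun_prop
  have hc : ∀ {k : (Fin n → ℂ) × (Fin n → ℂ) → ℂ}, ContDiff ℝ 1 k →
      ContDiff ℝ 1 fun Y => (starRingEnd ℂ) (k Y) := fun hk => Complex.conjCLE.contDiff.comp hk
  have hre : ∀ {k : (Fin n → ℂ) × (Fin n → ℂ) → ℂ}, ContDiff ℝ 1 k →
      ContDiff ℝ 1 fun Y => (k Y).re := fun hk => Complex.reCLM.contDiff.comp hk
  refine hre ?_
  simp only [spinorProduct, spinorOf, clifford, gammaT, gammaX, Matrix.toLin'_apply,
    Pi.smul_apply, smul_eq_mul, Matrix.mulVec, dotProduct, Fin.sum_univ_two]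
  have h3 : ∀ i : Fin 2, ∀ j, ContDiff ℝ 1 fun Y : (Fin n → ℂ) × (Fin n → ℂ) =>
      (![Y.1 j, Y.2 j] : Fin 2 → ℂ) i := by
    intro i j
    fin_cases i
    · exact h1 j
    · exact h2 j
  have h4 : ∀ c₀ c₁ : ℂ, ∀ j, ContDiff ℝ 1 fun Y : (Fin n → ℂ) × (Fin n → ℂ) =>
      (starRingEnd ℂ) (Complex.I * (c₀ * (![Y.1 j, Y.2 j] : Fin 2 → ℂ) 0
        + c₁ * (![Y.1 j, Y.2 j] : Fin 2 → ℂ) 1)) := fun c₀ c₁ j =>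
    hc (contDiff_const.mul ((contDiff_const.mul (h3 0 j)).add (contDiff_const.mul (h3 1 j))))
  exact ((h3 1 γ).mul (h4 _ _ δ)).add ((h3 0 γ).mul (h4 _ _ δ))

theorem contDiffAt_coordSmul {V X : Type*} [NormedAddCommGroup V] [NormedSpace ℝ V]
    [NormedAddCommGroup X] [NormedSpace ℝ X] {v : X → V} {x : X} (hv : ContDiffAt ℝ 1 v x)
    (β : Fin n) : ContDiffAt ℝ 1 (fun x => coordSmul β (v x)) x := by
  unfold coordSmul
  exact contDiffAt_const.smulRight hv

variable {e} in
theorem contDiffAt_diracWaveCoeff (he : e ∈ atlas (EuclideanSpace ℝ (Fin n)) N)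
    {Y : EuclideanSpace ℝ (Fin n) × (Fin n → ℂ) × (Fin n → ℂ)} (hY : Y.1 ∈ e.target) :
    ContDiffAt ℝ 1 (diracWaveCoeff h e) Y := by
  have hnhds := e.open_target.mem_nhds hY
  have hG : ∀ k i j, ContDiffAt ℝ 1 (fun Y : EuclideanSpace ℝ (Fin n) × (Fin n → ℂ) × (Fin n → ℂ) =>
      christoffel h e k i j Y.1) Y := fun k i j =>
    (((contDiffOn_christoffel h he k i j).contDiffAt hnhds).of_le
      (by exact_mod_cast le_top)).comp Y contDiffAt_fst
  have hR : ∀ l k i j, ContDiffAt ℝ 1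
      (fun Y : EuclideanSpace ℝ (Fin n) × (Fin n → ℂ) × (Fin n → ℂ) =>
        curvature h e l k i j Y.1) Y := fun l k i j =>
    (((contDiffOn_curvature h he l k i j).contDiffAt hnhds).of_le
      (by exact_mod_cast le_top)).comp Y contDiffAt_fst
  have hP : ∀ X γ δ, ContDiffAt ℝ 1
      (fun Y : EuclideanSpace ℝ (Fin n) × (Fin n → ℂ) × (Fin n → ℂ) =>
        pairing X (spinorOf Y.2.1 Y.2.2) γ δ) Y := fun X γ δ =>
    (contDiff_pairing X γ δ).contDiffAt.comp Y contDiffAt_snd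
  have hα : ∀ γ, ContDiffAt ℝ 1 (fun Y : EuclideanSpace ℝ (Fin n) × (Fin n → ℂ) × (Fin n → ℂ) =>
      Y.2.1 γ) Y := fun γ => by fun_prop
  have hβ : ∀ γ, ContDiffAt ℝ 1 (fun Y : EuclideanSpace ℝ (Fin n) × (Fin n → ℂ) × (Fin n → ℂ) =>
      Y.2.2 γ) Y := fun γ => by fun_prop
  unfold diracWaveCoeff
  refine ContDiffAt.prodMk ?_ (ContDiffAt.prodMk ?_ (ContDiffAt.prodMk ?_
    (ContDiffAt.prodMk ?_ ?_)))
  · refine ContDiffAt.sum fun β _ => ContDiffAt.sum fun γ _ =>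
      contDiffAt_coordSmul (contDiffAt_coordSmul ((contDiffAt_euclidean).2 fun α => ?_) _) _
    exact contDiffAt_const.mul ((hG α β γ).add (hG α γ β))
  · refine ContDiffAt.sum fun β _ => contDiffAt_coordSmul ((contDiffAt_euclidean).2 fun α => ?_) _
    exact contDiffAt_const.mul (ContDiffAt.sum fun γ _ => ContDiffAt.sum fun δ _ =>
      (hR α β γ δ).mul ((hP dt γ δ).sub (hP dx γ δ)))
  · refine ContDiffAt.sum fun β _ => contDiffAt_coordSmul ((contDiffAt_euclidean).2 fun α => ?_) _
    exact contDiffAt_const.mul (ContDiffAt.sum fun γ _ => ContDiffAt.sum fun δ _ =>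
      (hR α β γ δ).mul ((hP dt γ δ).add (hP dx γ δ)))
  · refine ContDiffAt.sum fun β _ => contDiffAt_coordSmul (contDiffAt_pi.2 fun α => ?_) _
    exact (ContDiffAt.sum fun γ _ => (hG α β γ).smul (hα γ)).neg
  · refine ContDiffAt.sum fun β _ => contDiffAt_coordSmul (contDiffAt_pi.2 fun α => ?_) _
    exact (ContDiffAt.sum fun γ _ => (hG α β γ).smul (hβ γ)).neg

/-- The wave map equation in null form: with `f = y_t + y_x` and `g = y_t - y_x`, the derivative
`y_tt - y_xx` is a quadratic form in `(f, g)` plus curvature terms linear in `f` and in `g`. -/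
theorem wave_equation_null {y yt yx ytt yxx : EuclideanSpace ℝ (Fin n)} {s : Fin n → Spinor}
    (heq : ∀ α, tension h e α y yt yx ytt yxx
      = (1 / 2) * (curvatureTerm h e α y dt s yt - curvatureTerm h e α y dx s yx)) :
    ytt - yxx = (diracWaveCoeff h e (y, fun γ => s γ 0, fun γ => s γ 1)).1 (yt + yx) (yt - yx)
      + (diracWaveCoeff h e (y, fun γ => s γ 0, fun γ => s γ 1)).2.1 (yt + yx)
      + (diracWaveCoeff h e (y, fun γ => s γ 0, fun γ => s γ 1)).2.2.1 (yt - yx) := by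
  ext α
  have h1 := heq α
  simp only [tension, curvatureTerm] at h1
  have hquad : ∑ β, ∑ γ, christoffel h e α β γ y * (yt β * yt γ - yx β * yx γ)
      = -∑ β, ∑ γ, (yt β + yx β) * ((yt γ - yx γ) *
        (-(1 / 2) * (christoffel h e α β γ y + christoffel h e α γ β y))) := by
    have e1 : ∑ β, ∑ γ, (yt β + yx β) * ((yt γ - yx γ) * (-(1 / 2) *
          (christoffel h e α β γ y + christoffel h e α γ β y)))
        = ∑ β, ∑ γ, (yt β + yx β) * ((yt γ - yx γ) * (-(1 / 2) * christoffel h e α β γ y))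
          + ∑ β, ∑ γ, (yt γ + yx γ) * ((yt β - yx β) * (-(1 / 2) * christoffel h e α β γ y)) := by
      rw [Finset.sum_comm (f := fun β γ =>
        (yt γ + yx γ) * ((yt β - yx β) * (-(1 / 2) * christoffel h e α β γ y)))]
      simp only [← Finset.sum_add_distrib]
      exact Finset.sum_congr rfl fun β _ => Finset.sum_congr rfl fun γ _ => by ring
    rw [e1]
    simp only [← Finset.sum_add_distrib, ← Finset.sum_neg_distrib]
    exact Finset.sum_congr rfl fun β _ => Finset.sum_congr rfl fun γ _ => by ring
  have hcurv : (1 / 2) * (∑ β, ∑ γ, ∑ δ, curvature h e α β γ δ y *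
          (spinorProduct (s γ) (Complex.I • clifford dt (s δ))).re * yt β
        - ∑ β, ∑ γ, ∑ δ, curvature h e α β γ δ y *
          (spinorProduct (s γ) (Complex.I • clifford dx (s δ))).re * yx β)
      = ∑ β, (yt β + yx β) * ((1 / 4) * ∑ γ, ∑ δ, curvature h e α β γ δ y *
          (pairing dt s γ δ - pairing dx s γ δ))
        + ∑ β, (yt β - yx β) * ((1 / 4) * ∑ γ, ∑ δ, curvature h e α β γ δ y *
          (pairing dt s γ δ + pairing dx s γ δ)) := by
    simp only [← Finset.sum_add_distrib, ← Finset.sum_sub_distrib, Finset.mul_sum, pairing]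
    exact Finset.sum_congr rfl fun β _ => Finset.sum_congr rfl fun γ _ =>
      Finset.sum_congr rfl fun δ _ => by ring
  rw [hquad, hcurv] at h1
  simp only [diracWaveCoeff, sum_apply, smul_apply, coordSmul_apply, spinorOf_components,
    PiLp.add_apply, PiLp.sub_apply, PiLp.smul_apply, smul_eq_mul, WithLp.ofLp_sum, Finset.sum_apply]
  linarith

/-- The Dirac equation in null form: each chirality satisfies a transport equation along its own
null direction. -/
theorem dirac_equation_null {y yt yx : EuclideanSpace ℝ (Fin n)} {s st sx : Fin n → Spinor}
    (heq : ∀ α, twistedDirac h e α y yt yx s st sx = 0) :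
    (fun γ => st γ 0 + sx γ 0)
        = (diracWaveCoeff h e (y, fun γ => s γ 0, fun γ => s γ 1)).2.2.2.1 (yt + yx) ∧
      (fun γ => st γ 1 - sx γ 1)
        = (diracWaveCoeff h e (y, fun γ => s γ 0, fun γ => s γ 1)).2.2.2.2 (yt - yx) := by
  constructor
  · ext α
    have h1 := congrFun (heq α) 1
    simp [twistedDirac, clifford, gammaT, gammaX, Fin.sum_univ_two, dotProduct,
      Finset.sum_apply] at h1
    simp [diracWaveCoeff, sum_apply, coordSmul_apply, Finset.sum_apply]
    have e1 : ∑ β, ((yt β : ℂ) + (yx β : ℂ)) * ∑ γ, (christoffel h e α β γ y : ℂ) * s γ 0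
        = ∑ β, ∑ γ, (christoffel h e α β γ y : ℂ) * (yt β : ℂ) * s γ 0
          + ∑ β, ∑ γ, (christoffel h e α β γ y : ℂ) * (yx β : ℂ) * s γ 0 := by
      simp only [Finset.mul_sum, ← Finset.sum_add_distrib]
      exact Finset.sum_congr rfl fun β _ => Finset.sum_congr rfl fun γ _ => by ring
    rw [e1]
    linear_combination h1
  · ext α
    have h1 := congrFun (heq α) 0
    simp [twistedDirac, clifford, gammaT, gammaX, Fin.sum_univ_two, dotProduct,
      Finset.sum_apply] at h1
    simp [diracWaveCoeff, sum_apply, coordSmul_apply, Finset.sum_apply]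
    have e1 : ∑ β, ((yt β : ℂ) - (yx β : ℂ)) * ∑ γ, (christoffel h e α β γ y : ℂ) * s γ 1
        = ∑ β, ∑ γ, (christoffel h e α β γ y : ℂ) * (yt β : ℂ) * s γ 1
          - ∑ β, ∑ γ, (christoffel h e α β γ y : ℂ) * (yx β : ℂ) * s γ 1 := by
      simp only [Finset.mul_sum, ← Finset.sum_sub_distrib]
      exact Finset.sum_congr rfl fun β _ => Finset.sum_congr rfl fun γ _ => by ring
    rw [e1]
    linear_combination h1

end Coefficients

/-! ### Local representatives and their null fields -/

section WaveField

/-- The coordinates `y` of a map and the components `s` of a vector spinor in a chart, together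
with their weak partial derivatives of the orders that occur in the Dirac-wave map system. -/
structure WaveField (n : ℕ) where
  y : Spacetime → EuclideanSpace ℝ (Fin n)
  yt : Spacetime → EuclideanSpace ℝ (Fin n)
  yx : Spacetime → EuclideanSpace ℝ (Fin n)
  ytt : Spacetime → EuclideanSpace ℝ (Fin n)
  ytx : Spacetime → EuclideanSpace ℝ (Fin n)
  yxx : Spacetime → EuclideanSpace ℝ (Fin n)
  s : Spacetime → Fin n → Spinor
  st : Spacetime → Fin n → Spinor
  sx : Spacetime → Fin n → Spinor

namespace WaveField

variable {n : ℕ} {O O' O₁ O₂ : Set Spacetime} {Φ Φ' : WaveField n}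

/-- The derivatives recorded in a `WaveField` are weak derivatives on `O`. -/
structure IsWeak (Φ : WaveField n) (O : Set Spacetime) : Prop where
  y_t : HasWeakDeriv O dt Φ.y Φ.yt
  y_x : HasWeakDeriv O dx Φ.y Φ.yx
  yt_t : HasWeakDeriv O dt Φ.yt Φ.ytt
  yt_x : HasWeakDeriv O dx Φ.yt Φ.ytx
  yx_x : HasWeakDeriv O dx Φ.yx Φ.yxx
  s_t : HasWeakDeriv O dt Φ.s Φ.st
  s_x : HasWeakDeriv O dx Φ.s Φ.sx

theorem IsWeak.mono (h : Φ.IsWeak O) (hO : O' ⊆ O) : Φ.IsWeak O' :=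
  ⟨h.y_t.mono hO, h.y_x.mono hO, h.yt_t.mono hO, h.yt_x.mono hO, h.yx_x.mono hO, h.s_t.mono hO,
    h.s_x.mono hO⟩

/-- The unknowns in null directions `∂_t ± ∂_x`; the two chiral parts of the vector spinor are
differentiated in one null direction each. -/
def toNullField (Φ : WaveField n) : NullField (EuclideanSpace ℝ (Fin n)) (Fin n → ℂ) :=
  ⟨Φ.y, fun z => Φ.yt z + Φ.yx z, fun z => Φ.yt z - Φ.yx z, fun z => Φ.ytt z - Φ.yxx z,
    fun z γ => Φ.s z γ 0, fun z γ => Φ.st z γ 0 + Φ.sx z γ 0,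
    fun z γ => Φ.s z γ 1, fun z γ => Φ.st z γ 1 - Φ.sx z γ 1⟩

/-- The components of one chirality. -/
noncomputable def chiralPart (n : ℕ) (i : Fin 2) : (Fin n → Spinor) →L[ℝ] Fin n → ℂ :=
  ContinuousLinearMap.pi fun γ =>
    (ContinuousLinearMap.proj i : Spinor →L[ℝ] ℂ).comp (ContinuousLinearMap.proj γ)

theorem IsWeak.toNullField (h : Φ.IsWeak O) : Φ.toNullField.IsWeak O (1, 1) (1, -1) := by
  have e₁ : dt + dx = (1, 1) := by simp
  have e₂ : dt - dx = (1, -1) := by simp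
  have hyx_t : HasWeakDeriv O dt Φ.yx Φ.ytx := h.y_t.comm h.y_x h.yt_x
  have hO : ∀ {f f' g' : Spacetime → EuclideanSpace ℝ (Fin n)} {v : Spacetime},
      HasWeakDeriv O v f f' → (∀ z, f' z = g' z) → HasWeakDeriv O v f g' := fun hf he => by
    rwa [funext he] at hf
  refine ⟨?_, ?_, ?_, ?_, ?_, ?_⟩
  · exact e₁ ▸ h.y_t.add_dir h.y_x
  · exact e₂ ▸ h.y_t.sub_dir h.y_x
  · refine hO (e₂ ▸ (h.yt_t.add hyx_t).sub_dir (h.yt_x.add h.yx_x)) fun z => ?_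
    simp only [WaveField.toNullField]
    abel
  · refine hO (e₁ ▸ (h.yt_t.sub hyx_t).add_dir (h.yt_x.sub h.yx_x)) fun z => ?_
    simp only [WaveField.toNullField]
    abel
  · exact e₁ ▸ (h.s_t.clm_comp (chiralPart n 0)).add_dir (h.s_x.clm_comp (chiralPart n 0))
  · exact e₂ ▸ (h.s_t.clm_comp (chiralPart n 1)).sub_dir (h.s_x.clm_comp (chiralPart n 1))

/-- The difference of two local representatives, cut off outside `P`. -/
noncomputable def cutSub (Φ Φ' : WaveField n) (P : Set Spacetime) : WaveField n :=
  ⟨P.indicator fun z => Φ.y z - Φ'.y z, P.indicator fun z => Φ.yt z - Φ'.yt z,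
    P.indicator fun z => Φ.yx z - Φ'.yx z, P.indicator fun z => Φ.ytt z - Φ'.ytt z,
    P.indicator fun z => Φ.ytx z - Φ'.ytx z, P.indicator fun z => Φ.yxx z - Φ'.yxx z,
    P.indicator fun z => Φ.s z - Φ'.s z, P.indicator fun z => Φ.st z - Φ'.st z,
    P.indicator fun z => Φ.sx z - Φ'.sx z⟩

theorem toNullField_cutSub (Φ Φ' : WaveField n) (P : Set Spacetime) :
    (Φ.cutSub Φ' P).toNullField = Φ.toNullField.cutSub Φ'.toNullField P := by
  simp only [toNullField, cutSub, NullField.cutSub, NullField.mk.injEq]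
  refine ⟨trivial, ?_, ?_, ?_, ?_, ?_, ?_, ?_⟩ <;>
  · funext z
    by_cases hz : z ∈ P
    · simp only [indicator_of_mem hz]
      first
        | rfl
        | (funext γ; simp only [Pi.sub_apply]; ring)
        | abel
    · simp only [indicator_of_notMem hz]
      first
        | (funext γ; simp)
        | simp

/-- If two local representatives have the same initial values, and the same initial velocity in the
sense of traces, then their difference may be cut off in the past. -/
theorem IsWeak.cutSub_future (hO : IsOpen O) (h : Φ.IsWeak O) (h' : Φ'.IsWeak O)
    (hy : ContinuousOn Φ.y O) (hy' : ContinuousOn Φ'.y O)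
    (hs : ContinuousOn Φ.s O) (hs' : ContinuousOn Φ'.s O)
    (hy₀ : ∀ x : ℝ, ((0, x) : Spacetime) ∈ O → Φ.y (0, x) = Φ'.y (0, x))
    (hs₀ : ∀ x : ℝ, ((0, x) : Spacetime) ∈ O → Φ.s (0, x) = Φ'.s (0, x))
    {k l : Spacetime → EuclideanSpace ℝ (Fin n)} {tr : ℝ → EuclideanSpace ℝ (Fin n)}
    (hO₁ : O ⊆ O₁) (hO₂ : O ⊆ O₂) (hk : HasInitialTrace O₁ k tr) (hl : HasInitialTrace O₂ l tr)
    (hky : ∀ᵐ z, z ∈ O → Φ.yt z = k z) (hly : ∀ᵐ z, z ∈ O → Φ'.yt z = l z) :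
    (Φ.cutSub Φ' future).IsWeak O := by
  have hy_c : ContinuousOn (fun z => Φ.y z - Φ'.y z) O ∧
      ∀ x : ℝ, ((0, x) : Spacetime) ∈ O → Φ.y (0, x) - Φ'.y (0, x) = 0 :=
    ⟨hy.sub hy', fun x hx => sub_eq_zero.2 (hy₀ x hx)⟩
  have hs_c : ContinuousOn (fun z => Φ.s z - Φ'.s z) O ∧
      ∀ x : ℝ, ((0, x) : Spacetime) ∈ O → Φ.s (0, x) - Φ'.s (0, x) = 0 :=
    ⟨hs.sub hs', fun x hx => sub_eq_zero.2 (hs₀ x hx)⟩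
  refine ⟨(h.y_t.sub h'.y_t).indicator_future_of_vanish hO (Or.inr hy_c),
    (h.y_x.sub h'.y_x).indicator_future_of_vanish hO (Or.inl rfl), ?_,
    (h.yt_x.sub h'.yt_x).indicator_future_of_vanish hO (Or.inl rfl),
    (h.yx_x.sub h'.yx_x).indicator_future_of_vanish hO (Or.inl rfl),
    (h.s_t.sub h'.s_t).indicator_future_of_vanish hO (Or.inr hs_c),
    (h.s_x.sub h'.s_x).indicator_future_of_vanish hO (Or.inl rfl)⟩
  refine (hk.indicator_future_sub hO hO₁ hO₂ hl
    (h.yt_t.congr hO.measurableSet hky (ae_of_all _ fun _ _ => rfl))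
    (h'.yt_t.congr hO.measurableSet hly (ae_of_all _ fun _ _ => rfl))).congr hO.measurableSet ?_
    (ae_of_all _ fun _ _ => rfl)
  filter_upwards [hky, hly] with z h1 h2 hz
  simp only [cutSub, indicator]
  rw [h1 hz, h2 hz]

theorem IsWeak.cutSub_future_compl (h : Φ.IsWeak O) (h' : Φ'.IsWeak O)
    (hc : (Φ.cutSub Φ' future).IsWeak O) : (Φ.cutSub Φ' futureᶜ).IsWeak O :=
  ⟨(h.y_t.sub h'.y_t).indicator_future_compl hc.y_t,
    (h.y_x.sub h'.y_x).indicator_future_compl hc.y_x,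
    (h.yt_t.sub h'.yt_t).indicator_future_compl hc.yt_t,
    (h.yt_x.sub h'.yt_x).indicator_future_compl hc.yt_x,
    (h.yx_x.sub h'.yx_x).indicator_future_compl hc.yx_x,
    (h.s_t.sub h'.s_t).indicator_future_compl hc.s_t,
    (h.s_x.sub h'.s_x).indicator_future_compl hc.s_x⟩

/-- The Dirac-wave map system in a chart, as a semilinear null system. -/
theorem solves_toNullField {N : Type*} [TopologicalSpace N]
    [ChartedSpace (EuclideanSpace ℝ (Fin n)) N] [IsManifold 𝓘(ℝ, EuclideanSpace ℝ (Fin n)) ∞ N]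
    {h : Bundle.ContMDiffRiemannianMetric 𝓘(ℝ, EuclideanSpace ℝ (Fin n)) ∞
      (EuclideanSpace ℝ (Fin n))
      (fun p : N => TangentSpace 𝓘(ℝ, EuclideanSpace ℝ (Fin n)) p)}
    {e : OpenPartialHomeomorph N (EuclideanSpace ℝ (Fin n))}
    (heq : ∀ᵐ z : Spacetime, z ∈ O → ∀ α : Fin n,
      tension h e α (Φ.y z) (Φ.yt z) (Φ.yx z) (Φ.ytt z) (Φ.yxx z)
          = (1 / 2) * (curvatureTerm h e α (Φ.y z) dt (Φ.s z) (Φ.yt z)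
              - curvatureTerm h e α (Φ.y z) dx (Φ.s z) (Φ.yx z)) ∧
        twistedDirac h e α (Φ.y z) (Φ.yt z) (Φ.yx z) (Φ.s z) (Φ.st z) (Φ.sx z) = 0) :
    Φ.toNullField.Solves O (diracWaveCoeff h e) := by
  filter_upwards [heq] with z hz hzO
  exact ⟨wave_equation_null h e fun α => (hz hzO α).1,
    dirac_equation_null h e fun α => (hz hzO α).2⟩

end WaveField

end WaveField

/-! ### Propagation of coincidence -/

theorem NullField.norm_cutSub_le {E S : Type*} [NormedAddCommGroup E] [NormedAddCommGroup S]
    {Φ Φ' : NullField E S} {P : Set Spacetime} {y₀ : E × S × S}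
    {z : Spacetime} (h : Φ.state z ∈ Metric.ball y₀ 1) (h' : Φ'.state z ∈ Metric.ball y₀ 1) :
    ‖(Φ.cutSub Φ' P).α z‖ ≤ 2 ∧ ‖(Φ.cutSub Φ' P).β z‖ ≤ 2 := by
  have h2 : ‖Φ.state z - Φ'.state z‖ ≤ 2 := by
    rw [← dist_eq_norm]
    have := dist_triangle_right (Φ.state z) (Φ'.state z) y₀
    rw [Metric.mem_ball] at h h'
    linarith
  have h3 := (norm_snd_le _).trans h2
  have hα : ‖Φ.α z - Φ'.α z‖ ≤ 2 := (norm_fst_le _).trans h3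
  have hβ : ‖Φ.β z - Φ'.β z‖ ≤ 2 := (norm_snd_le _).trans h3
  exact ⟨(norm_indicator_le_norm_self (fun z => Φ.α z - Φ'.α z) z).trans hα,
    (norm_indicator_le_norm_self (fun z => Φ.β z - Φ'.β z) z).trans hβ⟩

theorem diamond_subset_ball {τ x ρ r : ℝ} {q : Spacetime} (hτ : |τ - q.1| < r) (hx : |x - q.2| < r)
    (hρ : ρ < r) : diamond τ x ρ ⊆ Metric.ball q (2 * r) := by
  intro z hz
  have hz' : |z.1 - τ| + |z.2 - x| < ρ := hz
  have h1 := abs_sub_le z.1 τ q.1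
  have h2 := abs_sub_le z.2 x q.2
  have h3 := abs_nonneg (z.1 - τ)
  have h4 := abs_nonneg (z.2 - x)
  rw [Metric.mem_ball, Prod.dist_eq, Real.dist_eq, Real.dist_eq, max_lt_iff]
  constructor <;> linarith

theorem reflect_mem_diamond {τ x ρ : ℝ} {z : Spacetime} (hz : z ∈ diamond τ x ρ) :
    ((-z.1, z.2) : Spacetime) ∈ diamond (-τ) x ρ := by
  have h1 : |-z.1 - -τ| = |z.1 - τ| := by rw [← abs_neg]; congr 1; ring
  have h2 : |z.1 - τ| + |z.2 - x| < ρ := hz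
  change |-z.1 - -τ| + |z.2 - x| < ρ
  rwa [h1]

section Uniqueness

variable {n : ℕ} {N : Type*} [TopologicalSpace N] [ChartedSpace (EuclideanSpace ℝ (Fin n)) N]

/-- The events at which two maps with vector spinors along them coincide. -/
def coincidenceSet (φ φ' : Spacetime → N) (ψ : ∀ z, VectorSpinor (n := n) (φ z))
    (ψ' : ∀ z, VectorSpinor (n := n) (φ' z)) : Set Spacetime :=
  {z | (⟨φ z, ψ z⟩ : Σ p : N, VectorSpinor (n := n) p) = ⟨φ' z, ψ' z⟩}

variable {φ φ' : Spacetime → N} {ψ : ∀ z, VectorSpinor (n := n) (φ z)}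
  {ψ' : ∀ z, VectorSpinor (n := n) (φ' z)}

theorem map_eq_of_mem_coincidenceSet {z : Spacetime} (hz : z ∈ coincidenceSet φ φ' ψ ψ') :
    φ z = φ' z :=
  congrArg Sigma.fst hz

variable [IsManifold 𝓘(ℝ, EuclideanSpace ℝ (Fin n)) ∞ N]
  {h : Bundle.ContMDiffRiemannianMetric 𝓘(ℝ, EuclideanSpace ℝ (Fin n)) ∞
    (EuclideanSpace ℝ (Fin n))
    (fun p : N => TangentSpace 𝓘(ℝ, EuclideanSpace ℝ (Fin n)) p)}

/-- At a limit of coincidence events the maps agree because `N` is Hausdorff, and the vector spinors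
agree because their components in a chart about the common value are continuous. -/
theorem isClosed_coincidenceSet [T2Space N] (hsol : IsDiracWaveMap h φ ψ)
    (hsol' : IsDiracWaveMap h φ' ψ') : IsClosed (coincidenceSet φ φ' ψ ψ') := by
  refine isClosed_of_closure_subset fun z hz => ?_
  have hφ : φ z = φ' z :=
    closure_minimal (fun w hw => map_eq_of_mem_coincidenceSet hw)
      (isClosed_eq hsol.continuous_map hsol'.continuous_map) hz
  set e := chartAt (EuclideanSpace ℝ (Fin n)) (φ z) with he
  have hea : e ∈ atlas (EuclideanSpace ℝ (Fin n)) N := chart_mem_atlas _ _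
  have hz1 : φ z ∈ e.source := mem_chart_source _ _
  refine sigma_eq_of_components_eq hea hz1 hφ _ _ ?_
  have hc := (hsol.continuousOn_spinor e hea).continuousAt
    ((e.open_source.preimage hsol.continuous_map).mem_nhds hz1)
  have hc' := (hsol'.continuousOn_spinor e hea).continuousAt
    ((e.open_source.preimage hsol'.continuous_map).mem_nhds (hφ ▸ hz1 : φ' z ∈ e.source))
  by_contra hne
  refine mem_closure_iff_frequently.1 hz ?_
  filter_upwards [(hc.sub hc').eventually_ne (sub_ne_zero.2 hne)] with w hw hwZ
  exact sub_ne_zero.1 hw (components_eq_of_sigma_eq _ _ hwZ e)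

/-- The local representative of a weak solution in a chart solves the semilinear null system. -/
theorem IsDiracWaveMap.exists_waveField (hsol : IsDiracWaveMap h φ ψ)
    {e : OpenPartialHomeomorph N (EuclideanSpace ℝ (Fin n))}
    (he : e ∈ atlas (EuclideanSpace ℝ (Fin n)) N) :
    ∃ Φ : WaveField n, Φ.y = (fun z => e (φ z)) ∧
      Φ.s = (fun z => spinorComponents e (φ z) (ψ z)) ∧ Φ.IsWeak (φ ⁻¹' e.source) ∧
      Φ.toNullField.Solves (φ ⁻¹' e.source) (diracWaveCoeff h e) := by
  obtain ⟨φt, φx, φtt, φtx, φxx, ψt, ψx, h1, h2, h3, h4, heq⟩ := hsol.equations e he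
  refine ⟨⟨fun z => e (φ z), φt, φx, φtt, φtx, φxx,
    fun z => spinorComponents e (φ z) (ψ z), ψt, ψx⟩, rfl, rfl, ?_, ?_⟩
  · exact ⟨h1.weak_dt, h1.weak_dx, h2.weak_dt, h2.weak_dx, h3.weak_dx, h4.weak_dt, h4.weak_dx⟩
  · exact WaveField.solves_toNullField heq

theorem WaveField.continuousOn_state {Φ : WaveField n} {O : Set Spacetime}
    (hy : ContinuousOn Φ.y O) (hs : ContinuousOn Φ.s O) : ContinuousOn Φ.toNullField.state O :=
  hy.prodMk (((chiralPart n 0).continuous.comp_continuousOn hs).prodMk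
    ((chiralPart n 1).continuous.comp_continuousOn hs))

/-- Near an event where the solutions coincide, coincidence propagates through small causal
diamonds, towards the future (`σ = 1`) and towards the past (`σ = -1`). -/
theorem exists_diamond_coincidence (hsol : IsDiracWaveMap h φ ψ) (hsol' : IsDiracWaveMap h φ' ψ')
    {φ₀ : ℝ → N} {φ₁ : ∀ x, TangentSpace 𝓘(ℝ, EuclideanSpace ℝ (Fin n)) (φ₀ x)}
    {ψ₀ : ∀ x, VectorSpinor (n := n) (φ₀ x)}
    (hdata : HasInitialData φ ψ φ₀ φ₁ ψ₀) (hdata' : HasInitialData φ' ψ' φ₀ φ₁ ψ₀)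
    {q : Spacetime} (hq : q ∈ coincidenceSet φ φ' ψ ψ') {σ : ℝ} (hσ : σ = 1 ∨ σ = -1) :
    ∃ r > 0, ∀ τ x ρ, |τ - q.1| < r → |x - q.2| < r → ρ < r →
      (∀ z ∈ diamond τ x ρ, σ * (z.1 - τ) < 0 → 0 < σ * z.1 → z ∈ coincidenceSet φ φ' ψ ψ') →
      ∀ z ∈ diamond τ x ρ, 0 < σ * z.1 → z ∈ coincidenceSet φ φ' ψ ψ' := by
  set Z := coincidenceSet φ φ' ψ ψ' with hZdef
  have h0 : ∀ x : ℝ, ((0, x) : Spacetime) ∈ Z := fun x =>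
    (hdata.spinor_eq x).trans (hdata'.spinor_eq x).symm
  set e := chartAt (EuclideanSpace ℝ (Fin n)) (φ q) with he_def
  have he : e ∈ atlas (EuclideanSpace ℝ (Fin n)) N := chart_mem_atlas _ _
  have hq1 : φ q ∈ e.source := mem_chart_source _ _
  have hq2 : φ' q ∈ e.source := map_eq_of_mem_coincidenceSet hq ▸ hq1
  obtain ⟨Φ, hΦy, hΦs, hΦw, hΦsol⟩ := hsol.exists_waveField he
  obtain ⟨Φ', hΦy', hΦs', hΦw', hΦsol'⟩ := hsol'.exists_waveField he
  -- both solutions have the same local representative at coinciding events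
  have hZy : ∀ z ∈ Z, Φ.y z = Φ'.y z := fun z hz => by
    rw [hΦy, hΦy']
    exact congrArg e (map_eq_of_mem_coincidenceSet hz)
  have hZs : ∀ z ∈ Z, Φ.s z = Φ'.s z := fun z hz => by
    rw [hΦs, hΦs']
    exact components_eq_of_sigma_eq _ _ hz e
  have hO₁ : IsOpen (φ ⁻¹' e.source) := e.open_source.preimage hsol.continuous_map
  have hO₂ : IsOpen (φ' ⁻¹' e.source) := e.open_source.preimage hsol'.continuous_map
  have hy : ContinuousOn Φ.y (φ ⁻¹' e.source) := hΦy ▸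
    e.continuousOn.comp hsol.continuous_map.continuousOn (mapsTo_preimage _ _)
  have hy' : ContinuousOn Φ'.y (φ' ⁻¹' e.source) := hΦy' ▸
    e.continuousOn.comp hsol'.continuous_map.continuousOn (mapsTo_preimage _ _)
  have hs : ContinuousOn Φ.s (φ ⁻¹' e.source) := hΦs ▸ hsol.continuousOn_spinor e he
  have hs' : ContinuousOn Φ'.s (φ' ⁻¹' e.source) := hΦs' ▸ hsol'.continuousOn_spinor e he
  -- a neighbourhood where both states stay in a set on which the coefficients are controlled
  have hstate : Φ.toNullField.state q = Φ'.toNullField.state q := by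
    simp only [NullField.state, WaveField.toNullField, hZy q hq, hZs q hq]
  have htarget : (Φ.toNullField.state q).1 ∈ e.target := by
    simp only [NullField.state, WaveField.toNullField, hΦy]
    exact e.map_source hq1
  obtain ⟨V, hVo, hqV, hVb, L, M, hL0, hM0, hL, hM⟩ :=
    exists_coeff_bounds (contDiffAt_diracWaveCoeff h he htarget)
  set O : Set Spacetime := (φ ⁻¹' e.source ∩ Φ.toNullField.state ⁻¹' V) ∩
    (φ' ⁻¹' e.source ∩ Φ'.toNullField.state ⁻¹' V) with hOdef
  have hO : IsOpen O :=
    ((WaveField.continuousOn_state hy hs).isOpen_inter_preimage hO₁ hVo).inter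
      ((WaveField.continuousOn_state hy' hs').isOpen_inter_preimage hO₂ hVo)
  have hqO : q ∈ O := ⟨⟨hq1, hqV⟩, hq2, by rw [mem_preimage, ← hstate]; exact hqV⟩
  have hOs₁ : O ⊆ φ ⁻¹' e.source := fun z hz => hz.1.1
  have hOs₂ : O ⊆ φ' ⁻¹' e.source := fun z hz => hz.2.1
  have hw := hΦw.mono hOs₁
  have hw' := hΦw'.mono hOs₂
  -- the velocity of the initial data is the trace of the weak derivative
  obtain ⟨k, hk, hktr⟩ := hdata.velocity_eq e he
  obtain ⟨l, hl, hltr⟩ := hdata'.velocity_eq e he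
  have hky : ∀ᵐ z, z ∈ O → Φ.yt z = k z := hw.y_t.unique hO (hΦy ▸ hk.mono hOs₁)
  have hly : ∀ᵐ z, z ∈ O → Φ'.yt z = l z := hw'.y_t.unique hO (hΦy' ▸ hl.mono hOs₂)
  have hcut : (Φ.cutSub Φ' future).IsWeak O :=
    hw.cutSub_future hO hw' (hy.mono hOs₁) (hy'.mono hOs₂) (hs.mono hOs₁) (hs'.mono hOs₂)
      (fun x _ => hZy _ (h0 x)) (fun x _ => hZs _ (h0 x)) hOs₁ hOs₂ hktr hltr hky hly
  -- the half plane in which the difference is kept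
  obtain ⟨P, hP, hPσ, hPσ'⟩ : ∃ P, (Φ.cutSub Φ' P).IsWeak O ∧ (∀ z : Spacetime, 0 < σ * z.1 → z ∈ P)
      ∧ ∀ z ∈ P, z.1 = 0 ∨ 0 < σ * z.1 := by
    rcases hσ with rfl | rfl
    · refine ⟨future, hcut, fun z hz => by simpa [future] using hz, fun z hz => Or.inr ?_⟩
      simpa [future] using hz
    · refine ⟨futureᶜ, hw.cutSub_future_compl hw' hcut, fun z hz => ?_, fun z hz => ?_⟩
      · have : z.1 < 0 := by linarith
        simpa [future] using this.le
      · have : z.1 ≤ 0 := by simpa [future] using hz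
        rcases this.eq_or_lt with h1 | h1
        · exact Or.inl h1
        · exact Or.inr (by linarith)
  have hΔ := hP.toNullField
  rw [WaveField.toNullField_cutSub] at hΔ
  obtain ⟨r₁, hr₁, huniq⟩ := NullField.exists_diamond_uniqueness hO hqO hw.toNullField
    hw'.toNullField hΔ (C := 1 + 3 * L + 2 * M) (by linarith)
    (NullField.isDominated_cutSub hL0 hM0 hL hM
      (hΦsol.mono fun z hz hzO => hz (hOs₁ hzO)) (hΦsol'.mono fun z hz hzO => hz (hOs₂ hzO))
      (fun z hz => hz.1.2) fun z hz => hz.2.2)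
    (fun z hz => NullField.norm_cutSub_le (hVb hz.1.2) (hVb hz.2.2))
  obtain ⟨δ, hδ, hball⟩ := Metric.isOpen_iff.1 hO q hqO
  refine ⟨min r₁ (δ / 2), lt_min hr₁ (half_pos hδ), fun τ x ρ hτ hx hρ hpast => ?_⟩
  rw [lt_min_iff] at hτ hx hρ
  have hDO : diamond τ x ρ ⊆ O := by
    refine (diamond_subset_ball hτ.2 hx.2 hρ.2).trans ?_
    rwa [mul_div_cancel₀ δ two_ne_zero]
  have hzero := huniq τ x ρ hτ.1 hx.1 hρ.1 σ hσ fun z hz hzτ => by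
    by_cases hzP : z ∈ P
    · have hzZ : z ∈ Z := by
        rcases hPσ' z hzP with h1 | h1
        · have : z = (0, z.2) := Prod.ext h1 rfl
          exact this ▸ h0 z.2
        · exact hpast z hz hzτ h1
      simp only [NullField.cutSub, indicator_of_mem hzP, WaveField.toNullField, hZy z hzZ,
        hZs z hzZ, sub_self, and_self]
    · simp only [NullField.cutSub, indicator_of_notMem hzP, and_self]
  -- by continuity the solutions agree at every event of the open set, not only at almost every one
  set U : Set Spacetime := diamond τ x ρ ∩ {z | 0 < σ * z.1} with hU
  have hUo : IsOpen U := (isOpen_diamond τ x ρ).inter (isOpen_lt (by fun_prop) (by fun_prop))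
  have hUO : U ⊆ O := inter_subset_left.trans hDO
  have hae : Φ.toNullField.state =ᵐ[volume.restrict U] Φ'.toNullField.state := by
    rw [Filter.EventuallyEq, ae_restrict_iff' hUo.measurableSet]
    filter_upwards [hzero] with z hz hzU
    obtain ⟨h1, h2, h3⟩ := hz hzU.1
    simp only [NullField.cutSub, indicator_of_mem (hPσ z hzU.2), sub_eq_zero] at h1 h2 h3
    simp only [NullField.state, h1, h2, h3]
  have heq := Measure.eqOn_open_of_ae_eq hae hUo
    ((WaveField.continuousOn_state hy hs).mono (hUO.trans hOs₁))
    ((WaveField.continuousOn_state hy' hs').mono (hUO.trans hOs₂))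
  intro z hz hzσ
  have hzU : z ∈ U := ⟨hz, hzσ⟩
  have hst := heq hzU
  simp only [NullField.state, WaveField.toNullField, Prod.mk.injEq] at hst
  have hφz : φ z = φ' z :=
    e.injOn (hOs₁ (hUO hzU)) (hOs₂ (hUO hzU)) (by simpa only [hΦy, hΦy'] using hst.1)
  refine sigma_eq_of_components_eq he (hOs₁ (hUO hzU)) hφz _ _ ?_
  have hsz : Φ.s z = Φ'.s z := by
    rw [← spinorOf_components (Φ.s z), ← spinorOf_components (Φ'.s z), hst.2.1, hst.2.2]
  simpa only [hΦs, hΦs'] using hsz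

/-- The solutions coincide at all events; those with `t < 0` are reached by reflecting time. -/
theorem mem_coincidenceSet [T2Space N] (hsol : IsDiracWaveMap h φ ψ)
    (hsol' : IsDiracWaveMap h φ' ψ') {φ₀ : ℝ → N}
    {φ₁ : ∀ x, TangentSpace 𝓘(ℝ, EuclideanSpace ℝ (Fin n)) (φ₀ x)}
    {ψ₀ : ∀ x, VectorSpinor (n := n) (φ₀ x)}
    (hdata : HasInitialData φ ψ φ₀ φ₁ ψ₀) (hdata' : HasInitialData φ' ψ' φ₀ φ₁ ψ₀)
    (z : Spacetime) : z ∈ coincidenceSet φ φ' ψ ψ' := by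
  have h0 : ∀ x : ℝ, ((0, x) : Spacetime) ∈ coincidenceSet φ φ' ψ ψ' := fun x =>
    (hdata.spinor_eq x).trans (hdata'.spinor_eq x).symm
  have hZ := isClosed_coincidenceSet hsol hsol'
  rcases le_total 0 z.1 with hz | hz
  · refine mem_of_diamond_propagation hZ h0 (fun q hq _ => ?_) z hz
    obtain ⟨r, hr, H⟩ := exists_diamond_coincidence hsol hsol' hdata hdata' hq (Or.inl rfl)
    refine ⟨r, hr, fun τ x ρ _ hτ hx hρ hpast w hw hw0 => ?_⟩
    exact H τ x ρ hτ hx hρ (fun w hw h1 h2 => hpast w hw (by linarith) (by linarith)) w hw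
      (by linarith)
  · -- the past of the initial line is the future for the reflected time
    have hR : Continuous fun w : Spacetime => ((-w.1, w.2) : Spacetime) := by fun_prop
    have key := mem_of_diamond_propagation (hZ.preimage hR) (fun x => by simpa using h0 x)
      (fun q hq _ => ?_) (-z.1, z.2) (by simpa using hz)
    · simpa using key
    obtain ⟨r, hr, H⟩ := exists_diamond_coincidence hsol hsol' hdata hdata' hq (Or.inr rfl)
    refine ⟨r, hr, fun τ x ρ _ hτ hx hρ hpast w hw hw0 => ?_⟩
    refine H (-τ) x ρ ?_ hx hρ (fun w hw h1 h2 => ?_) _ (reflect_mem_diamond hw) (by simpa)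
    · rwa [neg_sub_neg, abs_sub_comm]
    · have hw' := reflect_mem_diamond hw
      rw [neg_neg] at hw'
      simpa using hpast _ hw' (by simp only; linarith) (by simp only; linarith)

end Uniqueness

end DiracWave

theorem mainTheorem3 {n : ℕ} {N : Type*} [TopologicalSpace N] [T2Space N] [CompactSpace N]
    [ChartedSpace (EuclideanSpace ℝ (Fin n)) N]
    [IsManifold 𝓘(ℝ, EuclideanSpace ℝ (Fin n)) ∞ N]
    (h : Bundle.ContMDiffRiemannianMetric 𝓘(ℝ, EuclideanSpace ℝ (Fin n)) ∞
      (EuclideanSpace ℝ (Fin n))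
      (fun p : N => TangentSpace 𝓘(ℝ, EuclideanSpace ℝ (Fin n)) p))
    (φ φ' : DiracWave.Spacetime → N)
    (ψ : ∀ z, DiracWave.VectorSpinor (n := n) (φ z))
    (ψ' : ∀ z, DiracWave.VectorSpinor (n := n) (φ' z))
    (hsol : DiracWave.IsDiracWaveMap h φ ψ)
    (hsol' : DiracWave.IsDiracWaveMap h φ' ψ')
    (φ₀ : ℝ → N) (φ₁ : ∀ x, TangentSpace 𝓘(ℝ, EuclideanSpace ℝ (Fin n)) (φ₀ x))
    (ψ₀ : ∀ x, DiracWave.VectorSpinor (n := n) (φ₀ x))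
    (hdata : DiracWave.HasInitialData φ ψ φ₀ φ₁ ψ₀)
    (hdata' : DiracWave.HasInitialData φ' ψ' φ₀ φ₁ ψ₀) :
    φ = φ' ∧ ∀ z : DiracWave.Spacetime,
      (⟨φ z, ψ z⟩ : Σ p : N, DiracWave.VectorSpinor (n := n) p) = ⟨φ' z, ψ' z⟩ :=
  have hall := DiracWave.mem_coincidenceSet hsol hsol' hdata hdata'
  ⟨funext fun z => DiracWave.map_eq_of_mem_coincidenceSet (hall z), hall⟩
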